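/- Let $\Gamma$ be a finite graph with $N\ge 1$ edges $e_1,\dots,e_N$ of length one, each identified with $[0,1]$ (loops, multiple edges and disconnected graphs are allowed). Let $U$ be a unitary $2N\times 2N$ matrix indexed by the $2N$ edge ends which couples only ends at the same vertex (it is block diagonal with respect to the vertices), and let $a_j\in C^2([0,1])$, $b_j\in C([0,1])$, $j=1,\dots,N$, be real-valued (the damping and the potential). Let $H$ be the operator $$H\begin{pmatrix}\psi_1\\ \psi_2\end{pmatrix}=\begin{pmatrix}\psi_2\\ \psi_1''+b\,\psi_1-2a\,\psi_2\end{pmatrix}$$ in $L^2(\Gamma)\oplus L^2(\Gamma)$, whose domain consists of all $(\psi_1,\psi_2)$ such that all edge components of $\psi_1$ and $\psi_2$ are in $W^{2,2}(0,1)$ and both $\psi_1$ and $\psi_2$ satisfy the coupling condition $(U-I)\Psi+i(U+I)\Psi'=0$, where $\Psi$ is the vector of boundary values at the edge ends and $\Psi'$ the vector of derivatives there, taken in the direction into the edge. Standard coupling is the case in which the block of $U$ at a vertex of degree $d$ is $\frac2d J-I$, where $J$ is the $d\times d$ matrix of ones. Eigenvalues are counted with algebraic multiplicity. For $R>0$ and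 an open interval $I\subset\mathbb R$ put $$\mu_R(I)=\frac{\#\{\lambda:\ \operatorname{Re}\lambda\in I,\ |\operatorname{Im}\lambda|<R\}}{\#\{\lambda:\ |\operatorname{Im}\lambda|<R\}},\qquad \mu(I)=\lim_{R\to\infty}\mu_R(I),$$ where $\lambda$ runs through the eigenvalues of $H$. A real number $c$ is called a high frequency abscissa of $H$ if there is a sequence $(\lambda_n)$ of eigenvalues of $H$ with $\operatorname{Im}\lambda_n\to+\infty$ or $\operatorname{Im}\lambda_n\to-\infty$, and $\operatorname{Re}\lambda_n\to c$. Then, for every $R$, only finitely many eigenvalues satisfy $|\operatorname{Im}\lambda|<R$, all algebraic multiplicities are finite, and the following hold. (i) For every open (bounded or unbounded) interval $I\subset\mathbb R$ none of whose endpoints is a high frequency abscissa, $\mu(I)$ exists and $\mu(I)=\frac{m_I}{2N}$ with an integer $m_I\ge 0$. (ii) There are at most $2N$ high frequency abscissas $c_j$, and there are positive integers $m_{c_j}$ with $\sum_j m_{c_j}=2N$ such that $\mu((c_j-\varepsilon,c_j+\varepsilon))=\frac{m_{c_j}}{2N}$ for every $\varepsilon>0$ with $\varepsilon<|c_i-c_j|$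 for all $i\ne j$. If $c\in\mathbb R$ is not one of the $c_j$, then $\mu((c-\varepsilon,c+\varepsilon))=0$ for all sufficiently small $\varepsilon>0$. (iii) If $\Gamma$ is bipartite, then all $m_{c_j}$ are even. (iv) If $\Gamma$ is a tree all of whose vertices have odd degree, then there is a damping $a=(a_j)$ with $a_j\in C^2([0,1])$ such that, for every continuous potential $b$, the operator $H$ with standard coupling has at least $N$ high frequency abscissas $c_j$ (with $m_{c_j}>0$). -/

import Mathlib

open MeasureTheory Filter Topology

noncomputable section

namespace DampedGraph

/-- A graph with vertex set `V` and `N` edges of unit length (loops, parallel edges and several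
components are allowed).  The edge `e` is parametrised by `[0,1]`; its end at `x = 0` is
`(e, 0)`, its end at `x = 1` is `(e, 1)`, and `vert` is the vertex at which an edge end sits. -/
structure EdgeGraph (V : Type*) (N : ℕ) where
  vert : Fin N × Fin 2 → V

namespace EdgeGraph

variable {V : Type*} {N : ℕ}

/-- The degree of a vertex: the number of edge ends at it (a loop counts twice). -/
def degree (Γ : EdgeGraph V N) (v : V) : ℕ := Nat.card {p : Fin N × Fin 2 // Γ.vert p = v}

/-- The vertices can be two-coloured so that every edge joins vertices of different colours. -/
def IsBipartite (Γ : EdgeGraph V N) : Prop :=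
  ∃ col : V → Bool, ∀ e : Fin N, col (Γ.vert (e, 0)) ≠ col (Γ.vert (e, 1))

/-- The adjacency relation of the graph. -/
def toSimpleGraph (Γ : EdgeGraph V N) : SimpleGraph V :=
  SimpleGraph.fromRel fun u v => ∃ e : Fin N, Γ.vert (e, 0) = u ∧ Γ.vert (e, 1) = v

/-- No loops, no parallel edges, and the adjacency graph is a tree. -/
structure IsTree (Γ : EdgeGraph V N) : Prop where
  no_loop : ∀ e : Fin N, Γ.vert (e, 0) ≠ Γ.vert (e, 1)
  no_parallel : Function.Injective fun e : Fin N => s(Γ.vert (e, 0), Γ.vert (e, 1))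
  isTree : Γ.toSimpleGraph.IsTree

/-- The coupling matrix `U` only couples edge ends that sit at the same vertex, i.e. it is block
diagonal with one block for each vertex. -/
def IsLocal (Γ : EdgeGraph V N) (U : Matrix (Fin N × Fin 2) (Fin N × Fin 2) ℂ) : Prop :=
  ∀ p q, Γ.vert p ≠ Γ.vert q → U p q = 0

open Classical in
/-- Standard coupling: the block of a vertex of degree `d` is `(2 / d) J - I`. -/
def standardCoupling (Γ : EdgeGraph V N) : Matrix (Fin N × Fin 2) (Fin N × Fin 2) ℂ :=
  fun p q => (if Γ.vert p = Γ.vert q then 2 / (Γ.degree (Γ.vert p) : ℂ) else 0)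
    - (if p = q then 1 else 0)

end EdgeGraph

/-- Lebesgue measure on `[0,1]`. -/
abbrev unitVol : Measure ℝ := volume.restrict (Set.Icc (0 : ℝ) 1)

/-- The space `L²(0,1)` of one edge. -/
abbrev EdgeL2 : Type := Lp ℂ 2 unitVol

/-- `f ∈ W^{2,2}(0,1)` with second derivative `h ∈ L²`, boundary values `p = (f(0), f(1))` and
derivatives at the ends directed into the edge, `q = (f'(0), -f'(1))`: the class `f` has a
representative `g ∈ C¹[0,1]` whose derivative `g₁` is absolutely continuous with `g₁' = h`. -/
def IsW22 (f h : EdgeL2) (p q : Fin 2 → ℂ) : Prop :=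
  ∃ g g₁ : ℝ → ℂ, f =ᵐ[unitVol] g ∧
    (∀ x ∈ Set.Icc (0 : ℝ) 1, HasDerivWithinAt g (g₁ x) (Set.Icc 0 1) x) ∧
    (∀ x ∈ Set.Icc (0 : ℝ) 1, g₁ x = g₁ 0 + ∫ t in (0 : ℝ)..x, h t) ∧
    p 0 = g 0 ∧ p 1 = g 1 ∧ q 0 = g₁ 0 ∧ q 1 = -g₁ 1

theorem intervalIntegrable_edge (h : EdgeL2) {x : ℝ} (hx : x ∈ Set.Icc (0 : ℝ) 1) :
    IntervalIntegrable (fun t => h t) volume 0 x := by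
  have h1 : IntegrableOn (fun t => h t) (Set.Icc (0 : ℝ) 1) volume :=
    (Lp.memLp h).integrable (by norm_num)
  rw [intervalIntegrable_iff_integrableOn_Icc_of_le hx.1]
  exact h1.mono_set (Set.Icc_subset_Icc le_rfl hx.2)

theorem integral_edge_congr {u v : ℝ → ℂ} (h : u =ᵐ[unitVol] v) {x : ℝ}
    (hx : x ∈ Set.Icc (0 : ℝ) 1) : ∫ t in (0 : ℝ)..x, u t = ∫ t in (0 : ℝ)..x, v t := by
  rw [intervalIntegral.integral_of_le hx.1, intervalIntegral.integral_of_le hx.1]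
  refine integral_congr_ae (ae_restrict_of_ae_restrict_of_subset (t := Set.Icc (0 : ℝ) 1) ?_ h)
  exact fun t ht => ⟨ht.1.le, ht.2.trans hx.2⟩

theorem isW22_zero : IsW22 0 0 0 0 := by
  refine ⟨fun _ => 0, fun _ => 0, Lp.coeFn_zero _ _ _, fun x _ => hasDerivWithinAt_const _ _ _,
    fun x hx => ?_, by simp, by simp, by simp, by simp⟩
  rw [integral_edge_congr (Lp.coeFn_zero ℂ 2 unitVol) hx]
  simp

theorem IsW22.add {f h f' h' : EdgeL2} {p q p' q' : Fin 2 → ℂ} (H : IsW22 f h p q)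
    (H' : IsW22 f' h' p' q') : IsW22 (f + f') (h + h') (p + p') (q + q') := by
  obtain ⟨g, g₁, h1, h2, h3, h4, h5, h6, h7⟩ := H
  obtain ⟨k, k₁, l1, l2, l3, l4, l5, l6, l7⟩ := H'
  refine ⟨g + k, g₁ + k₁, (Lp.coeFn_add f f').trans (h1.add l1),
    fun x hx => (h2 x hx).add (l2 x hx), fun x hx => ?_, by simp [h4, l4], by simp [h5, l5],
    by simp [h6, l6], by simp [h7, l7, add_comm]⟩
  rw [integral_edge_congr (Lp.coeFn_add h h') hx]
  simp only [Pi.add_apply]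
  rw [intervalIntegral.integral_add (intervalIntegrable_edge h hx) (intervalIntegrable_edge h' hx),
    h3 x hx, l3 x hx]
  ring

theorem IsW22.smul (c : ℂ) {f h : EdgeL2} {p q : Fin 2 → ℂ} (H : IsW22 f h p q) :
    IsW22 (c • f) (c • h) (c • p) (c • q) := by
  obtain ⟨g, g₁, h1, h2, h3, h4, h5, h6, h7⟩ := H
  refine ⟨c • g, c • g₁, (Lp.coeFn_smul c f).trans (h1.const_smul c),
    fun x hx => (h2 x hx).const_smul c, fun x hx => ?_, by simp [h4], by simp [h5],
    by simp [h6], by simp [h7]⟩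
  rw [integral_edge_congr (Lp.coeFn_smul c h) hx]
  simp only [Pi.smul_apply]
  rw [intervalIntegral.integral_smul, h3 x hx, smul_add]

variable {N : ℕ}

/-- The space `L²(Γ) ⊕ L²(Γ)`. -/
abbrev StateSpace (N : ℕ) : Type := (Fin N → EdgeL2) × (Fin N → EdgeL2)

/-- The coupling condition `(U - I) Ψ + i (U + I) Ψ' = 0`. -/
def Coupled (U : Matrix (Fin N × Fin 2) (Fin N × Fin 2) ℂ) (p q : Fin N → Fin 2 → ℂ) : Prop :=
  (U - 1).mulVec (fun s => p s.1 s.2) + Complex.I • (U + 1).mulVec (fun s => q s.1 s.2) = 0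

/-- `u` has all components in `W^{2,2}`, satisfies the coupling conditions given by `U`, and
`u'' = h`. -/
def IsCoupledW22 (U : Matrix (Fin N × Fin 2) (Fin N × Fin 2) ℂ) (u h : Fin N → EdgeL2) : Prop :=
  ∃ p q : Fin N → Fin 2 → ℂ, (∀ j, IsW22 (u j) (h j) (p j) (q j)) ∧ Coupled U p q

theorem isCoupledW22_zero (U : Matrix (Fin N × Fin 2) (Fin N × Fin 2) ℂ) :
    IsCoupledW22 U 0 0 :=
  ⟨0, 0, fun _ => isW22_zero, by
    have e : (fun s : Fin N × Fin 2 => (0 : Fin N → Fin 2 → ℂ) s.1 s.2) = 0 := rfl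
    unfold Coupled
    rw [e, Matrix.mulVec_zero, Matrix.mulVec_zero, smul_zero, add_zero]⟩

theorem IsCoupledW22.add {U : Matrix (Fin N × Fin 2) (Fin N × Fin 2) ℂ}
    {u h u' h' : Fin N → EdgeL2} (H : IsCoupledW22 U u h) (H' : IsCoupledW22 U u' h') :
    IsCoupledW22 U (u + u') (h + h') := by
  obtain ⟨p, q, h1, h2⟩ := H
  obtain ⟨p', q', l1, l2⟩ := H'
  refine ⟨p + p', q + q', fun j => (h1 j).add (l1 j), ?_⟩
  have e (r r' : Fin N → Fin 2 → ℂ) : (fun s : Fin N × Fin 2 => (r + r') s.1 s.2)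
      = (fun s => r s.1 s.2) + fun s => r' s.1 s.2 := rfl
  unfold Coupled at *
  rw [e, e, Matrix.mulVec_add, Matrix.mulVec_add, smul_add, add_add_add_comm, h2, l2, add_zero]

theorem IsCoupledW22.smul (c : ℂ) {U : Matrix (Fin N × Fin 2) (Fin N × Fin 2) ℂ}
    {u h : Fin N → EdgeL2} (H : IsCoupledW22 U u h) : IsCoupledW22 U (c • u) (c • h) := by
  obtain ⟨p, q, h1, h2⟩ := H
  refine ⟨c • p, c • q, fun j => (h1 j).smul c, ?_⟩
  have e (r : Fin N → Fin 2 → ℂ) : (fun s : Fin N × Fin 2 => (c • r) s.1 s.2)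
      = c • (fun s => r s.1 s.2) := rfl
  unfold Coupled at *
  rw [e, e, Matrix.mulVec_smul, Matrix.mulVec_smul, smul_comm Complex.I c, ← smul_add, h2,
    smul_zero]

/-- The graph `{(ψ, Hψ)}` of the operator
`H (ψ₁, ψ₂) = (ψ₂, ψ₁'' + b ψ₁ - 2 a ψ₂)` on the domain of all `(ψ₁, ψ₂)` with components in
`W^{2,2}` such that `ψ₁` and `ψ₂` satisfy the coupling conditions given by `U`. -/
def waveOp (U : Matrix (Fin N × Fin 2) (Fin N × Fin 2) ℂ) (a b : Fin N → ℝ → ℝ) :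
    Submodule ℂ (StateSpace N × StateSpace N) where
  carrier := {w | ∃ h k : Fin N → EdgeL2, IsCoupledW22 U w.1.1 h ∧ IsCoupledW22 U w.1.2 k ∧
    w.2.1 = w.1.2 ∧
    ∀ j, w.2.2 j =ᵐ[unitVol] fun x =>
      h j x + (b j x : ℂ) * w.1.1 j x - 2 * (a j x : ℂ) * w.1.2 j x}
  zero_mem' := by
    refine ⟨0, 0, isCoupledW22_zero U, isCoupledW22_zero U, rfl, fun j => ?_⟩
    filter_upwards [Lp.coeFn_zero ℂ 2 unitVol] with x hx
    simp only [Prod.fst_zero, Prod.snd_zero, Pi.zero_apply] at *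
    rw [hx]
    ring
  add_mem' := by
    rintro w w' ⟨h, k, h1, h2, h3, h4⟩ ⟨h', k', l1, l2, l3, l4⟩
    refine ⟨h + h', k + k', h1.add l1, h2.add l2, by simp [h3, l3], fun j => ?_⟩
    filter_upwards [h4 j, l4 j, Lp.coeFn_add (w.2.2 j) (w'.2.2 j), Lp.coeFn_add (h j) (h' j),
      Lp.coeFn_add (w.1.1 j) (w'.1.1 j), Lp.coeFn_add (w.1.2 j) (w'.1.2 j)]
      with x e1 e2 e3 e4 e5 e6
    simp only [Prod.fst_add, Prod.snd_add, Pi.add_apply] at *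
    rw [e3, e4, e5, e6, e1, e2]
    ring
  smul_mem' := by
    rintro c w ⟨h, k, h1, h2, h3, h4⟩
    refine ⟨c • h, c • k, h1.smul c, h2.smul c, by simp [h3], fun j => ?_⟩
    filter_upwards [h4 j, Lp.coeFn_smul c (w.2.2 j), Lp.coeFn_smul c (h j),
      Lp.coeFn_smul c (w.1.1 j), Lp.coeFn_smul c (w.1.2 j)] with x e1 e2 e3 e4 e5
    simp only [Prod.smul_fst, Prod.smul_snd, Pi.smul_apply, smul_eq_mul] at *
    rw [e2, e3, e4, e5, e1]
    ring

section Spectrum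

variable (H : Submodule ℂ (StateSpace N × StateSpace N))

/-- `z` is an eigenvalue of the operator with graph `H`. -/
def IsEigenvalue (z : ℂ) : Prop := ∃ ψ : StateSpace N, ψ ≠ 0 ∧ (ψ, z • ψ) ∈ H

/-- The kernel of `(H - z)^k`: the vectors `ψ` of the domain with `Hψ - zψ` in the kernel of
`(H - z)^(k-1)`. -/
def genKer (z : ℂ) : ℕ → Submodule ℂ (StateSpace N)
  | 0 => ⊥
  | k + 1 => (H ⊓ (genKer z k).comap
      (LinearMap.snd ℂ (StateSpace N) (StateSpace N)
        - z • LinearMap.fst ℂ (StateSpace N) (StateSpace N))).map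
      (LinearMap.fst ℂ (StateSpace N) (StateSpace N))

/-- The root space of `z`, the union of the kernels of all powers of `H - z`. -/
def rootSpace (z : ℂ) : Submodule ℂ (StateSpace N) := ⨆ k, genKer H z k

/-- The algebraic multiplicity. -/
def algMult (z : ℂ) : ℕ := Module.finrank ℂ (rootSpace H z)

/-- The number of eigenvalues, with algebraic multiplicity, such that `Re z ∈ I` and
`|Im z| < R`. -/
def eigenCount (I : Set ℝ) (R : ℝ) : ℕ :=
  ∑ᶠ z ∈ {z : ℂ | IsEigenvalue H z ∧ z.re ∈ I ∧ |z.im| < R}, algMult H z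

/-- The distribution `μ_R(I)`. -/
def muR (R : ℝ) (I : Set ℝ) : ℝ := (eigenCount H I R : ℝ) / (eigenCount H Set.univ R : ℝ)

/-- `μ(I) = lim_{R → ∞} μ_R(I)` exists and equals `p`. -/
def MuEq (I : Set ℝ) (p : ℝ) : Prop := Tendsto (fun R : ℝ => muR H R I) atTop (𝓝 p)

/-- `c` is a high frequency abscissa of `H`. -/
def IsHighFreqAbscissa (c : ℝ) : Prop :=
  ∃ z : ℕ → ℂ, (∀ n, IsEigenvalue H (z n)) ∧
    (Tendsto (fun n => (z n).im) atTop atTop ∨ Tendsto (fun n => (z n).im) atTop atBot) ∧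
    Tendsto (fun n => (z n).re) atTop (𝓝 c)

end Spectrum

end DampedGraph

end

/-! With second component `z ψ`, the eigenvalue equation becomes ψ'' = (z² + 2za − b) ψ on each
edge, together with the coupling condition. Writing the condition in the fundamental solutions gives
a 2N × 2N matrix of entire functions, and z is an eigenvalue exactly when its determinant D(z) =
`secularDet` vanishes. Jordan chains of H at z₀ correspond to vectors of power series which the
Taylor expansion of this matrix sends to multiples of X^k; the dimension of that kernel is the
X-adic order of the determinant, so algebraic multiplicity equals the order of the zero of D
(`algMult_eq_order`). Pairing the equation with ψ shows that all zeros lie in a vertical strip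
(`exists_strip_bound`), since the boundary term is real and controlled by a trace inequality.

At high frequency in such a strip the waves ψ ± ψ'/z cross an edge with only a factor exp(±(z +
∫a)), up to O(1/z) (`exists_amplitude_bound`), and the coupling condition reduces to the reflection
2P − 1, with P the orthogonal projection onto the range of U + 1. Hence D, multiplied by factors
without zeros away from 0, is asymptotic to det(1 − e^z T), where T = (2P − 1) J, with J exchanging
the ends of each edge with weight exp(∫a) (`asympEq_reducedDet`). This limit is ∏ (1 − τ e^z) over
the eigenvalues τ of T: it is 2πi-periodic and its zeros have real part −log|τ|. By Hurwitz's
theorem every sufficiently high period box contains as many eigenvalues of H with real part in I as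
T has eigenvalues with −log|τ| in I, provided the frontier of I avoids these numbers
(`eventually_box_count`). Since T is invertible of size 2N, averaging over boxes yields (i) and
(ii); the abscissas are the numbers −log|τ|, weighted by the multiplicities of the τ.

If the graph is bipartite, the signs of a two-colouring commute with P and anticommute with J, so T
is similar to −T and the τ pair off with equal modulus (`roots_limitMatrix_symm`,
`even_abscissaCount`).

For (iv), the constant damping −e·log ε on edge e makes the edge weights ε^(−e), with widely
separated scales for small ε. Looking for 1/τ at scale ε^k and rescaling rows, the limit ε → 0
leaves U on the edges below k, −J up to a factor above, and a genuine pencil U − yJ on edge k. Odd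
degrees make the relevant partial determinants nonzero, so the pencil has a root y ≠ 0; it survives
for small ε and gives one abscissa near k·log ε for each k (`exists_damping_card_abscissas`). -/

noncomputable section

namespace DampedGraph

set_option linter.unusedSectionVars false

/-! ### Argument principle and Hurwitz's theorem with multiplicities on a disc. -/

section ArgumentPrinciple

open Metric Complex

/-- Identity theorem on the connected disc: infinite order at one point would spread to the circle,
where `f` does not vanish. This makes `analyticOrderNatAt`, which sends infinite order to 0,
meaningful in the disc. -/
theorem analyticOrderAt_ne_top_of_ne_zero_on_sphere {f : ℂ → ℂ} {c : ℂ} {r : ℝ} (hr : 0 < r)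
    (hf : AnalyticOnNhd ℂ f (closedBall c r)) (h0 : ∀ z ∈ sphere c r, f z ≠ 0) {u : ℂ}
    (hu : u ∈ closedBall c r) : analyticOrderAt f u ≠ ⊤ := by
  obtain ⟨x, hx⟩ : (sphere c r).Nonempty := NormedSpace.sphere_nonempty.2 hr.le
  have hx' := sphere_subset_closedBall hx
  refine AnalyticOnNhd.analyticOrderAt_ne_top_of_isPreconnected hf
    (convex_closedBall c r).isPreconnected hx' hu ?_
  rw [(hf x hx').analyticOrderAt_eq_zero.2 (h0 x hx)]
  simp

/-- The divisor on the compact disc is finite, so its zeros can be divided out. The extraction only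
gives equality off a discrete set; analyticity of both sides upgrades it to a full neighbourhood of
each point, including points of the circle, which is what logarithmic derivatives require. -/
theorem exists_factorization_of_ne_zero_on_sphere {f : ℂ → ℂ} {c : ℂ} {r : ℝ} (hr : 0 < r)
    (hf : AnalyticOnNhd ℂ f (closedBall c r)) (h0 : ∀ z ∈ sphere c r, f z ≠ 0) :
    ∃ (s : Finset ℂ) (g : ℂ → ℂ), AnalyticOnNhd ℂ g (closedBall c r) ∧
      (∀ z ∈ closedBall c r, g z ≠ 0) ∧ (↑s ⊆ ball c r) ∧
      (∀ z ∈ ball c r, z ∉ s → analyticOrderNatAt f z = 0) ∧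
      ∀ z ∈ closedBall c r, f =ᶠ[𝓝 z]
        fun w => (∏ u ∈ s, (w - u) ^ analyticOrderNatAt f u) * g w := by
  have hord := fun u hu => analyticOrderAt_ne_top_of_ne_zero_on_sphere hr hf h0 (u := u) hu
  set D := MeromorphicOn.divisor f (closedBall c r) with hD
  have hDapp : ∀ u ∈ closedBall c r, D u = analyticOrderNatAt f u := by
    intro u hu
    rw [hD, MeromorphicOn.AnalyticOnNhd.divisor_apply hf hu]
    have := hord u hu
    unfold analyticOrderNatAt
    revert this
    cases analyticOrderAt f u <;> simp
  have hfin : D.support.Finite := D.finiteSupport (isCompact_closedBall c r)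
  obtain ⟨g, hg, hg0, hfg⟩ := hf.meromorphicOn.extract_zeros_poles
    (fun u => by
      rw [(hf u u.2).meromorphicOrderAt_eq]
      have := hord u u.2
      revert this
      cases analyticOrderAt f u <;> simp) hfin
  have hsup : ∀ u, D u ≠ 0 → u ∈ closedBall c r := fun u hu => by
    by_contra h
    exact hu (D.apply_eq_zero_of_notMem h)
  have hs : ∀ u ∈ hfin.toFinset, u ∈ ball c r := by
    intro u hu
    have hu1 : D u ≠ 0 := by simpa using hu
    have hu2 := hsup u hu1
    rw [hDapp u hu2] at hu1
    by_contra hb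
    have hus : u ∈ sphere c r := by
      simp only [mem_ball, mem_closedBall, mem_sphere, not_lt] at *
      exact le_antisymm hu2 hb
    exact h0 u hus (apply_eq_zero_of_analyticOrderNatAt_ne_zero (by exact_mod_cast hu1))
  refine ⟨hfin.toFinset, g, hg, fun z hz => hg0 ⟨z, hz⟩, fun u hu => hs u hu, ?_, ?_⟩
  · intro z hz hzs
    have : D z = 0 := by simpa using hzs
    rw [hDapp z (ball_subset_closedBall hz)] at this
    exact_mod_cast this
  · intro z hz
    have hprod : (∏ᶠ u, (fun w : ℂ => w - u) ^ D u) • g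
        = fun w => (∏ u ∈ hfin.toFinset, (w - u) ^ analyticOrderNatAt f u) * g w := by
      rw [finprod_eq_prod_of_mulSupport_subset (s := hfin.toFinset)]
      · ext w
        simp only [Pi.smul_apply', Finset.prod_apply, Pi.pow_apply, smul_eq_mul]
        congr 1
        refine Finset.prod_congr rfl fun u hu => ?_
        rw [hDapp u (ball_subset_closedBall (hs u hu)), zpow_natCast]
      · intro u hu
        simp only [Function.mem_mulSupport] at hu
        simp only [Set.Finite.coe_toFinset, Function.mem_support]
        intro h
        exact hu (by rw [h]; simp)
    rw [hprod] at hfg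
    have han : AnalyticAt ℂ (fun w => (∏ u ∈ hfin.toFinset, (w - u) ^ analyticOrderNatAt f u) * g w)
        z := by
      have := hg z hz
      refine AnalyticAt.mul ?_ this
      exact Finset.analyticAt_fun_prod _ fun u _ => by fun_prop
    -- Points of the circle are not interior, so accumulation is obtained from the closed disc being
    -- the perfect closure of the open one.
    have hacc : AccPt z (𝓟 (closedBall c r)) := by
      have h1 : Preperfect (closure (ball c r)) :=
        (Preperfect.perfect_closure isOpen_ball.preperfect).acc
      rw [closure_ball c hr.ne'] at h1
      exact h1 z hz
    have h2 := (hf z hz).meromorphicAt.eventuallyEq_nhdsNE_of_eventuallyEq_codiscreteWithin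
      han.meromorphicAt hz hacc hfg
    exact ((hf z hz).continuousAt.eventuallyEq_nhds_iff_eventuallyEq_nhdsNE han.continuousAt).1 h2

/-- The argument principle for a disc. -/
theorem circleIntegral_logDeriv {f : ℂ → ℂ} {c : ℂ} {r : ℝ} (hr : 0 < r)
    (hf : AnalyticOnNhd ℂ f (closedBall c r)) (h0 : ∀ z ∈ sphere c r, f z ≠ 0) :
    (∮ z in C(c, r), logDeriv f z) =
      2 * Real.pi * I * ((∑ᶠ z ∈ ball c r, analyticOrderNatAt f z : ℕ) : ℂ) := by
  obtain ⟨s, g, hg, hg0, hs, hs0, hfg⟩ := exists_factorization_of_ne_zero_on_sphere hr hf h0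
  have hsum : ∑ᶠ z ∈ ball c r, analyticOrderNatAt f z = ∑ z ∈ s, analyticOrderNatAt f z := by
    apply finsum_mem_eq_sum_of_inter_support_eq
    ext z
    simp only [Set.mem_inter_iff, Function.mem_support, Finset.mem_coe]
    constructor
    · rintro ⟨h1, h2⟩
      exact ⟨by_contra fun h => h2 (hs0 z h1 h), h2⟩
    · rintro ⟨h1, h2⟩
      exact ⟨hs h1, h2⟩
  have hne : ∀ z ∈ sphere c r, ∀ u ∈ s, z - u ≠ 0 := by
    intro z hz u hu h
    have := hs hu
    rw [sub_eq_zero] at h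
    subst h
    simp only [mem_sphere, mem_ball] at *
    linarith
  -- Partial fractions for the logarithmic derivative: each pole contributes 2πi times its
  -- multiplicity, and the zero-free cofactor contributes nothing by Cauchy's theorem.
  have hld : ∀ z ∈ sphere c r, logDeriv f z =
      (∑ u ∈ s, (analyticOrderNatAt f u : ℂ) * (z - u)⁻¹) + logDeriv g z := by
    intro z hz
    have hz' := sphere_subset_closedBall hz
    rw [(logDeriv_congr_nhds (hfg z hz')).eq_of_nhds, logDeriv_mul]
    · congr 1
      rw [logDeriv_prod]
      · refine Finset.sum_congr rfl fun u hu => ?_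
        rw [logDeriv_fun_pow (by fun_prop), logDeriv_apply]
        simp
      · intro u hu
        exact pow_ne_zero _ (hne z hz u hu)
      · intro u hu
        fun_prop
    · exact Finset.prod_ne_zero_iff.2 fun u hu => pow_ne_zero _ (hne z hz u hu)
    · exact hg0 z hz'
    · fun_prop
    · exact (hg z hz').differentiableAt
  have hgd : AnalyticOnNhd ℂ (logDeriv g) (closedBall c r) := fun z hz =>
    (hg z hz).deriv.div (hg z hz) (hg0 z hz)
  have hcirc : ∀ u ∈ s, CircleIntegrable (fun z => (analyticOrderNatAt f u : ℂ) * (z - u)⁻¹) c r := by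
    intro u hu
    refine ContinuousOn.circleIntegrable hr.le ?_
    exact continuousOn_const.mul
      ((continuousOn_id.sub continuousOn_const).inv₀ fun z hz => hne z hz u hu)
  rw [circleIntegral.integral_congr hr.le hld, circleIntegral.integral_add
    (CircleIntegrable.fun_sum s hcirc)
    ((hgd.continuousOn.mono sphere_subset_closedBall).circleIntegrable hr.le),
    circleIntegral.integral_fun_sum hcirc, hsum]
  have h1 : (∮ z in C(c, r), logDeriv g z) = 0 := by
    refine DiffContOnCl.circleIntegral_eq_zero hr.le ?_
    refine ⟨fun z hz => ((hgd z (ball_subset_closedBall hz)).differentiableAt).differentiableWithinAt,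
      ?_⟩
    rw [closure_ball c hr.ne']
    exact hgd.continuousOn
  rw [h1, add_zero]
  push_cast
  rw [Finset.mul_sum]
  refine Finset.sum_congr rfl fun u hu => ?_
  rw [circleIntegral.integral_const_mul, circleIntegral.integral_sub_inv_of_mem_ball (hs hu)]
  ring

/-- Hurwitz's theorem with multiplicities. -/
theorem eventually_sum_order_eq {ι : Type*} {l : Filter ι} [l.IsCountablyGenerated]
    {F : ι → ℂ → ℂ} {f : ℂ → ℂ} {c : ℂ} {r : ℝ} {W : Set ℂ} (hr : 0 < r) (hW : IsOpen W)
    (hcW : closedBall c r ⊆ W) (hF : ∀ᶠ n in l, DifferentiableOn ℂ (F n) W)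
    (hf : DifferentiableOn ℂ f W) (hFf : TendstoLocallyUniformlyOn F f l W)
    (h0 : ∀ z ∈ sphere c r, f z ≠ 0) :
    ∀ᶠ n in l, ∑ᶠ z ∈ ball c r, analyticOrderNatAt (F n) z
      = ∑ᶠ z ∈ ball c r, analyticOrderNatAt f z := by
  have hsW : sphere c r ⊆ W := sphere_subset_closedBall.trans hcW
  have hcomp : IsCompact (sphere c r) := isCompact_sphere c r
  have hanf : AnalyticOnNhd ℂ f (closedBall c r) := (hf.analyticOnNhd hW).mono hcW
  have hder : TendstoLocallyUniformlyOn (fun n => deriv (F n)) (deriv f) l (sphere c r) :=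
    (hFf.deriv hF hW).mono hsW
  have hlog : TendstoUniformlyOn (fun n => logDeriv (F n)) (logDeriv f) l (sphere c r) := by
    rw [← tendstoLocallyUniformlyOn_iff_tendstoUniformlyOn_of_compact hcomp]
    exact TendstoLocallyUniformlyOn.div₀ hder (hFf.mono hsW)
      (fun z hz => (hanf z (sphere_subset_closedBall hz)).deriv.continuousAt.continuousWithinAt)
      (fun z hz => (hanf z (sphere_subset_closedBall hz)).continuousAt.continuousWithinAt) h0
  have hne : ∀ᶠ n in l, ∀ z ∈ sphere c r, F n z ≠ 0 := by
    have hu := (tendstoLocallyUniformlyOn_iff_tendstoUniformlyOn_of_compact hcomp).1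
      (hFf.mono hsW)
    obtain ⟨x, hx, hmin⟩ := hcomp.exists_isMinOn (NormedSpace.sphere_nonempty.2 hr.le)
      (hanf.continuousOn.norm.mono sphere_subset_closedBall)
    have hpos : 0 < ‖f x‖ := norm_pos_iff.2 (h0 x hx)
    filter_upwards [Metric.tendstoUniformlyOn_iff.1 hu _ hpos] with n hn z hz h
    have h1 := hn z hz
    rw [h, dist_zero_right] at h1
    exact absurd (hmin hz) (by simpa using h1)
  have hcirc := hlog.tendsto_circleIntegral_of_continuousOn hr.le (by
    filter_upwards [hF, hne] with n hn hn0
    have := hn.analyticOnNhd hW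
    exact fun z hz => ((this z (hsW hz)).deriv.div (this z (hsW hz))
      (hn0 z hz)).continuousAt.continuousWithinAt)
  rw [circleIntegral_logDeriv hr hanf h0] at hcirc
  set m : ι → ℕ := fun n => ∑ᶠ z ∈ ball c r, analyticOrderNatAt (F n) z with hm
  have h2 : Tendsto (fun n => (m n : ℂ)) l
      (𝓝 ((∑ᶠ z ∈ ball c r, analyticOrderNatAt f z : ℕ) : ℂ)) := by
    have h3 := hcirc.const_mul (2 * Real.pi * I)⁻¹
    rw [inv_mul_cancel_left₀ Complex.two_pi_I_ne_zero] at h3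
    refine h3.congr' ?_
    filter_upwards [hF, hne] with n hn hn0
    rw [circleIntegral_logDeriv hr ((hn.analyticOnNhd hW).mono hcW) hn0,
      inv_mul_cancel_left₀ Complex.two_pi_I_ne_zero]
  have h4 : Tendsto (fun n => (m n : ℝ)) l
      (𝓝 ((∑ᶠ z ∈ ball c r, analyticOrderNatAt f z : ℕ) : ℝ)) := by
    exact (Complex.continuous_re.tendsto _).comp h2
  -- A convergent sequence of natural numbers is eventually constant: distance below 1 already
  -- forces equality.
  filter_upwards [Metric.tendsto_nhds.1 h4 1 one_pos] with n hn
  rw [Nat.dist_cast_real] at hn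
  by_contra h
  exact absurd hn (not_lt.2 (Nat.pairwise_one_le_dist h))

end ArgumentPrinciple

/-! ### Matrices over power series: cokernels and kernels modulo a power of the variable. -/

section PowerSeriesCokernel

open PowerSeries

variable {𝕜 ι : Type*} [Field 𝕜] [Fintype ι]

/-- The range of a matrix over `𝕜⟦X⟧`, as a `𝕜`-subspace. -/
def matrixRange (M : Matrix ι ι 𝕜⟦X⟧) : Submodule 𝕜 (ι → 𝕜⟦X⟧) :=
  (LinearMap.range M.mulVecLin).restrictScalars 𝕜

theorem mem_matrixRange {M : Matrix ι ι 𝕜⟦X⟧} {y : ι → 𝕜⟦X⟧} :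
    y ∈ matrixRange M ↔ ∃ x, M.mulVec x = y := by
  simp [matrixRange]

/-- The vectors of power series that are divisible by `X ^ k`. -/
def powerMultiples (𝕜 ι : Type*) [Field 𝕜] (k : ℕ) : Submodule 𝕜 (ι → 𝕜⟦X⟧) where
  carrier := {c | ∀ i, X ^ k ∣ c i}
  zero_mem' := fun _ => dvd_zero _
  add_mem' := fun h h' i => dvd_add (h i) (h' i)
  smul_mem' := fun a c h i => by
    rw [Pi.smul_apply, PowerSeries.smul_eq_C_mul]; exact Dvd.dvd.mul_left (h i) _

/-- The vectors which a matrix of power series maps to multiples of `X ^ k`. -/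
def kerMod (M : Matrix ι ι 𝕜⟦X⟧) (k : ℕ) : Submodule 𝕜 (ι → 𝕜⟦X⟧) :=
  (powerMultiples 𝕜 ι k).comap (M.mulVecLin.restrictScalars 𝕜)

theorem mem_powerMultiples {𝕜 ι : Type*} [Field 𝕜] {k : ℕ} {c : ι → 𝕜⟦X⟧} :
    c ∈ powerMultiples 𝕜 ι k ↔ ∀ i, X ^ k ∣ c i := Iff.rfl

theorem mem_kerMod {M : Matrix ι ι 𝕜⟦X⟧} {k : ℕ} {c : ι → 𝕜⟦X⟧} :
    c ∈ kerMod M k ↔ ∀ i, X ^ k ∣ M.mulVec c i := Iff.rfl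

variable [DecidableEq ι]

theorem mulVec_injective_of_det_eq {M : Matrix ι ι 𝕜⟦X⟧} {ν : ℕ} {u : 𝕜⟦X⟧} (hu : IsUnit u)
    (h : M.det = X ^ ν * u) : Function.Injective M.mulVec := by
  apply Matrix.mulVec_injective_of_det_mem_nonZeroDivisors
  rw [h]
  exact mem_nonZeroDivisors_of_ne_zero (mul_ne_zero (pow_ne_zero _ X_ne_zero) hu.ne_zero)

/-- The adjugate inverts `M` up to its determinant `X ^ ν * u`, so it solves the equation once the
right side carries at least the factor `X ^ ν`. -/
theorem exists_mulVec_eq_X_pow_smul {M : Matrix ι ι 𝕜⟦X⟧} {ν k : ℕ} {u : 𝕜⟦X⟧} (hu : IsUnit u)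
    (h : M.det = X ^ ν * u) (hk : ν ≤ k) (d : ι → 𝕜⟦X⟧) :
    ∃ c, M.mulVec c = (X : 𝕜⟦X⟧) ^ k • d := by
  obtain ⟨v, hv⟩ := hu.exists_left_inv
  refine ⟨(X ^ (k - ν) * v) • M.adjugate.mulVec d, ?_⟩
  rw [Matrix.mulVec_smul, Matrix.mulVec_mulVec, Matrix.mul_adjugate, h, Matrix.smul_mulVec,
    Matrix.one_mulVec, smul_smul]
  congr 1
  calc X ^ (k - ν) * v * (X ^ ν * u) = X ^ (k - ν) * X ^ ν * (v * u) := by ring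
    _ = X ^ k := by rw [hv, mul_one, ← pow_add, Nat.sub_add_cancel hk]

/-- One elementary step towards the Smith normal form. The matrix of constant terms is singular; a
kernel vector normalised to have `i`-th entry 1 replaces the `i`-th column of the identity, giving a
unimodular `Q` for which the `i`-th column of `M * Q` is divisible by `X`. -/
theorem exists_eq_mul_diagonal {M : Matrix ι ι 𝕜⟦X⟧} (h : constantCoeff M.det = 0) :
    ∃ (M' Q : Matrix ι ι 𝕜⟦X⟧) (i : ι), Q.det = 1 ∧
      M * Q = M' * Matrix.diagonal (Function.update 1 i X) := by
  have h0 : (M.map (constantCoeff (R := 𝕜))).det = 0 := by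
    rw [← h, RingHom.map_det]; rfl
  obtain ⟨v, hv, hMv⟩ := Matrix.exists_mulVec_eq_zero_iff.2 h0
  obtain ⟨i, hi⟩ := Function.ne_iff.1 hv
  simp only [Pi.zero_apply] at hi
  set w : ι → 𝕜⟦X⟧ := fun j => C ((v i)⁻¹ * v j) with hw
  have hwi : w i = 1 := by
    simp only [hw, inv_mul_cancel₀ hi, map_one]
  have hdvd : ∀ j, X ∣ M.mulVec w j := by
    intro j
    rw [X_dvd_iff]
    have := congrFun hMv j
    simp only [Matrix.mulVec, dotProduct, map_sum, map_mul, hw, Matrix.map_apply,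
      Pi.zero_apply, constantCoeff_C] at this ⊢
    calc ∑ x, constantCoeff (M j x) * ((v i)⁻¹ * v x)
        = (v i)⁻¹ * ∑ x, constantCoeff (M j x) * v x := by
          rw [Finset.mul_sum]; exact Finset.sum_congr rfl fun _ _ => by ring
      _ = 0 := by rw [this, mul_zero]
  choose y hy using hdvd
  refine ⟨M.updateCol i y, (1 : Matrix ι ι 𝕜⟦X⟧).updateCol i w, i, ?_, ?_⟩
  · rw [← Matrix.cramer_apply, Matrix.cramer_one]
    simpa using hwi
  · rw [Matrix.mul_updateCol, mul_one]
    ext j l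
    rw [Matrix.mul_diagonal]
    by_cases hl : l = i
    · subst hl
      simp [hy, mul_comm]
    · simp [hl]

/-- Induction on the order of the determinant: every factor diag(1, …, X, …, 1) split off from `M`
contributes exactly one dimension to the cokernel. -/
theorem rank_quotient_matrixRange {ν : ℕ} : ∀ {M : Matrix ι ι 𝕜⟦X⟧} {u : 𝕜⟦X⟧}, IsUnit u →
    M.det = X ^ ν * u → Module.rank 𝕜 ((ι → 𝕜⟦X⟧) ⧸ matrixRange M) = ν := by
  induction ν with
  | zero =>
    intro M u hu h
    have htop : matrixRange M = ⊤ := by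
      rw [eq_top_iff]
      intro y _
      obtain ⟨c, hc⟩ := exists_mulVec_eq_X_pow_smul hu h le_rfl y
      exact mem_matrixRange.2 ⟨c, by simpa using hc⟩
    have : Subsingleton ((ι → 𝕜⟦X⟧) ⧸ matrixRange M) :=
      Submodule.Quotient.subsingleton_iff.2 htop
    rw [rank_subsingleton']
    simp
  | succ ν ih =>
    intro M u hu h
    obtain ⟨M', Q, i, hQ, hMQ⟩ := exists_eq_mul_diagonal (M := M) (by
      rw [h]; simp [pow_succ])
    set D : Matrix ι ι 𝕜⟦X⟧ := Matrix.diagonal (Function.update 1 i X) with hD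
    have hDdet : D.det = X := by
      rw [hD, Matrix.det_diagonal, Finset.prod_update_of_mem (Finset.mem_univ i)]
      simp
    have hdet' : M'.det = X ^ ν * u := by
      have h1 : M.det = M'.det * X := by
        rw [← hDdet, ← Matrix.det_mul, ← hMQ, Matrix.det_mul, hQ, mul_one]
      rw [h] at h1
      apply mul_right_cancel₀ (X_ne_zero (R := 𝕜))
      rw [← h1]; ring
    have hinj := mulVec_injective_of_det_eq hu hdet'
    have hDvec : ∀ x : ι → 𝕜⟦X⟧, D.mulVec x = Function.update x i (X * x i) := by
      intro x
      ext1 j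
      rw [hD, Matrix.mulVec_diagonal]
      by_cases hj : j = i
      · subst hj; simp
      · simp [hj]
    have hrange : ∀ y, y ∈ matrixRange M ↔ ∃ x, M'.mulVec (D.mulVec x) = y := by
      intro y
      rw [mem_matrixRange]
      constructor
      · rintro ⟨x, rfl⟩
        refine ⟨Q⁻¹.mulVec x, ?_⟩
        rw [Matrix.mulVec_mulVec, ← hMQ, Matrix.mulVec_mulVec, mul_assoc, Matrix.mul_nonsing_inv _
          (by rw [hQ]; exact isUnit_one), mul_one]
      · rintro ⟨x, rfl⟩
        exact ⟨Q.mulVec x, by rw [Matrix.mulVec_mulVec, hMQ, Matrix.mulVec_mulVec]⟩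
    have hle : matrixRange M ≤ matrixRange M' := fun y hy => by
      obtain ⟨x, rfl⟩ := (hrange y).1 hy
      exact mem_matrixRange.2 ⟨_, rfl⟩
    let f := Submodule.factor hle
    have hf : Function.Surjective f := Submodule.factor_surjective hle
    set e : (ι → 𝕜⟦X⟧) ⧸ matrixRange M := Submodule.Quotient.mk (M'.mulVec (Pi.single i 1)) with he
    -- Modulo the range of `M' * D`, the class of `M' x` depends only on the constant term of `x i`,
    -- because `D` reaches every vector whose `i`-th entry is divisible by `X`. So the kernel is the
    -- line through the class of `M' e_i`.
    have hker : LinearMap.ker f = Submodule.span 𝕜 {e} := by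
      apply le_antisymm
      · intro q hq
        obtain ⟨y, rfl⟩ := Submodule.Quotient.mk_surjective _ q
        have hy : y ∈ matrixRange M' := by
          rw [LinearMap.mem_ker] at hq
          exact (Submodule.Quotient.mk_eq_zero _).1 hq
        obtain ⟨x, rfl⟩ := mem_matrixRange.1 hy
        rw [Submodule.mem_span_singleton]
        refine ⟨constantCoeff (x i), ?_⟩
        rw [he, ← Submodule.Quotient.mk_smul, eq_comm, Submodule.Quotient.eq, hrange]
        obtain ⟨t, ht⟩ : X ∣ x i - C (constantCoeff (x i)) := by
          rw [X_dvd_iff]; simp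
        refine ⟨Function.update x i t, ?_⟩
        have h2 : (constantCoeff (x i)) • M'.mulVec (Pi.single i (1 : 𝕜⟦X⟧))
            = M'.mulVec ((constantCoeff (x i)) • Pi.single i (1 : 𝕜⟦X⟧)) := by
          rw [Matrix.mulVec_smul]
        rw [h2, ← Matrix.mulVec_sub]
        congr 1
        rw [hDvec]
        ext1 j
        by_cases hj : j = i
        · subst hj
          simp [← ht, PowerSeries.smul_eq_C_mul]
        · simp [hj]
      · rw [Submodule.span_singleton_le_iff_mem, LinearMap.mem_ker]
        exact (Submodule.Quotient.mk_eq_zero _).2 (mem_matrixRange.2 ⟨_, rfl⟩)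
    have he0 : e ≠ 0 := by
      rw [he, Ne, Submodule.Quotient.mk_eq_zero, hrange]
      rintro ⟨x, hx⟩
      have h3 := congrFun (hinj hx) i
      rw [hDvec] at h3
      simp only [Function.update_self, Pi.single_eq_same] at h3
      have := congrArg (constantCoeff (R := 𝕜)) h3
      simp at this
    have h4 := LinearMap.rank_range_add_rank_ker f
    rw [LinearMap.range_eq_top.2 hf, rank_top, ih hu hdet', hker,
      ← Module.finrank_eq_rank 𝕜 (Submodule.span 𝕜 {e}), finrank_span_singleton he0] at h4
    rw [← h4]
    push_cast
    rfl

/-- The dimension of the kernel of a matrix modulo a high power of `X` is the order of its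
determinant. -/
theorem rank_map_kerMod {M : Matrix ι ι 𝕜⟦X⟧} {ν k : ℕ} {u : 𝕜⟦X⟧} (hu : IsUnit u)
    (h : M.det = X ^ ν * u) (hk : ν ≤ k) {W : Type*} [AddCommGroup W] [Module 𝕜 W]
    (Θ : (ι → 𝕜⟦X⟧) →ₗ[𝕜] W)
    (hΘ : ∀ c ∈ kerMod M k, Θ c = 0 ↔ c ∈ powerMultiples 𝕜 ι k) :
    Module.finrank 𝕜 ((kerMod M k).map Θ) = ν ∧
      FiniteDimensional 𝕜 ((kerMod M k).map Θ) := by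
  have hinj := mulVec_injective_of_det_eq hu h
  have hex : ∀ d : ι → 𝕜⟦X⟧, ∃ c, M.mulVec c = (X : 𝕜⟦X⟧) ^ k • d :=
    exists_mulVec_eq_X_pow_smul hu h hk
  -- The solution map `d ↦ M⁻¹ X^k d` identifies all vectors of power series with `kerMod M k`, and
  -- the range of `M` with the multiples of `X^k`. Thus `Θ` on `kerMod M k` has the cokernel of `M`
  -- as its image.
  choose s hs using hex
  have hXinj : Function.Injective fun d : ι → 𝕜⟦X⟧ => (X : 𝕜⟦X⟧) ^ k • d := fun d d' hd => by
    ext1 i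
    have := congrFun hd i
    exact mul_left_cancel₀ (pow_ne_zero k X_ne_zero) this
  let S : (ι → 𝕜⟦X⟧) →ₗ[𝕜] (ι → 𝕜⟦X⟧) :=
    { toFun := s
      map_add' := fun d d' => hinj (by
        simp only [Matrix.mulVec_add, hs, smul_add])
      map_smul' := fun a d => hinj (by
        simp only [RingHom.id_apply]
        rw [hs, Matrix.mulVec_smul, hs, smul_comm]) }
  let f : (ι → 𝕜⟦X⟧) →ₗ[𝕜] W := Θ ∘ₗ S
  have hmem : ∀ d, s d ∈ kerMod M k := fun d i => ⟨d i, by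
    change M.mulVec (s d) i = _
    rw [hs]; rfl⟩
  have hrange : LinearMap.range f = (kerMod M k).map Θ := by
    apply le_antisymm
    · rintro _ ⟨d, rfl⟩
      exact ⟨s d, hmem d, rfl⟩
    · rintro _ ⟨c, hc, rfl⟩
      choose d hd using mem_kerMod.1 hc
      refine ⟨d, ?_⟩
      change Θ (s d) = Θ c
      congr 1
      apply hinj
      rw [hs]
      ext1 i
      exact (hd i).symm
  have hker : LinearMap.ker f = matrixRange M := by
    ext d
    rw [LinearMap.mem_ker, mem_matrixRange]
    change Θ (s d) = 0 ↔ _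
    rw [hΘ _ (hmem d), mem_powerMultiples]
    constructor
    · intro hd
      choose x hx using hd
      refine ⟨x, hXinj ?_⟩
      simp only
      rw [← hs d, ← Matrix.mulVec_smul]
      congr 1
      ext1 i
      exact (hx i).symm
    · rintro ⟨x, rfl⟩ i
      have : s (M.mulVec x) = (X : 𝕜⟦X⟧) ^ k • x := hinj (by rw [hs, Matrix.mulVec_smul])
      rw [this]
      exact ⟨x i, rfl⟩
  have hrank := rank_quotient_matrixRange hu h
  rw [← hker] at hrank
  have hfin : Module.Finite 𝕜 ((ι → 𝕜⟦X⟧) ⧸ LinearMap.ker f) := Module.rank_lt_aleph0_iff.1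
    (by rw [hrank]; exact Cardinal.natCast_lt_aleph0)
  rw [← hrange]
  exact ⟨f.quotKerEquivRange.finrank_eq.symm.trans (Module.finrank_eq_of_rank_eq hrank),
    Module.Finite.equiv f.quotKerEquivRange⟩

end PowerSeriesCokernel

/-! ### Taylor coefficients of vector valued entire functions and formal products with scalar
series. -/

section Taylor

variable {E F : Type*} [NormedAddCommGroup E] [NormedSpace ℂ E] [CompleteSpace E]
  [NormedAddCommGroup F] [NormedSpace ℂ F] [CompleteSpace F]

/-- The Taylor coefficients of a function of a complex variable. -/
def taylorCoeff (f : ℂ → E) (z₀ : ℂ) (k : ℕ) : E := (k.factorial : ℂ)⁻¹ • iteratedDeriv k f z₀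

theorem taylorCoeff_add {f g : ℂ → E} (hf : Differentiable ℂ f) (hg : Differentiable ℂ g)
    (z₀ : ℂ) (k : ℕ) : taylorCoeff (fun z => f z + g z) z₀ k
      = taylorCoeff f z₀ k + taylorCoeff g z₀ k := by
  unfold taylorCoeff
  rw [iteratedDeriv_fun_add hf.contDiff.contDiffAt hg.contDiff.contDiffAt, smul_add]

theorem taylorCoeff_const (c : E) (z₀ : ℂ) (k : ℕ) :
    taylorCoeff (fun _ => c) z₀ k = if k = 0 then c else 0 := by
  unfold taylorCoeff
  rw [iteratedDeriv_const]
  split_ifs with h <;> simp [h]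

theorem taylorCoeff_clm (A : E →L[ℂ] F) {f : ℂ → E} (hf : Differentiable ℂ f) (z₀ : ℂ) (k : ℕ) :
    taylorCoeff (fun z => A (f z)) z₀ k = A (taylorCoeff f z₀ k) := by
  have h : ∀ k, iteratedDeriv k (fun z => A (f z)) = fun z => A (iteratedDeriv k f z) := by
    intro k
    induction k with
    | zero => simp
    | succ k ih =>
      ext1 z
      rw [iteratedDeriv_succ, ih, iteratedDeriv_succ]
      have hd : DifferentiableAt ℂ (iteratedDeriv k f) z :=
        (hf.contDiff (n := ⊤)).differentiable_iteratedDeriv k (by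
          exact_mod_cast WithTop.coe_lt_top _) z
      exact ((A.hasFDerivAt).comp_hasDerivAt z hd.hasDerivAt).deriv
  unfold taylorCoeff
  rw [h, map_smul]

theorem taylorCoeff_smul {f : ℂ → ℂ} {g : ℂ → E} (hf : Differentiable ℂ f)
    (hg : Differentiable ℂ g) (z₀ : ℂ) (k : ℕ) :
    taylorCoeff (fun z => f z • g z) z₀ k
      = ∑ p ∈ Finset.HasAntidiagonal.antidiagonal k, taylorCoeff f z₀ p.1 • taylorCoeff g z₀ p.2 := by
  unfold taylorCoeff
  have h := iteratedDerivWithin_smul (n := k) (Set.mem_univ z₀) uniqueDiffOn_univ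
    hf.contDiff.contDiffAt.contDiffWithinAt hg.contDiff.contDiffAt.contDiffWithinAt
  simp only [iteratedDerivWithin_univ] at h
  change _ • iteratedDeriv k (f • g) z₀ = _
  rw [h, Finset.Nat.sum_antidiagonal_eq_sum_range_succ_mk, Finset.smul_sum]
  refine Finset.sum_congr rfl fun i hi => ?_
  rw [← Nat.cast_smul_eq_nsmul ℂ, Nat.cast_choose ℂ (by simpa [Nat.lt_succ_iff] using hi),
    smul_smul, smul_smul, smul_smul]
  congr 1
  rw [smul_eq_mul]
  have := Nat.factorial_ne_zero k
  field_simp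

theorem taylorCoeff_id (z₀ : ℂ) (k : ℕ) :
    taylorCoeff (fun z : ℂ => z) z₀ k = if k = 0 then z₀ else if k = 1 then 1 else 0 := by
  unfold taylorCoeff
  rw [iteratedDeriv_fun_id]
  split_ifs with h h' <;> simp [*]

/-- Shift of a sequence by one place. -/
def shiftSeq (u : ℕ → E) : ℕ → E
  | 0 => 0
  | k + 1 => u k

theorem taylorCoeff_id_smul {g : ℂ → E} (hg : Differentiable ℂ g) (z₀ : ℂ) (k : ℕ) :
    taylorCoeff (fun z => z • g z) z₀ k
      = z₀ • taylorCoeff g z₀ k + shiftSeq (taylorCoeff g z₀) k := by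
  rw [taylorCoeff_smul differentiable_fun_id hg]
  cases k with
  | zero => simp [taylorCoeff_id, shiftSeq]
  | succ k =>
    rw [Finset.Nat.sum_antidiagonal_succ]
    cases k with
    | zero => simp [taylorCoeff_id, shiftSeq]
    | succ k =>
      rw [Finset.Nat.sum_antidiagonal_succ]
      simp [taylorCoeff_id, shiftSeq]

/-- The algebra of entire functions. -/
def entireFunctions : Subalgebra ℂ (ℂ → ℂ) where
  carrier := {f | Differentiable ℂ f}
  mul_mem' := fun hf hg => Differentiable.mul hf hg
  add_mem' := fun hf hg => Differentiable.add hf hg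
  algebraMap_mem' := fun r => differentiable_const r

/-- Taylor expansion at a point as a ring homomorphism. -/
def taylorHom (z₀ : ℂ) : entireFunctions →+* PowerSeries ℂ where
  toFun f := PowerSeries.mk (taylorCoeff f.1 z₀)
  map_one' := by
    ext k
    rw [PowerSeries.coeff_mk, PowerSeries.coeff_one]
    exact taylorCoeff_const 1 z₀ k
  map_zero' := by
    ext k
    rw [PowerSeries.coeff_mk, map_zero]
    exact (taylorCoeff_const 0 z₀ k).trans (by simp)
  map_add' f g := by
    ext k
    rw [map_add, PowerSeries.coeff_mk, PowerSeries.coeff_mk, PowerSeries.coeff_mk]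
    exact taylorCoeff_add f.2 g.2 z₀ k
  map_mul' f g := by
    ext k
    rw [PowerSeries.coeff_mul, PowerSeries.coeff_mk]
    simp only [PowerSeries.coeff_mk]
    exact taylorCoeff_smul f.2 g.2 z₀ k

theorem coeff_taylorHom (z₀ : ℂ) (f : entireFunctions) (k : ℕ) :
    PowerSeries.coeff k (taylorHom z₀ f) = taylorCoeff f.1 z₀ k := by
  change PowerSeries.coeff k (PowerSeries.mk (taylorCoeff f.1 z₀)) = _
  exact PowerSeries.coeff_mk _ _

/-- Translates the analytic order into the X-adic valuation. A function that is not identically zero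
has finite order everywhere, and its first nonvanishing derivative is the nonzero constant term that
makes the cofactor a unit. -/
theorem taylorHom_eq_X_pow_mul (z₀ : ℂ) (f : entireFunctions) (hf : f.1 ≠ 0) :
    ∃ u, IsUnit u ∧ taylorHom z₀ f = PowerSeries.X ^ analyticOrderNatAt f.1 z₀ * u := by
  have han : AnalyticAt ℂ f.1 z₀ := Differentiable.analyticAt f.2 z₀
  have htop : analyticOrderAt f.1 z₀ ≠ ⊤ := fun h =>
    hf ((AnalyticOnNhd.analyticOrderAt_eq_top_iff_eq_zero z₀ (fun z =>
      Differentiable.analyticAt f.2 z)).1 h)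
  obtain ⟨h1, h2⟩ := (analyticOrderAt_eq_nat_iff_iteratedDeriv_eq_zero han).1
    (Nat.cast_analyticOrderNatAt htop).symm
  obtain ⟨u, hu⟩ : PowerSeries.X ^ analyticOrderNatAt f.1 z₀ ∣ taylorHom z₀ f := by
    rw [PowerSeries.X_pow_dvd_iff]
    intro m hm
    rw [coeff_taylorHom, taylorCoeff, h1 m hm, smul_zero]
  refine ⟨u, ?_, hu⟩
  rw [PowerSeries.isUnit_iff_constantCoeff, isUnit_iff_ne_zero]
  intro h0
  have h3 := coeff_taylorHom z₀ f (analyticOrderNatAt f.1 z₀)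
  rw [hu, PowerSeries.coeff_X_pow_mul', if_pos le_rfl, Nat.sub_self,
    PowerSeries.coeff_zero_eq_constantCoeff_apply, h0, taylorCoeff] at h3
  exact (smul_ne_zero (inv_ne_zero (Nat.cast_ne_zero.2 (Nat.factorial_ne_zero _))) h2) h3.symm

/-- The product of a scalar power series with a vector valued power series. -/
def seriesSMul (u : ℕ → E) (k : ℕ) : PowerSeries ℂ →ₗ[ℂ] E where
  toFun c := ∑ p ∈ Finset.HasAntidiagonal.antidiagonal k, PowerSeries.coeff p.1 c • u p.2
  map_add' c d := by simp [add_smul, Finset.sum_add_distrib]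
  map_smul' r c := by simp [Finset.smul_sum, mul_smul]

theorem seriesSMul_apply (u : ℕ → E) (k : ℕ) (c : PowerSeries ℂ) :
    seriesSMul u k c = ∑ p ∈ Finset.HasAntidiagonal.antidiagonal k, PowerSeries.coeff p.1 c • u p.2 := rfl

/-- Moves an index shift from the vector series to the scalar one. In this way the lower
coefficients of a formal solution reappear as the same coefficient with initial data `X • c`. -/
theorem seriesSMul_shiftSeq (u : ℕ → E) (k : ℕ) (c : PowerSeries ℂ) :
    seriesSMul (shiftSeq u) k c = seriesSMul u k (PowerSeries.X * c) := by
  simp only [seriesSMul_apply]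
  cases k with
  | zero => simp [shiftSeq]
  | succ k =>
    rw [Finset.Nat.sum_antidiagonal_succ', Finset.Nat.sum_antidiagonal_succ]
    simp [shiftSeq, PowerSeries.coeff_succ_X_mul]

theorem seriesSMul_X_mul_zero (u : ℕ → E) (c : PowerSeries ℂ) :
    seriesSMul u 0 (PowerSeries.X * c) = 0 := by
  rw [← seriesSMul_shiftSeq]
  simp [seriesSMul_apply, shiftSeq]

theorem seriesSMul_X_mul_succ (u : ℕ → E) (k : ℕ) (c : PowerSeries ℂ) :
    seriesSMul u (k + 1) (PowerSeries.X * c) = seriesSMul u k c := by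
  rw [← seriesSMul_shiftSeq]
  simp only [seriesSMul_apply]
  rw [Finset.Nat.sum_antidiagonal_succ']
  simp [shiftSeq]

theorem seriesSMul_add (u v : ℕ → E) (k : ℕ) (c : PowerSeries ℂ) :
    seriesSMul (fun k => u k + v k) k c = seriesSMul u k c + seriesSMul v k c := by
  simp [seriesSMul_apply, Finset.sum_add_distrib]

theorem seriesSMul_clm (A : E →L[ℂ] F) (u : ℕ → E) (k : ℕ) (c : PowerSeries ℂ) :
    seriesSMul (fun k => A (u k)) k c = A (seriesSMul u k c) := by
  simp [seriesSMul_apply]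

theorem seriesSMul_single (v : E) (k : ℕ) (c : PowerSeries ℂ) :
    seriesSMul (fun k => if k = 0 then v else 0) k c = PowerSeries.coeff k c • v := by
  rw [seriesSMul_apply, Finset.sum_eq_single (k, 0)]
  · simp
  · rintro ⟨i, j⟩ hp hne
    have : j ≠ 0 := by
      rintro rfl
      simp only [Finset.HasAntidiagonal.mem_antidiagonal, add_zero] at hp
      exact hne (by rw [hp])
    simp [this]
  · simp

theorem seriesSMul_taylorCoeff (z₀ : ℂ) (f : entireFunctions) (k : ℕ) (c : PowerSeries ℂ) :
    seriesSMul (taylorCoeff f.1 z₀) k c = PowerSeries.coeff k (taylorHom z₀ f * c) := by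
  rw [mul_comm, PowerSeries.coeff_mul, seriesSMul_apply]
  simp [coeff_taylorHom]

theorem seriesSMul_congr_coeff (u : ℕ → E) {k : ℕ} {c d : PowerSeries ℂ}
    (h : ∀ j ≤ k, PowerSeries.coeff j c = PowerSeries.coeff j d) :
    seriesSMul u k c = seriesSMul u k d := by
  simp only [seriesSMul_apply]
  refine Finset.sum_congr rfl fun p hp => ?_
  rw [h p.1 (by have := Finset.HasAntidiagonal.mem_antidiagonal.1 hp; omega)]

end Taylor

/-! ### The edge equation as a Volterra integral equation on continuous functions. -/

section Volterra

/-- Continuous functions on one edge. -/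
def EdgeC : Type := C(Set.Icc (0 : ℝ) 1, ℂ)

namespace EdgeC

instance : NormedCommRing EdgeC := inferInstanceAs (NormedCommRing C(Set.Icc (0 : ℝ) 1, ℂ))

instance : NormedAlgebra ℂ EdgeC := inferInstanceAs (NormedAlgebra ℂ C(Set.Icc (0 : ℝ) 1, ℂ))

instance : CompleteSpace EdgeC := inferInstanceAs (CompleteSpace C(Set.Icc (0 : ℝ) 1, ℂ))

instance : FunLike EdgeC (Set.Icc (0 : ℝ) 1) ℂ :=
  inferInstanceAs (FunLike C(Set.Icc (0 : ℝ) 1, ℂ) (Set.Icc (0 : ℝ) 1) ℂ)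

@[ext]
theorem ext {f g : EdgeC} (h : ∀ x, f x = g x) : f = g := DFunLike.ext f g h

/-- Construct an element from a continuous function. -/
def mk (f : Set.Icc (0 : ℝ) 1 → ℂ) (hf : Continuous f) : EdgeC :=
  (⟨f, hf⟩ : C(Set.Icc (0 : ℝ) 1, ℂ))

@[simp]
theorem mk_apply (f : Set.Icc (0 : ℝ) 1 → ℂ) (hf : Continuous f) (x : Set.Icc (0 : ℝ) 1) :
    mk f hf x = f x := rfl

@[simp]
theorem add_apply (f g : EdgeC) (x : Set.Icc (0 : ℝ) 1) : (f + g) x = f x + g x := rfl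

@[simp]
theorem sub_apply (f g : EdgeC) (x : Set.Icc (0 : ℝ) 1) : (f - g) x = f x - g x := rfl

@[simp]
theorem neg_apply (f : EdgeC) (x : Set.Icc (0 : ℝ) 1) : (-f) x = -f x := rfl

@[simp]
theorem mul_apply (f g : EdgeC) (x : Set.Icc (0 : ℝ) 1) : (f * g) x = f x * g x := rfl

@[simp]
theorem smul_apply (c : ℂ) (f : EdgeC) (x : Set.Icc (0 : ℝ) 1) : (c • f) x = c * f x := rfl

@[simp]
theorem one_apply (x : Set.Icc (0 : ℝ) 1) : (1 : EdgeC) x = 1 := rfl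

@[simp]
theorem zero_apply (x : Set.Icc (0 : ℝ) 1) : (0 : EdgeC) x = 0 := rfl

protected theorem continuous (f : EdgeC) : Continuous f :=
  ContinuousMap.continuous (f : C(Set.Icc (0 : ℝ) 1, ℂ))

theorem norm_coe_le_norm (f : EdgeC) (x : Set.Icc (0 : ℝ) 1) : ‖f x‖ ≤ ‖f‖ :=
  ContinuousMap.norm_coe_le_norm (f : C(Set.Icc (0 : ℝ) 1, ℂ)) x

theorem norm_le (f : EdgeC) {C : ℝ} (hC : 0 ≤ C) : ‖f‖ ≤ C ↔ ∀ x, ‖f x‖ ≤ C :=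
  ContinuousMap.norm_le (f : C(Set.Icc (0 : ℝ) 1, ℂ)) hC

end EdgeC

/-- The end points of the edge. -/
abbrev edgeZero : Set.Icc (0 : ℝ) 1 := ⟨0, by simp⟩

abbrev edgeOne : Set.Icc (0 : ℝ) 1 := ⟨1, by simp⟩

/-- Extension of a continuous function on an edge to the real line. -/
def edgeExt (f : EdgeC) : ℝ → ℂ := Set.IccExtend zero_le_one (fun x => f x)

theorem continuous_edgeExt (f : EdgeC) : Continuous (edgeExt f) := f.continuous.Icc_extend'

theorem edgeExt_of_mem (f : EdgeC) {x : ℝ} (hx : x ∈ Set.Icc (0 : ℝ) 1) : edgeExt f x = f ⟨x, hx⟩ :=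
  Set.IccExtend_of_mem _ _ hx

theorem norm_edgeExt_le (f : EdgeC) (x : ℝ) : ‖edgeExt f x‖ ≤ ‖f‖ := f.norm_coe_le_norm _

theorem edgeExt_add (f g : EdgeC) (x : ℝ) : edgeExt (f + g) x = edgeExt f x + edgeExt g x := rfl

theorem edgeExt_smul (c : ℂ) (f : EdgeC) (x : ℝ) : edgeExt (c • f) x = c * edgeExt f x := rfl

theorem edgeExt_mul (f g : EdgeC) (x : ℝ) : edgeExt (f * g) x = edgeExt f x * edgeExt g x := rfl

theorem continuous_primitive_edgeExt (f : EdgeC) :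
    Continuous fun x : ℝ => ∫ t in (0 : ℝ)..x, edgeExt f t :=
  intervalIntegral.continuous_primitive
    (fun _ _ => (continuous_edgeExt f).intervalIntegrable _ _) 0

/-- Integration from `0`. -/
def edgeInt : EdgeC →L[ℂ] EdgeC :=
  LinearMap.mkContinuous
    { toFun := fun f => EdgeC.mk (fun x => ∫ t in (0 : ℝ)..x, edgeExt f t)
        ((continuous_primitive_edgeExt f).comp continuous_subtype_val)
      map_add' := fun f g => by
        ext x
        simp only [EdgeC.mk_apply, EdgeC.add_apply, edgeExt_add]
        exact intervalIntegral.integral_add ((continuous_edgeExt f).intervalIntegrable _ _)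
          ((continuous_edgeExt g).intervalIntegrable _ _)
      map_smul' := fun c f => by
        ext x
        simp only [EdgeC.mk_apply, EdgeC.smul_apply, edgeExt_smul, RingHom.id_apply]
        exact intervalIntegral.integral_const_mul _ _ } 1 (fun f => by
      rw [one_mul, EdgeC.norm_le _ (norm_nonneg f)]
      intro x
      refine (intervalIntegral.norm_integral_le_of_norm_le_const
        (C := ‖f‖) fun t _ => norm_edgeExt_le f t).trans ?_
      rw [sub_zero, abs_of_nonneg x.2.1]
      exact mul_le_of_le_one_right (norm_nonneg f) x.2.2)

theorem edgeInt_apply (f : EdgeC) (x : Set.Icc (0 : ℝ) 1) :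
    edgeInt f x = ∫ t in (0 : ℝ)..x, edgeExt f t := rfl

theorem norm_edgeInt_le_of_norm_le {f : EdgeC} {C : ℝ} {n : ℕ}
    (hf : ∀ x, ‖f x‖ ≤ C * (x : ℝ) ^ n) (x : Set.Icc (0 : ℝ) 1) :
    ‖edgeInt f x‖ ≤ C / (n + 1) * (x : ℝ) ^ (n + 1) := by
  rw [edgeInt_apply]
  have h : ‖∫ t in (0 : ℝ)..x, edgeExt f t‖ ≤ ∫ t in (0 : ℝ)..x, C * t ^ n := by
    refine intervalIntegral.norm_integral_le_of_norm_le x.2.1 ?_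
      (Continuous.intervalIntegrable (by fun_prop) _ _)
    refine Filter.Eventually.of_forall fun t ht => ?_
    rw [edgeExt_of_mem f ⟨ht.1.le, ht.2.trans x.2.2⟩]
    exact hf _
  refine h.trans (le_of_eq ?_)
  rw [intervalIntegral.integral_const_mul, integral_pow]
  simp only [ne_eq, Nat.add_eq_zero_iff, one_ne_zero, and_false, not_false_eq_true, zero_pow]
  ring

/-- The operator `f ↦ ∫∫ m f`. -/
def volterra (m : EdgeC) : EdgeC →L[ℂ] EdgeC :=
  edgeInt ∘L edgeInt ∘L ContinuousLinearMap.mul ℂ EdgeC m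

theorem volterra_apply (m f : EdgeC) : volterra m f = edgeInt (edgeInt (m * f)) := rfl

/-- The factor `x ^ n` is what closes the induction: it turns one integration into a gain of `1 / (n
+ 1)`. The second integration in each step could gain more, but is only bounded by 1. -/
theorem norm_volterra_pow_le (m f : EdgeC) (n : ℕ) (x : Set.Icc (0 : ℝ) 1) :
    ‖(volterra m ^ n) f x‖ ≤ ‖m‖ ^ n / n.factorial * ‖f‖ * (x : ℝ) ^ n := by
  induction n generalizing x with
  | zero => simpa using f.norm_coe_le_norm x
  | succ n ih =>
    set C := ‖m‖ ^ (n + 1) / n.factorial * ‖f‖ with hC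
    have hC0 : 0 ≤ C := by positivity
    rw [pow_succ', mul_apply_eq_comp, volterra_apply]
    have h1 : ∀ x, ‖(m * (volterra m ^ n) f) x‖ ≤ C * (x : ℝ) ^ n := by
      intro x
      rw [EdgeC.mul_apply, norm_mul]
      calc ‖m x‖ * ‖(volterra m ^ n) f x‖
          ≤ ‖m‖ * (‖m‖ ^ n / n.factorial * ‖f‖ * (x : ℝ) ^ n) :=
            mul_le_mul (m.norm_coe_le_norm x) (ih x) (norm_nonneg _) (norm_nonneg _)
        _ = C * (x : ℝ) ^ n := by rw [hC]; ring
    have h2 := norm_edgeInt_le_of_norm_le h1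
    have h3 := norm_edgeInt_le_of_norm_le h2 x
    refine h3.trans ?_
    have hx0 : (0 : ℝ) ≤ x := x.2.1
    have hx1 : (x : ℝ) ≤ 1 := x.2.2
    have e : ‖m‖ ^ (n + 1) / (n + 1).factorial * ‖f‖ = C / (n + 1) := by
      rw [hC, Nat.factorial_succ]
      push_cast
      field_simp
    rw [e]
    have h4 : C / (n + 1) / ((n + 1 : ℕ) + 1) ≤ C / (n + 1) :=
      div_le_self (by positivity) (by push_cast; linarith [(Nat.cast_nonneg n : (0 : ℝ) ≤ n)])
    exact mul_le_mul h4 (pow_le_pow_of_le_one hx0 hx1 (by omega)) (by positivity) (by positivity)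

theorem norm_volterra_pow (m : EdgeC) (n : ℕ) : ‖volterra m ^ n‖ ≤ ‖m‖ ^ n / n.factorial := by
  refine ContinuousLinearMap.opNorm_le_bound _ (by positivity) fun f => ?_
  rw [EdgeC.norm_le _ (by positivity)]
  intro x
  exact (norm_volterra_pow_le m f n x).trans
    (mul_le_of_le_one_right (by positivity) (pow_le_one₀ x.2.1 x.2.2))

/-- The factorial bound makes some power of the operator a strict contraction, however large `m` is.
Then `1 - A ^ n` is a unit, and `1 - A` is one of its two commuting factors. -/
theorem isUnit_one_sub_volterra (m : EdgeC) : IsUnit (1 - volterra m) := by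
  obtain ⟨n, hn⟩ := ((FloorSemiring.tendsto_pow_div_factorial_atTop ‖m‖).eventually
    (gt_mem_nhds one_pos)).exists
  have h1 : IsUnit (1 - volterra m ^ n) := by
    have := isUnit_one_sub_of_norm_lt_one (x := volterra m ^ n) ((norm_volterra_pow m n).trans_lt hn)
    exact this
  have hc : Commute (1 - volterra m) (∑ i ∈ Finset.range n, volterra m ^ i) :=
    (Commute.sum_right _ _ _ fun i _ =>
      (Commute.one_left _).sub_left ((Commute.refl _).pow_right i))
  rw [← mul_neg_geom_sum, hc.isUnit_mul_iff] at h1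
  exact h1.1

theorem volterra_solution_unique {m f : EdgeC} (h : f = edgeInt (edgeInt (m * f))) : f = 0 := by
  obtain ⟨v, hv⟩ := (isUnit_one_sub_volterra m).exists_left_inv
  have h1 : (1 - volterra m) f = 0 := by
    rw [sub_apply, volterra_apply, ← h]
    simp
  have h2 := congrArg (fun A : EdgeC →L[ℂ] EdgeC => A f) hv
  simp only [mul_apply_eq_comp, h1, map_zero] at h2
  simpa using h2.symm

/-- The first order system for `(f, f')` with `f'' = m f + g` is uniquely solvable. -/
theorem edge_system_unique {m g f f₁ h h₁ : EdgeC} {c d : ℂ}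
    (hf : f = c • 1 + edgeInt f₁) (hf₁ : f₁ = d • 1 + edgeInt (m * f + g))
    (hh : h = c • 1 + edgeInt h₁) (hh₁ : h₁ = d • 1 + edgeInt (m * h + g)) : f = h ∧ f₁ = h₁ := by
  have h1 : f₁ - h₁ = edgeInt (m * (f - h)) := by
    rw [hf₁, hh₁, add_sub_add_left_eq_sub, ← map_sub]
    congr 1
    rw [mul_sub]; abel
  have h2 : f - h = edgeInt (f₁ - h₁) := by
    rw [map_sub]
    nth_rw 1 [hf, hh]
    abel
  have h3 : f - h = 0 := volterra_solution_unique (by rw [← h1]; exact h2)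
  refine ⟨sub_eq_zero.1 h3, sub_eq_zero.1 ?_⟩
  rw [h1, h3, mul_zero, map_zero]

end Volterra

/-! ### Fundamental solutions, entire in the spectral parameter, and their formal expansions. -/

section FundamentalSystem

variable (α β : EdgeC)

/-- The coefficient `z² + 2 z a - b` of the equation on an edge. -/
def edgeCoeff (z : ℂ) : EdgeC := (z * z) • 1 + z • ((2 : ℂ) • α) - β

theorem differentiable_edgeCoeff : Differentiable ℂ (edgeCoeff α β) := by
  unfold edgeCoeff
  fun_prop

/-- Initial values of the fundamental system. -/
def initialValue (s : Fin 2) : EdgeC := if s = 0 then 1 else edgeInt 1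

/-- The fundamental system of solutions. -/
def fundSol (s : Fin 2) (z : ℂ) : EdgeC :=
  Ring.inverse (1 - volterra (edgeCoeff α β z)) (initialValue s)

/-- The derivatives of the fundamental system. -/
def fundSolDeriv (s : Fin 2) (z : ℂ) : EdgeC :=
  (if s = 1 then 1 else 0) + edgeInt (edgeCoeff α β z * fundSol α β s z)

theorem fundSol_eq (s : Fin 2) (z : ℂ) :
    fundSol α β s z = (if s = 0 then (1 : EdgeC) else 0) + edgeInt (fundSolDeriv α β s z) := by
  have h := Ring.mul_inverse_cancel _ (isUnit_one_sub_volterra (edgeCoeff α β z))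
  have h2 := congrArg (fun A : EdgeC →L[ℂ] EdgeC => A (initialValue s)) h
  simp only [mul_apply_eq_comp, sub_apply,
    one_apply_eq_self, volterra_apply] at h2
  have h3 : fundSol α β s z
      = initialValue s + edgeInt (edgeInt (edgeCoeff α β z * fundSol α β s z)) :=
    sub_eq_iff_eq_add.1 h2
  unfold fundSolDeriv
  rw [map_add, ← add_assoc]
  nth_rw 1 [h3]
  congr 1
  unfold initialValue
  fin_cases s <;> simp

/-- Inversion in the Banach algebra of operators is holomorphic at units, and the Volterra structure
makes every `z` a point where a unit is inverted. Hence there are no poles. -/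
theorem differentiable_fundSol (s : Fin 2) : Differentiable ℂ (fundSol α β s) := by
  intro z
  have h1 : DifferentiableAt ℂ (fun z => (1 : EdgeC →L[ℂ] EdgeC) - volterra (edgeCoeff α β z)) z := by
    unfold volterra
    have h2 : DifferentiableAt ℂ (fun z => ContinuousLinearMap.mul ℂ EdgeC (edgeCoeff α β z)) z :=
      (ContinuousLinearMap.mul ℂ EdgeC).differentiableAt.comp z (differentiable_edgeCoeff α β z)
    have h3 : DifferentiableAt ℂ (fun z => edgeInt ∘L ContinuousLinearMap.mul ℂ EdgeC
      (edgeCoeff α β z)) z := (differentiableAt_const _).clm_comp h2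
    exact (differentiableAt_const _).sub ((differentiableAt_const _).clm_comp h3)
  obtain ⟨w, hw⟩ := isUnit_one_sub_volterra (edgeCoeff α β z)
  have h4 : DifferentiableAt ℂ Ring.inverse ((1 : EdgeC →L[ℂ] EdgeC) - volterra (edgeCoeff α β z)) := by
    rw [← hw]; exact differentiableAt_inverse w.isUnit
  exact (DifferentiableAt.comp z h4 h1).clm_apply (differentiableAt_const _)

theorem differentiable_fundSolDeriv (s : Fin 2) : Differentiable ℂ (fundSolDeriv α β s) := by
  unfold fundSolDeriv
  exact (differentiable_const _).add (edgeInt.differentiable.fun_comp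
    ((differentiable_edgeCoeff α β).mul (differentiable_fundSol α β s)))

/-- The derivative `2 z + 2 a` of the coefficient with respect to `z`. -/
def edgeCoeffDeriv (z : ℂ) : EdgeC := (2 * z) • 1 + (2 : ℂ) • α

/-- The coefficient is a quadratic polynomial in `z` with leading term `z²`, so the Cauchy product
has only three terms: value, first derivative, and half the second derivative, which is 1. -/
theorem taylorCoeff_edgeCoeff_mul {Y : ℂ → EdgeC} (hY : Differentiable ℂ Y) (z₀ : ℂ) (k : ℕ) :
    taylorCoeff (fun z => edgeCoeff α β z * Y z) z₀ k
      = edgeCoeff α β z₀ * taylorCoeff Y z₀ k + edgeCoeffDeriv α z₀ * shiftSeq (taylorCoeff Y z₀) k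
        + shiftSeq (shiftSeq (taylorCoeff Y z₀)) k := by
  obtain ⟨A, hA'⟩ : ∃ A : EdgeC →L[ℂ] EdgeC, ∀ f, A f = ((2 : ℂ) • α) * f :=
    ⟨ContinuousLinearMap.mul ℂ EdgeC ((2 : ℂ) • α), fun _ => rfl⟩
  obtain ⟨B, hB'⟩ : ∃ B : EdgeC →L[ℂ] EdgeC, ∀ f, B f = -β * f :=
    ⟨ContinuousLinearMap.mul ℂ EdgeC (-β), fun _ => rfl⟩
  have e : (fun z => edgeCoeff α β z * Y z)
      = fun z => (z • (z • Y z) + z • A (Y z)) + B (Y z) := by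
    ext1 z
    rw [hA', hB', edgeCoeff, sub_mul, add_mul, smul_mul_assoc, one_mul, smul_mul_assoc z, mul_smul,
      neg_mul, sub_eq_add_neg]
  have hA : Differentiable ℂ fun z => A (Y z) := A.differentiable.comp hY
  have hB : Differentiable ℂ fun z => B (Y z) := B.differentiable.comp hY
  have hz : Differentiable ℂ fun z : ℂ => z • Y z := differentiable_fun_id.fun_smul hY
  have e1 : shiftSeq (taylorCoeff (fun z => A (Y z)) z₀) k = A (shiftSeq (taylorCoeff Y z₀) k) := by
    cases k with
    | zero => simp only [shiftSeq, map_zero]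
    | succ k => simp only [shiftSeq, taylorCoeff_clm _ hY]
  have e2 : shiftSeq (taylorCoeff (fun z => z • Y z) z₀) k
      = z₀ • shiftSeq (taylorCoeff Y z₀) k + shiftSeq (shiftSeq (taylorCoeff Y z₀)) k := by
    cases k with
    | zero => simp only [shiftSeq, smul_zero, add_zero]
    | succ k => simp only [shiftSeq, taylorCoeff_id_smul hY]
  rw [e, taylorCoeff_add ((differentiable_fun_id.fun_smul hz).fun_add
      (differentiable_fun_id.fun_smul hA)) hB,
    taylorCoeff_add (differentiable_fun_id.fun_smul hz) (differentiable_fun_id.fun_smul hA),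
    taylorCoeff_id_smul hz, taylorCoeff_id_smul hA, taylorCoeff_id_smul hY, taylorCoeff_clm _ hY,
    taylorCoeff_clm _ hY, e1, e2, hA', hA', hB', edgeCoeff, edgeCoeffDeriv]
  generalize taylorCoeff Y z₀ k = y
  generalize shiftSeq (taylorCoeff Y z₀) k = y'
  generalize shiftSeq (shiftSeq (taylorCoeff Y z₀)) k = y''
  simp only [smul_add, smul_smul, add_mul, sub_mul, smul_mul_assoc, one_mul, neg_mul, two_mul,
    add_smul]
  abel

theorem taylorCoeff_fundSol (s : Fin 2) (z₀ : ℂ) (k : ℕ) :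
    taylorCoeff (fundSol α β s) z₀ k
      = (if k = 0 then (if s = 0 then (1 : EdgeC) else 0) else 0)
        + edgeInt (taylorCoeff (fundSolDeriv α β s) z₀ k) := by
  have e : fundSol α β s = fun z => (if s = 0 then (1 : EdgeC) else 0)
      + edgeInt (fundSolDeriv α β s z) := funext fun z => fundSol_eq α β s z
  rw [e, taylorCoeff_add (differentiable_const _)
    (edgeInt.differentiable.fun_comp (differentiable_fundSolDeriv α β s)),
    taylorCoeff_clm _ (differentiable_fundSolDeriv α β s), taylorCoeff_const]

theorem taylorCoeff_fundSolDeriv (s : Fin 2) (z₀ : ℂ) (k : ℕ) :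
    taylorCoeff (fundSolDeriv α β s) z₀ k
      = (if k = 0 then (if s = 1 then (1 : EdgeC) else 0) else 0)
        + edgeInt (edgeCoeff α β z₀ * taylorCoeff (fundSol α β s) z₀ k
          + edgeCoeffDeriv α z₀ * shiftSeq (taylorCoeff (fundSol α β s) z₀) k
          + shiftSeq (shiftSeq (taylorCoeff (fundSol α β s) z₀)) k) := by
  have hm : Differentiable ℂ fun z => edgeCoeff α β z * fundSol α β s z :=
    (differentiable_edgeCoeff α β).mul (differentiable_fundSol α β s)
  rw [← taylorCoeff_edgeCoeff_mul α β (differentiable_fundSol α β s), ← taylorCoeff_clm _ hm,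
    ← taylorCoeff_const, ← taylorCoeff_add (differentiable_const _)
    (edgeInt.differentiable.fun_comp hm)]
  rfl

/-- The coefficients of the formal solution with initial values `(c 0, c 1)`. -/
def formalSol (z₀ : ℂ) (k : ℕ) : (Fin 2 → PowerSeries ℂ) →ₗ[ℂ] EdgeC :=
  ∑ s, seriesSMul (taylorCoeff (fundSol α β s) z₀) k ∘ₗ LinearMap.proj s

/-- The coefficients of the derivative of the formal solution. -/
def formalSolDeriv (z₀ : ℂ) (k : ℕ) : (Fin 2 → PowerSeries ℂ) →ₗ[ℂ] EdgeC :=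
  ∑ s, seriesSMul (taylorCoeff (fundSolDeriv α β s) z₀) k ∘ₗ LinearMap.proj s

theorem formalSol_apply (z₀ : ℂ) (k : ℕ) (c : Fin 2 → PowerSeries ℂ) :
    formalSol α β z₀ k c = ∑ s, seriesSMul (taylorCoeff (fundSol α β s) z₀) k (c s) := by
  simp [formalSol]

theorem formalSolDeriv_apply (z₀ : ℂ) (k : ℕ) (c : Fin 2 → PowerSeries ℂ) :
    formalSolDeriv α β z₀ k c = ∑ s, seriesSMul (taylorCoeff (fundSolDeriv α β s) z₀) k (c s) := by
  simp [formalSolDeriv]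

theorem formalSol_eq (z₀ : ℂ) (k : ℕ) (c : Fin 2 → PowerSeries ℂ) :
    formalSol α β z₀ k c = PowerSeries.coeff k (c 0) • 1 + edgeInt (formalSolDeriv α β z₀ k c) := by
  have e : ∀ s, taylorCoeff (fundSol α β s) z₀ = fun k =>
      (if k = 0 then (if s = 0 then (1 : EdgeC) else 0) else 0)
        + edgeInt (taylorCoeff (fundSolDeriv α β s) z₀ k) :=
    fun s => funext fun k => taylorCoeff_fundSol α β s z₀ k
  rw [formalSol_apply, formalSolDeriv_apply, map_sum]
  simp only [e, seriesSMul_add, seriesSMul_single, seriesSMul_clm, Finset.sum_add_distrib]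
  congr 1
  simp

/-- The data `X • c` and `X • X • c` stand for the coefficients of index `k - 1` and `k - 2`. The
equation for the `k`-th coefficient is therefore inhomogeneous with the two preceding ones as
sources, which is the relation satisfied by a Jordan chain. -/
theorem formalSolDeriv_eq (z₀ : ℂ) (k : ℕ) (c : Fin 2 → PowerSeries ℂ) :
    formalSolDeriv α β z₀ k c = PowerSeries.coeff k (c 1) • 1
      + edgeInt (edgeCoeff α β z₀ * formalSol α β z₀ k c
        + (edgeCoeffDeriv α z₀ * formalSol α β z₀ k ((PowerSeries.X : PowerSeries ℂ) • c)
        + formalSol α β z₀ k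
            ((PowerSeries.X : PowerSeries ℂ) • (PowerSeries.X : PowerSeries ℂ) • c))) := by
  set A : EdgeC →L[ℂ] EdgeC := ContinuousLinearMap.mul ℂ EdgeC (edgeCoeff α β z₀) with hA
  set B : EdgeC →L[ℂ] EdgeC := ContinuousLinearMap.mul ℂ EdgeC (edgeCoeffDeriv α z₀) with hB
  have e : ∀ s, taylorCoeff (fundSolDeriv α β s) z₀ = fun k =>
      (if k = 0 then (if s = 1 then (1 : EdgeC) else 0) else 0)
        + edgeInt (A (taylorCoeff (fundSol α β s) z₀ k)
          + B (shiftSeq (taylorCoeff (fundSol α β s) z₀) k)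
          + shiftSeq (shiftSeq (taylorCoeff (fundSol α β s) z₀)) k) :=
    fun s => funext fun k => taylorCoeff_fundSolDeriv α β s z₀ k
  change _ = _ + edgeInt (A (formalSol α β z₀ k c) + (B (formalSol α β z₀ k _) + _))
  rw [formalSolDeriv_apply]
  simp only [e, seriesSMul_add, seriesSMul_single, seriesSMul_clm, Finset.sum_add_distrib,
    formalSol_apply, map_add, map_sum, seriesSMul_shiftSeq, Pi.smul_apply, smul_eq_mul]
  congr 1
  · simp
  · rw [add_assoc]

theorem formalSol_X_smul_zero (z₀ : ℂ) (c : Fin 2 → PowerSeries ℂ) :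
    formalSol α β z₀ 0 ((PowerSeries.X : PowerSeries ℂ) • c) = 0 := by
  simp [formalSol_apply, seriesSMul_X_mul_zero]

theorem formalSol_X_smul_succ (z₀ : ℂ) (k : ℕ) (c : Fin 2 → PowerSeries ℂ) :
    formalSol α β z₀ (k + 1) ((PowerSeries.X : PowerSeries ℂ) • c) = formalSol α β z₀ k c := by
  simp [formalSol_apply, seriesSMul_X_mul_succ]

theorem formalSol_congr_coeff (z₀ : ℂ) {k : ℕ} {c d : Fin 2 → PowerSeries ℂ}
    (h : ∀ s, ∀ j ≤ k, PowerSeries.coeff j (c s) = PowerSeries.coeff j (d s)) :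
    formalSol α β z₀ k c = formalSol α β z₀ k d := by
  simp only [formalSol_apply]
  exact Finset.sum_congr rfl fun s _ => seriesSMul_congr_coeff _ (h s)

end FundamentalSystem

/-! ### Passage between Sobolev classes and continuous solutions of integral equations. -/

section EdgeL2

theorem memLp_edgeExt (f : EdgeC) : MemLp (edgeExt f) 2 unitVol :=
  MemLp.of_bound (continuous_edgeExt f).aestronglyMeasurable ‖f‖
    (Filter.Eventually.of_forall fun x => norm_edgeExt_le f x)

/-- The class in `L²` of a continuous function. -/
def toL2 : EdgeC →ₗ[ℂ] EdgeL2 where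
  toFun f := (memLp_edgeExt f).toLp (edgeExt f)
  map_add' _ _ := rfl
  map_smul' _ _ := rfl

theorem coeFn_toL2 (f : EdgeC) : toL2 f =ᵐ[unitVol] edgeExt f := (memLp_edgeExt f).coeFn_toLp

theorem toL2_eq_of_ae {f : EdgeC} {u : EdgeL2} (h : u =ᵐ[unitVol] edgeExt f) : u = toL2 f :=
  Lp.ext (h.trans (coeFn_toL2 f).symm)

theorem toL2_injective : Function.Injective toL2 := by
  intro f g h
  have h1 : edgeExt f =ᵐ[unitVol] edgeExt g :=
    (coeFn_toL2 f).symm.trans (by rw [h]; exact coeFn_toL2 g)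
  have h2 := Measure.eqOn_Icc_of_ae_eq volume zero_ne_one h1 (continuous_edgeExt f).continuousOn
    (continuous_edgeExt g).continuousOn
  ext x
  have := h2 x.2
  rwa [edgeExt_of_mem f x.2, edgeExt_of_mem g x.2] at this

theorem hasDerivAt_integral_edgeExt (f : EdgeC) (x : ℝ) :
    HasDerivAt (fun x => ∫ t in (0 : ℝ)..x, edgeExt f t) (edgeExt f x) x :=
  intervalIntegral.integral_hasDerivAt_right ((continuous_edgeExt f).intervalIntegrable _ _)
    (continuous_edgeExt f).stronglyMeasurable.stronglyMeasurableAtFilter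
    (continuous_edgeExt f).continuousAt

theorem edgeInt_injective {f : EdgeC} (h : edgeInt f = 0) : f = 0 := by
  ext x
  have h1 : HasDerivWithinAt (fun _ : ℝ => (0 : ℂ)) (edgeExt f x) (Set.Icc 0 1) x :=
    (hasDerivAt_integral_edgeExt f x).hasDerivWithinAt.congr
      (fun y hy => (congrArg (fun g : EdgeC => g ⟨y, hy⟩) h).symm)
      (congrArg (fun g : EdgeC => g x) h).symm
  have h2 := (uniqueDiffOn_Icc zero_lt_one _ x.2).eq_deriv _ h1
    (hasDerivWithinAt_const (x : ℝ) (Set.Icc (0 : ℝ) 1) (0 : ℂ))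
  rwa [edgeExt_of_mem f x.2] at h2

theorem edgeInt_edgeZero (f : EdgeC) : edgeInt f edgeZero = 0 := by
  rw [edgeInt_apply]
  simp

theorem isW22_of_system {u u₁ w : EdgeC} {p q : Fin 2 → ℂ} (hu : u = p 0 • 1 + edgeInt u₁)
    (hu₁ : u₁ = q 0 • 1 + edgeInt w) (hp : p 1 = u edgeOne) (hq : q 1 = -u₁ edgeOne) :
    IsW22 (toL2 u) (toL2 w) p q := by
  have e : ∀ x (hx : x ∈ Set.Icc (0 : ℝ) 1), u ⟨x, hx⟩ = p 0 + ∫ t in (0 : ℝ)..x, edgeExt u₁ t := by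
    intro x hx
    conv_lhs => rw [hu]
    simp [edgeInt_apply]
  have e₁ : ∀ x (hx : x ∈ Set.Icc (0 : ℝ) 1), u₁ ⟨x, hx⟩ = q 0 + ∫ t in (0 : ℝ)..x, edgeExt w t := by
    intro x hx
    conv_lhs => rw [hu₁]
    simp [edgeInt_apply]
  have h0 : (0 : ℝ) ∈ Set.Icc (0 : ℝ) 1 := by simp
  have h1 : (1 : ℝ) ∈ Set.Icc (0 : ℝ) 1 := by simp
  refine ⟨edgeExt u, edgeExt u₁, coeFn_toL2 u, fun x hx => ?_, fun x hx => ?_, ?_, ?_, ?_, ?_⟩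
  · refine ((hasDerivAt_integral_edgeExt u₁ x).hasDerivWithinAt.const_add (p 0)).congr
      (fun y hy => ?_) ?_
    · rw [edgeExt_of_mem u hy, e y hy]
    · rw [edgeExt_of_mem u hx, e x hx]
  · rw [edgeExt_of_mem u₁ hx, edgeExt_of_mem u₁ h0, e₁ x hx, e₁ 0 h0,
      integral_edge_congr (coeFn_toL2 w) hx]
    simp
  · rw [edgeExt_of_mem u h0, e 0 h0]
    simp
  · rw [edgeExt_of_mem u h1, hp]
  · rw [edgeExt_of_mem u₁ h0, e₁ 0 h0]
    simp
  · rw [edgeExt_of_mem u₁ h1, hq]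

/-- The representative and its derivative are continuous from the start, but the second derivative
is only square integrable. The equation for `u₁` is therefore stated conditionally, to be used once
the second derivative is known to be continuous. -/
theorem system_of_isW22 {f h : EdgeL2} {p q : Fin 2 → ℂ} (H : IsW22 f h p q) :
    ∃ u u₁ : EdgeC, f = toL2 u ∧ u = p 0 • 1 + edgeInt u₁ ∧ p 1 = u edgeOne ∧
      q 1 = -u₁ edgeOne ∧ ∀ w : EdgeC, h = toL2 w → u₁ = q 0 • 1 + edgeInt w := by
  obtain ⟨g, g₁, hfg, hg, hg₁, hp0, hp1, hq0, hq1⟩ := H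
  have hgc : ContinuousOn g (Set.Icc 0 1) := fun x hx => (hg x hx).continuousWithinAt
  have hgc₁ : ContinuousOn g₁ (Set.Icc 0 1) := by
    have h1 : ContinuousOn (fun x => g₁ 0 + ∫ t in (0 : ℝ)..x, h t) (Set.Icc 0 1) := by
      refine continuousOn_const.add ?_
      have hi := intervalIntegrable_edge h (x := 1) (by simp)
      have := intervalIntegral.continuousOn_primitive_interval' hi (a := 0) (by simp)
      rwa [Set.uIcc_of_le zero_le_one] at this
    exact h1.congr hg₁
  set u : EdgeC := EdgeC.mk (fun x => g x) (continuousOn_iff_continuous_domRestrict.1 hgc)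
  set u₁ : EdgeC := EdgeC.mk (fun x => g₁ x) (continuousOn_iff_continuous_domRestrict.1 hgc₁)
  have hext : ∀ x ∈ Set.Icc (0 : ℝ) 1, edgeExt u x = g x := fun x hx => edgeExt_of_mem u hx
  have hext₁ : ∀ x ∈ Set.Icc (0 : ℝ) 1, edgeExt u₁ x = g₁ x := fun x hx => edgeExt_of_mem u₁ hx
  refine ⟨u, u₁, ?_, ?_, hp1, ?_, ?_⟩
  · refine toL2_eq_of_ae (hfg.trans ?_)
    filter_upwards [ae_restrict_mem measurableSet_Icc] with x hx
    exact (hext x hx).symm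
  · ext x
    simp only [EdgeC.add_apply, EdgeC.smul_apply, EdgeC.one_apply, mul_one, edgeInt_apply]
    have h2 : ∫ t in (0 : ℝ)..x, edgeExt u₁ t = g x - g 0 := by
      refine intervalIntegral.integral_eq_sub_of_hasDeriv_right_of_le x.2.1
        (hgc.mono (Set.Icc_subset_Icc le_rfl x.2.2)) (fun y hy => ?_)
        ((continuous_edgeExt u₁).intervalIntegrable _ _)
      have hy' : y ∈ Set.Icc (0 : ℝ) 1 := ⟨hy.1.le, hy.2.le.trans x.2.2⟩
      rw [hext₁ y hy']
      exact ((hg y hy').hasDerivAt (Icc_mem_nhds hy.1 (hy.2.trans_le x.2.2))).hasDerivWithinAt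
    rw [h2, hp0, show u x = g x from rfl]
    ring
  · rw [hq1]; rfl
  · rintro w rfl
    ext x
    simp only [EdgeC.add_apply, EdgeC.smul_apply, EdgeC.one_apply, mul_one, edgeInt_apply]
    rw [show u₁ x = g₁ x from rfl, hg₁ x x.2, hq0, integral_edge_congr (coeFn_toL2 w) x.2]

end EdgeL2

/-! ### The secular matrix and the coupling condition for formal solutions. -/

section Secular

variable {N : ℕ} (U : Matrix (Fin N × Fin 2) (Fin N × Fin 2) ℂ) (α β : Fin N → EdgeC)

/-- Evaluation at the end `x = 1`. -/
def evalOne : EdgeC →L[ℂ] ℂ :=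
  LinearMap.mkContinuous
    { toFun := fun f => f edgeOne, map_add' := fun _ _ => rfl, map_smul' := fun _ _ => rfl } 1
    fun f => by rw [one_mul]; exact f.norm_coe_le_norm _

theorem evalOne_apply (f : EdgeC) : evalOne f = f edgeOne := rfl

/-- The value at `x = 1` of the fundamental solutions. -/
def endValue (e : Fin N) (s : Fin 2) : entireFunctions :=
  ⟨fun z => evalOne (fundSol (α e) (β e) s z),
    evalOne.differentiable.comp (differentiable_fundSol (α e) (β e) s)⟩

/-- The derivative at `x = 1` of the fundamental solutions. -/
def endDeriv (e : Fin N) (s : Fin 2) : entireFunctions :=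
  ⟨fun z => evalOne (fundSolDeriv (α e) (β e) s z),
    evalOne.differentiable.comp (differentiable_fundSolDeriv (α e) (β e) s)⟩

/-- The boundary values in terms of the values `(ψ(0), ψ'(0))`. -/
def valueMatrix : Matrix (Fin N × Fin 2) (Fin N × Fin 2) entireFunctions := fun p r =>
  if p.1 = r.1 then (if p.2 = 0 then (if r.2 = 0 then 1 else 0) else endValue α β p.1 r.2) else 0

/-- The boundary derivatives in terms of the values `(ψ(0), ψ'(0))`. -/
def derivMatrix : Matrix (Fin N × Fin 2) (Fin N × Fin 2) entireFunctions := fun p r =>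
  if p.1 = r.1 then (if p.2 = 0 then (if r.2 = 1 then 1 else 0) else -endDeriv α β p.1 r.2) else 0

/-- The matrix of the coupling conditions. -/
def secularMatrix : Matrix (Fin N × Fin 2) (Fin N × Fin 2) entireFunctions :=
  (U - 1).map (algebraMap ℂ entireFunctions) * valueMatrix α β
    + (Complex.I • (U + 1)).map (algebraMap ℂ entireFunctions) * derivMatrix α β

/-- The secular function. -/
def secularDet : ℂ → ℂ := (secularMatrix U α β).det.1

/-- The components on one edge of a vector of power series. -/
def edgePart (e : Fin N) : ((Fin N × Fin 2) → PowerSeries ℂ) →ₗ[PowerSeries ℂ]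
    (Fin 2 → PowerSeries ℂ) := LinearMap.funLeft _ _ fun s => (e, s)

theorem edgePart_apply (e : Fin N) (c : (Fin N × Fin 2) → PowerSeries ℂ) (s : Fin 2) :
    edgePart e c s = c (e, s) := rfl

/-- Boundary values of the coefficients of the formal solution. -/
def formalValue (z₀ : ℂ) (k : ℕ) (c : (Fin N × Fin 2) → PowerSeries ℂ) (e : Fin N) : Fin 2 → ℂ :=
  ![PowerSeries.coeff k (c (e, 0)), formalSol (α e) (β e) z₀ k (edgePart e c) edgeOne]

/-- Boundary derivatives of the coefficients of the formal solution. -/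
def formalDeriv (z₀ : ℂ) (k : ℕ) (c : (Fin N × Fin 2) → PowerSeries ℂ) (e : Fin N) : Fin 2 → ℂ :=
  ![PowerSeries.coeff k (c (e, 1)), -formalSolDeriv (α e) (β e) z₀ k (edgePart e c) edgeOne]

theorem taylorHom_algebraMap (z₀ r : ℂ) :
    taylorHom z₀ (algebraMap ℂ entireFunctions r) = PowerSeries.C r := by
  ext k
  rw [coeff_taylorHom, PowerSeries.coeff_C]
  exact taylorCoeff_const r z₀ k

theorem coeff_valueMatrix_mulVec (z₀ : ℂ) (k : ℕ) (c : (Fin N × Fin 2) → PowerSeries ℂ)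
    (p : Fin N × Fin 2) :
    PowerSeries.coeff k (((valueMatrix α β).map (taylorHom z₀)).mulVec c p)
      = formalValue α β z₀ k c p.1 p.2 := by
  obtain ⟨e, s⟩ := p
  rw [Matrix.mulVec, dotProduct, Fintype.sum_prod_type, Finset.sum_eq_single e]
  · fin_cases s
    · simp [valueMatrix, formalValue]
    · simp only [Matrix.map_apply, valueMatrix, formalValue]
      simp only [if_true, Fin.mk_one, one_ne_zero, if_false, map_sum, Matrix.cons_val_one,
        Matrix.cons_val_fin_one, formalSol_apply]
      rw [← evalOne_apply, map_sum]
      refine Finset.sum_congr rfl fun s _ => ?_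
      rw [← seriesSMul_taylorCoeff, ← seriesSMul_clm, edgePart_apply]
      congr 2
      ext1 k
      exact taylorCoeff_clm _ (differentiable_fundSol (α e) (β e) s) z₀ k
  · intro e' _ he'
    simp [valueMatrix, he'.symm]
  · simp

theorem coeff_derivMatrix_mulVec (z₀ : ℂ) (k : ℕ) (c : (Fin N × Fin 2) → PowerSeries ℂ)
    (p : Fin N × Fin 2) :
    PowerSeries.coeff k (((derivMatrix α β).map (taylorHom z₀)).mulVec c p)
      = formalDeriv α β z₀ k c p.1 p.2 := by
  obtain ⟨e, s⟩ := p
  rw [Matrix.mulVec, dotProduct, Fintype.sum_prod_type, Finset.sum_eq_single e]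
  · fin_cases s
    · simp [derivMatrix, formalDeriv]
    · simp only [Matrix.map_apply, derivMatrix, formalDeriv]
      simp only [if_true, Fin.mk_one, one_ne_zero, if_false, map_sum, Matrix.cons_val_one,
        Matrix.cons_val_fin_one, formalSolDeriv_apply]
      rw [← evalOne_apply, map_sum, ← Finset.sum_neg_distrib]
      refine Finset.sum_congr rfl fun s _ => ?_
      rw [map_neg, neg_mul, map_neg, ← seriesSMul_taylorCoeff, ← seriesSMul_clm, edgePart_apply]
      congr 3
      ext1 k
      exact taylorCoeff_clm _ (differentiable_fundSolDeriv (α e) (β e) s) z₀ k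
  · intro e' _ he'
    simp [derivMatrix, he'.symm]
  · simp

theorem coeff_map_C_mulVec (A : Matrix (Fin N × Fin 2) (Fin N × Fin 2) ℂ) (k : ℕ)
    (y : (Fin N × Fin 2) → PowerSeries ℂ) (p : Fin N × Fin 2) :
    PowerSeries.coeff k ((A.map (PowerSeries.C (R := ℂ))).mulVec y p)
      = A.mulVec (fun r => PowerSeries.coeff k (y r)) p := by
  simp [Matrix.mulVec, dotProduct]

theorem map_taylorHom_secularMatrix (z₀ : ℂ) :
    (secularMatrix U α β).map (taylorHom z₀) =
      (U - 1).map (PowerSeries.C (R := ℂ)) * (valueMatrix α β).map (taylorHom z₀)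
      + (Complex.I • (U + 1)).map (PowerSeries.C (R := ℂ)) * (derivMatrix α β).map (taylorHom z₀) := by
  have h : ∀ A : Matrix (Fin N × Fin 2) (Fin N × Fin 2) ℂ,
      (A.map (algebraMap ℂ entireFunctions)).map (taylorHom z₀)
        = A.map (PowerSeries.C (R := ℂ)) := by
    intro A
    ext1 i j
    exact taylorHom_algebraMap z₀ (A i j)
  unfold secularMatrix
  rw [Matrix.map_add _ (map_add (taylorHom z₀)), Matrix.map_mul, Matrix.map_mul, h, h]

theorem coeff_secularMatrix_mulVec_eq_zero_iff (z₀ : ℂ) (k : ℕ)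
    (c : (Fin N × Fin 2) → PowerSeries ℂ) :
    (∀ p, PowerSeries.coeff k (((secularMatrix U α β).map (taylorHom z₀)).mulVec c p) = 0) ↔
      Coupled U (formalValue α β z₀ k c) (formalDeriv α β z₀ k c) := by
  unfold Coupled
  rw [funext_iff]
  refine forall_congr' fun p => ?_
  rw [map_taylorHom_secularMatrix, Matrix.add_mulVec, ← Matrix.mulVec_mulVec,
    ← Matrix.mulVec_mulVec, Pi.add_apply, map_add, coeff_map_C_mulVec, coeff_map_C_mulVec]
  simp only [coeff_valueMatrix_mulVec, coeff_derivMatrix_mulVec, Matrix.smul_mulVec]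
  rfl

/-- The secular matrix applied to the series of initial values records the coupling defect of the
formal solution coefficient by coefficient. Divisibility by `X ^ k` therefore expresses the coupling
of the first `k` members of a chain. -/
theorem mem_kerMod_secularMatrix_iff (z₀ : ℂ) (k : ℕ) (c : (Fin N × Fin 2) → PowerSeries ℂ) :
    c ∈ kerMod ((secularMatrix U α β).map (taylorHom z₀)) k ↔
      ∀ j < k, Coupled U (formalValue α β z₀ j c) (formalDeriv α β z₀ j c) := by
  rw [mem_kerMod]
  simp only [PowerSeries.X_pow_dvd_iff]
  constructor
  · intro h j hj
    exact (coeff_secularMatrix_mulVec_eq_zero_iff U α β z₀ j c).1 fun p => h p j hj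
  · intro h p j hj
    exact (coeff_secularMatrix_mulVec_eq_zero_iff U α β z₀ j c).2 (h j hj) p

end Secular

/-! ### Jordan chains as formal solutions; algebraic multiplicity as order of a zero. -/

section RootSpace

variable {N : ℕ} (U : Matrix (Fin N × Fin 2) (Fin N × Fin 2) ℂ) (α β : Fin N → EdgeC)
  {a b : Fin N → ℝ → ℝ}

/-- The state whose first component is the `k`-th coefficient of the formal solution. -/
def formalState (z₀ : ℂ) (k : ℕ) : ((Fin N × Fin 2) → PowerSeries ℂ) →ₗ[ℂ] StateSpace N where
  toFun c := (fun e => toL2 (formalSol (α e) (β e) z₀ k (edgePart e c)),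
    fun e => toL2 (z₀ • formalSol (α e) (β e) z₀ k (edgePart e c)
      + formalSol (α e) (β e) z₀ k ((PowerSeries.X : PowerSeries ℂ) • edgePart e c)))
  map_add' c d := by
    ext1 <;> funext e
    · simp only [map_add, Prod.fst_add, Pi.add_apply]
    · simp only [map_add, Prod.snd_add, Pi.add_apply, smul_add]
      abel
  map_smul' r c := by
    have h : ∀ e : Fin N, edgePart e (r • c) = r • edgePart e c := fun e => rfl
    ext1 <;> funext e
    · simp only [h, map_smul, Prod.smul_fst, Pi.smul_apply, RingHom.id_apply]
    · simp only [h, map_add, map_smul, Prod.smul_snd, Pi.smul_apply, RingHom.id_apply, smul_add,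
        smul_comm (PowerSeries.X : PowerSeries ℂ) r, smul_comm z₀ r]

/-- Multiplication of a vector of power series with the variable. -/
def mulX : ((Fin N × Fin 2) → PowerSeries ℂ) →ₗ[ℂ] ((Fin N × Fin 2) → PowerSeries ℂ) where
  toFun c := (PowerSeries.X : PowerSeries ℂ) • c
  map_add' c d := smul_add _ c d
  map_smul' r c := smul_comm _ r c

theorem formalState_mulX_zero (z₀ : ℂ) (c : (Fin N × Fin 2) → PowerSeries ℂ) :
    formalState α β z₀ 0 (mulX c) = 0 := by
  ext1 <;> funext e
  · change toL2 (formalSol (α e) (β e) z₀ 0 ((PowerSeries.X : PowerSeries ℂ) • edgePart e c)) = 0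
    rw [formalSol_X_smul_zero, map_zero]
  · change toL2 (z₀ • formalSol (α e) (β e) z₀ 0 ((PowerSeries.X : PowerSeries ℂ) • edgePart e c)
      + formalSol (α e) (β e) z₀ 0 ((PowerSeries.X : PowerSeries ℂ) •
        (PowerSeries.X : PowerSeries ℂ) • edgePart e c)) = 0
    rw [formalSol_X_smul_zero, formalSol_X_smul_zero, smul_zero, add_zero, map_zero]

theorem formalState_mulX_succ (z₀ : ℂ) (k : ℕ) (c : (Fin N × Fin 2) → PowerSeries ℂ) :
    formalState α β z₀ (k + 1) (mulX c) = formalState α β z₀ k c := by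
  ext1 <;> funext e
  · change toL2 (formalSol (α e) (β e) z₀ (k + 1) ((PowerSeries.X : PowerSeries ℂ) • edgePart e c)) = _
    rw [formalSol_X_smul_succ]
    rfl
  · change toL2 (z₀ • formalSol (α e) (β e) z₀ (k + 1) ((PowerSeries.X : PowerSeries ℂ) • edgePart e c)
      + formalSol (α e) (β e) z₀ (k + 1) ((PowerSeries.X : PowerSeries ℂ) •
        (PowerSeries.X : PowerSeries ℂ) • edgePart e c)) = _
    rw [formalSol_X_smul_succ, formalSol_X_smul_succ]
    rfl

/-- The right hand side `q u + q' u⁻ + u⁻⁻` of the equation for the coefficients of the formal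
solution. -/
def formalRHS (z₀ : ℂ) (k : ℕ) (e : Fin N) (c : (Fin N × Fin 2) → PowerSeries ℂ) : EdgeC :=
  edgeCoeff (α e) (β e) z₀ * formalSol (α e) (β e) z₀ k (edgePart e c)
    + (edgeCoeffDeriv (α e) z₀ *
        formalSol (α e) (β e) z₀ k ((PowerSeries.X : PowerSeries ℂ) • edgePart e c)
      + formalSol (α e) (β e) z₀ k
        ((PowerSeries.X : PowerSeries ℂ) • (PowerSeries.X : PowerSeries ℂ) • edgePart e c))

theorem isCoupledW22_formalSol {z₀ : ℂ} {k : ℕ} {c : (Fin N × Fin 2) → PowerSeries ℂ}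
    (hc : Coupled U (formalValue α β z₀ k c) (formalDeriv α β z₀ k c)) :
    IsCoupledW22 U (fun e => toL2 (formalSol (α e) (β e) z₀ k (edgePart e c)))
      (fun e => toL2 (formalRHS α β z₀ k e c)) :=
  ⟨formalValue α β z₀ k c, formalDeriv α β z₀ k c, fun e => isW22_of_system
    (formalSol_eq (α e) (β e) z₀ k (edgePart e c))
    (formalSolDeriv_eq (α e) (β e) z₀ k (edgePart e c)) rfl rfl, hc⟩

/-- The identity `h = q u + q' u⁻ + u⁻⁻` for the second derivative. -/
theorem formal_pointwise
    (hα : ∀ e, ∀ x ∈ Set.Icc (0 : ℝ) 1, edgeExt (α e) x = a e x)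
    (hβ : ∀ e, ∀ x ∈ Set.Icc (0 : ℝ) 1, edgeExt (β e) x = b e x)
    (z₀ : ℂ) (e : Fin N) (u v w : EdgeC) {x : ℝ}
    (hx : x ∈ Set.Icc (0 : ℝ) 1) :
    z₀ * (z₀ * edgeExt u x + edgeExt v x) + (z₀ * edgeExt v x + edgeExt w x)
      = edgeExt (edgeCoeff (α e) (β e) z₀ * u + (edgeCoeffDeriv (α e) z₀ * v + w)) x
        + (b e x : ℂ) * edgeExt u x - 2 * (a e x : ℂ) * (z₀ * edgeExt u x + edgeExt v x) := by
  rw [← hα e x hx, ← hβ e x hx]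
  simp only [edgeExt_of_mem _ hx, EdgeC.add_apply, EdgeC.mul_apply, edgeCoeff, edgeCoeffDeriv,
    EdgeC.sub_apply, EdgeC.smul_apply, EdgeC.one_apply]
  ring

/-- `H - z₀` lowers the index of a formal state by one. Both `c` and `mulX c` must be coupled
because the second component of the state mixes the current and the preceding coefficient, and the
domain couples both components. -/
theorem formalState_mem_waveOp
    (hα : ∀ e, ∀ x ∈ Set.Icc (0 : ℝ) 1, edgeExt (α e) x = a e x)
    (hβ : ∀ e, ∀ x ∈ Set.Icc (0 : ℝ) 1, edgeExt (β e) x = b e x)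
    {z₀ : ℂ} {k : ℕ} {c : (Fin N × Fin 2) → PowerSeries ℂ}
    (hc : Coupled U (formalValue α β z₀ k c) (formalDeriv α β z₀ k c))
    (hc' : Coupled U (formalValue α β z₀ k (mulX c)) (formalDeriv α β z₀ k (mulX c))) :
    (formalState α β z₀ k c, z₀ • formalState α β z₀ k c + formalState α β z₀ k (mulX c))
      ∈ waveOp U a b := by
  have h1 := isCoupledW22_formalSol U α β hc
  have h2 := isCoupledW22_formalSol U α β hc'
  refine ⟨_, fun e => z₀ • toL2 (formalRHS α β z₀ k e c) + toL2 (formalRHS α β z₀ k e (mulX c)),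
    h1, ?_, ?_, fun e => ?_⟩
  · have h3 := (h1.smul z₀).add h2
    convert h3 using 1
    · funext e
      change toL2 _ = z₀ • toL2 _ + toL2 _
      rw [map_add, map_smul]
      rfl
    · rfl
  · funext e
    change z₀ • toL2 _ + toL2 _ = toL2 _
    rw [map_add, map_smul]
    rfl
  · set u := formalSol (α e) (β e) z₀ k (edgePart e c)
    set v := formalSol (α e) (β e) z₀ k ((PowerSeries.X : PowerSeries ℂ) • edgePart e c)
    set w := formalSol (α e) (β e) z₀ k
      ((PowerSeries.X : PowerSeries ℂ) • (PowerSeries.X : PowerSeries ℂ) • edgePart e c)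
    change (z₀ • toL2 (z₀ • u + v) + toL2 (z₀ • v + w) : EdgeL2) =ᵐ[unitVol] fun x =>
      toL2 (edgeCoeff (α e) (β e) z₀ * u + (edgeCoeffDeriv (α e) z₀ * v + w)) x
        + (b e x : ℂ) * toL2 u x - 2 * (a e x : ℂ) * toL2 (z₀ • u + v) x
    rw [← map_smul, ← map_add]
    filter_upwards [coeFn_toL2 (z₀ • (z₀ • u + v) + (z₀ • v + w)), coeFn_toL2 u,
      coeFn_toL2 (z₀ • u + v), coeFn_toL2
        (edgeCoeff (α e) (β e) z₀ * u + (edgeCoeffDeriv (α e) z₀ * v + w)),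
      ae_restrict_mem measurableSet_Icc] with x h1 h2 h3 h4 hx
    rw [h1, h2, h3, h4]
    simp only [edgeExt_add _ _ x, edgeExt_smul _ _ x]
    have := formal_pointwise α β hα hβ z₀ e u v w hx
    simpa only [edgeExt_add _ _ x] using this

/-- Every extension of a Jordan chain is again formal. Only the `k`-th coefficients of the initial
values are new; the preceding members fix the rest, and unique solvability on each edge identifies
the solution. -/
theorem exists_formalState_of_mem_waveOp
    (hα : ∀ e, ∀ x ∈ Set.Icc (0 : ℝ) 1, edgeExt (α e) x = a e x)
    (hβ : ∀ e, ∀ x ∈ Set.Icc (0 : ℝ) 1, edgeExt (β e) x = b e x)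
    {z₀ : ℂ} {k : ℕ} {ψ : StateSpace N}
    {c : (Fin N × Fin 2) → PowerSeries ℂ}
    (hψ : (ψ, z₀ • ψ + formalState α β z₀ k (mulX c)) ∈ waveOp U a b) :
    ∃ c', (∀ p, ∀ j < k, PowerSeries.coeff j (c' p) = PowerSeries.coeff j (c p)) ∧
      ψ = formalState α β z₀ k c' ∧
      Coupled U (formalValue α β z₀ k c') (formalDeriv α β z₀ k c') := by
  obtain ⟨h, h', ⟨p, q, hpq, hcoup⟩, -, h1, h2⟩ := hψ
  simp only at h1 h2 hpq
  choose u u₁ hu1 hu2 hu3 hu4 hu5 using fun e => system_of_isW22 (hpq e)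
  -- The `k`-th coefficient is overwritten by the actual initial values of `ψ`. The lower ones stay,
  -- so multiples by `X` of the old and new data agree up to order `k`.
  set c' : (Fin N × Fin 2) → PowerSeries ℂ := fun r =>
    c r + PowerSeries.monomial k
      ((if r.2 = 0 then p r.1 0 else q r.1 0) - PowerSeries.coeff k (c r)) with hc'
  have hlt : ∀ r, ∀ j < k, PowerSeries.coeff j (c' r) = PowerSeries.coeff j (c r) := by
    intro r j hj
    simp [hc', PowerSeries.coeff_monomial, hj.ne]
  have hk0 : ∀ e, PowerSeries.coeff k (c' (e, 0)) = p e 0 := by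
    intro e; simp [hc']
  have hk1 : ∀ e, PowerSeries.coeff k (c' (e, 1)) = q e 0 := by
    intro e; simp [hc']
  have hX : ∀ e s, ∀ j ≤ k, PowerSeries.coeff j
      (((PowerSeries.X : PowerSeries ℂ) • edgePart e c) s)
      = PowerSeries.coeff j (((PowerSeries.X : PowerSeries ℂ) • edgePart e c') s) := by
    intro e s j hj
    cases j with
    | zero => simp
    | succ j =>
      simp only [Pi.smul_apply, smul_eq_mul, PowerSeries.coeff_succ_X_mul, edgePart_apply]
      exact (hlt (e, s) j hj).symm
  have hXX : ∀ e s, ∀ j ≤ k, PowerSeries.coeff j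
      (((PowerSeries.X : PowerSeries ℂ) • (PowerSeries.X : PowerSeries ℂ) • edgePart e c) s)
      = PowerSeries.coeff j
        (((PowerSeries.X : PowerSeries ℂ) • (PowerSeries.X : PowerSeries ℂ) • edgePart e c') s) := by
    intro e s j hj
    cases j with
    | zero => simp
    | succ j =>
      simp only [Pi.smul_apply _ (_ • _), smul_eq_mul, PowerSeries.coeff_succ_X_mul]
      exact hX e s j (by omega)
  have e1 : ∀ e, formalSol (α e) (β e) z₀ k (edgePart e (mulX c)) = formalSol (α e) (β e) z₀ k
      ((PowerSeries.X : PowerSeries ℂ) • edgePart e c') :=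
    fun e => formalSol_congr_coeff _ _ _ (hX e)
  have e2 : ∀ e, formalSol (α e) (β e) z₀ k
      ((PowerSeries.X : PowerSeries ℂ) • edgePart e (mulX c)) = formalSol (α e) (β e) z₀ k
      ((PowerSeries.X : PowerSeries ℂ) • (PowerSeries.X : PowerSeries ℂ) • edgePart e c') :=
    fun e => formalSol_congr_coeff _ _ _ (hXX e)
  set v : Fin N → EdgeC := fun e => formalSol (α e) (β e) z₀ k
      ((PowerSeries.X : PowerSeries ℂ) • edgePart e c') with hv
  set w : Fin N → EdgeC := fun e => formalSol (α e) (β e) z₀ k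
      ((PowerSeries.X : PowerSeries ℂ) • (PowerSeries.X : PowerSeries ℂ) • edgePart e c') with hw
  have hψ2 : ∀ e, ψ.2 e = toL2 (z₀ • u e + v e) := by
    intro e
    have := congrFun h1 e
    rw [← this]
    change z₀ • ψ.1 e + toL2 (formalSol (α e) (β e) z₀ k (edgePart e (mulX c))) = _
    rw [e1, hu1, map_add, map_smul toL2]
  have hh : ∀ e, h e = toL2 (edgeCoeff (α e) (β e) z₀ * u e
      + (edgeCoeffDeriv (α e) z₀ * v e + w e)) := by
    intro e
    apply toL2_eq_of_ae
    have h3 := h2 e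
    have h4 : (z₀ • ψ + formalState α β z₀ k (mulX c)).2 e
        = toL2 (z₀ • (z₀ • u e + v e) + (z₀ • v e + w e)) := by
      change z₀ • ψ.2 e + toL2 (z₀ • formalSol (α e) (β e) z₀ k (edgePart e (mulX c))
        + formalSol (α e) (β e) z₀ k ((PowerSeries.X : PowerSeries ℂ) • edgePart e (mulX c))) = _
      rw [e1, e2, hψ2, ← map_smul, ← map_add]
    rw [h4, hψ2, hu1] at h3
    filter_upwards [h3, coeFn_toL2 (z₀ • (z₀ • u e + v e) + (z₀ • v e + w e)), coeFn_toL2 (u e),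
      coeFn_toL2 (z₀ • u e + v e), ae_restrict_mem measurableSet_Icc] with x g1 g2 g3 g4 hx
    rw [g2, g3, g4] at g1
    have := formal_pointwise α β hα hβ z₀ e (u e) (v e) (w e) hx
    simp only [edgeExt_add _ _ x, edgeExt_smul _ _ x] at g1 this ⊢
    rw [this] at g1
    linear_combination -g1
  have huniq : ∀ e, u e = formalSol (α e) (β e) z₀ k (edgePart e c') ∧
      u₁ e = formalSolDeriv (α e) (β e) z₀ k (edgePart e c') := by
    intro e
    refine edge_system_unique (hu2 e) (hu5 e _ (hh e)) ?_ ?_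
    · rw [← hk0]
      exact formalSol_eq (α e) (β e) z₀ k (edgePart e c')
    · rw [← hk1]
      exact formalSolDeriv_eq (α e) (β e) z₀ k (edgePart e c')
  refine ⟨c', hlt, ?_, ?_⟩
  · ext1 <;> funext e
    · change ψ.1 e = toL2 (formalSol (α e) (β e) z₀ k (edgePart e c'))
      rw [hu1, (huniq e).1]
    · change ψ.2 e = toL2 (z₀ • formalSol (α e) (β e) z₀ k (edgePart e c') + v e)
      rw [hψ2, (huniq e).1]
  · convert hcoup using 1
    · funext e s
      fin_cases s
      · simp [formalValue, hk0]
      · simp [formalValue, ← (huniq e).1, hu3]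
    · funext e s
      fin_cases s
      · simp [formalDeriv, hk1]
      · simp [formalDeriv, ← (huniq e).2, hu4]

theorem formalValue_congr (z₀ : ℂ) {k : ℕ} {c d : (Fin N × Fin 2) → PowerSeries ℂ}
    (h : ∀ p, ∀ j ≤ k, PowerSeries.coeff j (c p) = PowerSeries.coeff j (d p)) :
    formalValue α β z₀ k c = formalValue α β z₀ k d := by
  funext e
  unfold formalValue
  rw [h _ k le_rfl, formalSol_congr_coeff (α e) (β e) z₀ (c := edgePart e c) (d := edgePart e d)
    fun s => h (e, s)]

theorem formalDeriv_congr (z₀ : ℂ) {k : ℕ} {c d : (Fin N × Fin 2) → PowerSeries ℂ}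
    (h : ∀ p, ∀ j ≤ k, PowerSeries.coeff j (c p) = PowerSeries.coeff j (d p)) :
    formalDeriv α β z₀ k c = formalDeriv α β z₀ k d := by
  funext e
  unfold formalDeriv
  rw [h _ k le_rfl, formalSolDeriv_apply, formalSolDeriv_apply]
  have : ∀ s, seriesSMul (taylorCoeff (fundSolDeriv (α e) (β e) s) z₀) k (edgePart e c s)
      = seriesSMul (taylorCoeff (fundSolDeriv (α e) (β e) s) z₀) k (edgePart e d s) :=
    fun s => seriesSMul_congr_coeff _ (h (e, s))
  simp only [this]

theorem mulX_mem_kerMod {M : Matrix (Fin N × Fin 2) (Fin N × Fin 2) (PowerSeries ℂ)} {k : ℕ}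
    {c : (Fin N × Fin 2) → PowerSeries ℂ} (hc : c ∈ kerMod M k) : mulX c ∈ kerMod M (k + 1) := by
  rw [mem_kerMod] at hc ⊢
  intro i
  change _ ∣ M.mulVec ((PowerSeries.X : PowerSeries ℂ) • c) i
  rw [Matrix.mulVec_smul, Pi.smul_apply, smul_eq_mul, pow_succ']
  exact mul_dvd_mul_left _ (hc i)

theorem kerMod_anti {M : Matrix (Fin N × Fin 2) (Fin N × Fin 2) (PowerSeries ℂ)} {k : ℕ}
    {c : (Fin N × Fin 2) → PowerSeries ℂ} (hc : c ∈ kerMod M (k + 1)) : c ∈ kerMod M k :=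
  fun i => (pow_dvd_pow _ (Nat.le_succ k)).trans (hc i)

/-- For `k ≥ 1` the map `formalState k ∘ mulX` is the formal state of index `k - 1`, and for `k = 0`
it is zero. This form covers the trivial kernel without a case distinction, and the induction
extends or shortens a chain by one member. -/
theorem genKer_eq_map
    (hα : ∀ e, ∀ x ∈ Set.Icc (0 : ℝ) 1, edgeExt (α e) x = a e x)
    (hβ : ∀ e, ∀ x ∈ Set.Icc (0 : ℝ) 1, edgeExt (β e) x = b e x)
    (z₀ : ℂ) (k : ℕ) :
    genKer (waveOp U a b) z₀ k = (kerMod ((secularMatrix U α β).map (taylorHom z₀)) k).map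
      (formalState α β z₀ k ∘ₗ mulX) := by
  induction k with
  | zero =>
    rw [genKer, eq_comm, eq_bot_iff]
    rintro _ ⟨c, -, rfl⟩
    exact formalState_mulX_zero α β z₀ c
  | succ k ih =>
    ext ψ
    rw [genKer, Submodule.mem_map, Submodule.mem_map]
    constructor
    · rintro ⟨⟨ψ, w⟩, ⟨hw, hw2⟩, rfl⟩
      change w - z₀ • ψ ∈ genKer (waveOp U a b) z₀ k at hw2
      rw [ih] at hw2
      obtain ⟨c, hc, hcw⟩ := hw2
      have hwψ : w = z₀ • ψ + formalState α β z₀ k (mulX c) := by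
        rw [← sub_eq_iff_eq_add', ← hcw]; rfl
      have hw' : (ψ, w) ∈ waveOp U a b := hw
      rw [hwψ] at hw'
      obtain ⟨c', h1, h2, h3⟩ := exists_formalState_of_mem_waveOp U α β hα hβ hw'
      refine ⟨c', ?_, ?_⟩
      · have hc2 := (mem_kerMod_secularMatrix_iff U α β z₀ k c).1 hc
        refine (mem_kerMod_secularMatrix_iff U α β z₀ (k + 1) c').2 fun j hj => ?_
        rcases Nat.lt_succ_iff_lt_or_eq.1 hj with hj | rfl
        · rw [formalValue_congr α β z₀ (d := c) fun p i hi => h1 p i (hi.trans_lt hj),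
            formalDeriv_congr α β z₀ (d := c) fun p i hi => h1 p i (hi.trans_lt hj)]
          exact hc2 j hj
        · exact h3
      · change formalState α β z₀ (k + 1) (mulX c') = ψ
        rw [formalState_mulX_succ, h2]
    · rintro ⟨c, hc, rfl⟩
      change ∃ y, _ ∧ _ = formalState α β z₀ (k + 1) (mulX c)
      rw [formalState_mulX_succ]
      refine ⟨(formalState α β z₀ k c, z₀ • formalState α β z₀ k c
        + formalState α β z₀ k (mulX c)), ⟨?_, ?_⟩, rfl⟩
      · have hc1 := (mem_kerMod_secularMatrix_iff U α β z₀ (k + 1) c).1 hc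
        have hc2 := (mem_kerMod_secularMatrix_iff U α β z₀ (k + 1) (mulX c)).1
          (mulX_mem_kerMod (kerMod_anti hc))
        exact formalState_mem_waveOp U α β hα hβ (hc1 k (Nat.lt_succ_self k))
          (hc2 k (Nat.lt_succ_self k))
      · change (z₀ • formalState α β z₀ k c + formalState α β z₀ k (mulX c))
          - z₀ • formalState α β z₀ k c ∈ genKer (waveOp U a b) z₀ k
        rw [add_sub_cancel_left, ih]
        exact ⟨c, kerMod_anti hc, rfl⟩

theorem eq_zero_of_zero_eq_smul_one_add {c : ℂ} {f : EdgeC} (h : 0 = c • 1 + edgeInt f) :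
    c = 0 := by
  have h1 := congrArg (fun f : EdgeC => f edgeZero) h
  simp only [EdgeC.add_apply, EdgeC.smul_apply, EdgeC.one_apply, EdgeC.zero_apply,
    edgeInt_edgeZero, mul_one, add_zero] at h1
  exact h1.symm

/-- Vanishing of two consecutive coefficients propagates downwards: a zero coefficient has zero
initial values, and its equation then forces the source term two places below to vanish. Two
consecutive ones are exactly what a vanishing state provides. -/
theorem coeff_eq_zero_of_formalSol_eq_zero (α β : EdgeC) (z₀ : ℂ) (k : ℕ) :
    ∀ c : Fin 2 → PowerSeries ℂ, formalSol α β z₀ k c = 0 →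
      formalSol α β z₀ k ((PowerSeries.X : PowerSeries ℂ) • c) = 0 →
      ∀ s, ∀ j ≤ k, PowerSeries.coeff j (c s) = 0 := by
  induction k with
  | zero =>
    intro c h0 h1 s j hj
    obtain rfl : j = 0 := by omega
    have e0 := formalSol_eq α β z₀ 0 c
    have e1 := formalSolDeriv_eq α β z₀ 0 c
    rw [h0] at e0
    have g0 : PowerSeries.coeff 0 (c 0) = 0 := eq_zero_of_zero_eq_smul_one_add e0
    rw [g0, zero_smul, zero_add] at e0
    rw [edgeInt_injective e0.symm] at e1
    have g1 : PowerSeries.coeff 0 (c 1) = 0 := eq_zero_of_zero_eq_smul_one_add e1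
    fin_cases s
    · exact g0
    · exact g1
  | succ k ih =>
    intro c h0 h1 s j hj
    have e0 := formalSol_eq α β z₀ (k + 1) c
    have e1 := formalSolDeriv_eq α β z₀ (k + 1) c
    rw [h0] at e0
    have g0 : PowerSeries.coeff (k + 1) (c 0) = 0 := eq_zero_of_zero_eq_smul_one_add e0
    rw [g0, zero_smul, zero_add] at e0
    rw [edgeInt_injective e0.symm] at e1
    have g1 : PowerSeries.coeff (k + 1) (c 1) = 0 := eq_zero_of_zero_eq_smul_one_add e1
    rw [g1, zero_smul, zero_add, h0, h1, mul_zero, mul_zero, zero_add, zero_add] at e1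
    have h2 := edgeInt_injective e1.symm
    rw [formalSol_X_smul_succ] at h1 h2
    rcases Nat.le_succ_iff.1 hj with hj | rfl
    · exact ih c h1 h2 s j hj
    · fin_cases s
      · exact g0
      · exact g1

theorem formalState_eq_zero_iff (z₀ : ℂ) (k : ℕ) (c : (Fin N × Fin 2) → PowerSeries ℂ) :
    formalState α β z₀ k c = 0 ↔ c ∈ powerMultiples ℂ (Fin N × Fin 2) (k + 1) := by
  rw [mem_powerMultiples]
  simp only [PowerSeries.X_pow_dvd_iff, Nat.lt_succ_iff]
  constructor
  · rintro h ⟨e, s⟩ j hj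
    have h1 : formalSol (α e) (β e) z₀ k (edgePart e c) = 0 := by
      apply toL2_injective
      rw [map_zero]
      exact congrFun (congrArg Prod.fst h) e
    have h2 : formalSol (α e) (β e) z₀ k ((PowerSeries.X : PowerSeries ℂ) • edgePart e c) = 0 := by
      apply toL2_injective
      rw [map_zero]
      have h3 : toL2 (z₀ • formalSol (α e) (β e) z₀ k (edgePart e c) + formalSol (α e) (β e) z₀ k
        ((PowerSeries.X : PowerSeries ℂ) • edgePart e c)) = 0 := congrFun (congrArg Prod.snd h) e
      rwa [h1, smul_zero, zero_add] at h3
    exact coeff_eq_zero_of_formalSol_eq_zero (α e) (β e) z₀ k _ h1 h2 s j hj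
  · intro h
    have h1 : ∀ e, formalSol (α e) (β e) z₀ k (edgePart e c) = 0 := fun e => by
      rw [formalSol_congr_coeff (α e) (β e) z₀ (d := 0) fun s j hj => by
        simpa [edgePart_apply] using h (e, s) j hj, map_zero]
    have h2 : ∀ e, formalSol (α e) (β e) z₀ k ((PowerSeries.X : PowerSeries ℂ) • edgePart e c) = 0 :=
      fun e => by
        rw [formalSol_congr_coeff (α e) (β e) z₀ (d := 0) fun s j hj => ?_, map_zero]
        cases j with
        | zero => simp
        | succ j =>
          rw [Pi.smul_apply, smul_eq_mul, PowerSeries.coeff_succ_X_mul]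
          simpa [edgePart_apply] using h (e, s) j (by omega)
    ext1 <;> funext e
    · change toL2 (formalSol (α e) (β e) z₀ k (edgePart e c)) = 0
      rw [h1, map_zero]
    · change toL2 (z₀ • formalSol (α e) (β e) z₀ k (edgePart e c) + formalSol (α e) (β e) z₀ k
        ((PowerSeries.X : PowerSeries ℂ) • edgePart e c)) = 0
      rw [h1, h2, smul_zero, add_zero, map_zero]

theorem genKer_mono (H : Submodule ℂ (StateSpace N × StateSpace N)) (z : ℂ) :
    Monotone (genKer H z) := by
  refine monotone_nat_of_le_succ fun k => ?_
  induction k with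
  | zero => exact bot_le
  | succ k ih =>
    exact Submodule.map_mono (inf_le_inf_left _ (Submodule.comap_mono ih))

theorem isEigenvalue_iff_rootSpace_ne_bot (H : Submodule ℂ (StateSpace N × StateSpace N)) (z : ℂ) :
    IsEigenvalue H z ↔ rootSpace H z ≠ ⊥ := by
  have h1 : ∀ ψ, ψ ∈ genKer H z 1 ↔ (ψ, z • ψ) ∈ H := by
    intro ψ
    rw [genKer, Submodule.mem_map]
    constructor
    · rintro ⟨⟨ψ, w⟩, ⟨hw, hw2⟩, rfl⟩
      change w - z • ψ ∈ (⊥ : Submodule ℂ (StateSpace N)) at hw2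
      rw [Submodule.mem_bot, sub_eq_zero] at hw2
      change (ψ, z • ψ) ∈ H
      rw [← hw2]
      exact hw
    · intro h
      refine ⟨(ψ, z • ψ), ⟨h, ?_⟩, rfl⟩
      change z • ψ - z • ψ ∈ (⊥ : Submodule ℂ (StateSpace N))
      simp
  have h2 : IsEigenvalue H z ↔ genKer H z 1 ≠ ⊥ := by
    rw [Submodule.ne_bot_iff]
    simp only [h1, IsEigenvalue]
    exact exists_congr fun ψ => and_comm
  rw [h2, not_iff_not]
  constructor
  · intro h
    have h3 : ∀ k, genKer H z k = ⊥ := by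
      intro k
      induction k with
      | zero => rfl
      | succ k ih =>
        have : genKer H z (k + 1) = genKer H z 1 := by
          rw [genKer, ih]
          rfl
        rw [this, h]
    rw [rootSpace]
    simp [h3]
  · intro h
    exact eq_bot_iff.2 (h ▸ le_iSup (genKer H z) 1)

/-- The algebraic multiplicity is the order of the zero of the secular function. -/
theorem algMult_eq_order
    (hα : ∀ e, ∀ x ∈ Set.Icc (0 : ℝ) 1, edgeExt (α e) x = a e x)
    (hβ : ∀ e, ∀ x ∈ Set.Icc (0 : ℝ) 1, edgeExt (β e) x = b e x)
    (hdet : secularDet U α β ≠ 0) (z₀ : ℂ) :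
    FiniteDimensional ℂ (rootSpace (waveOp U a b) z₀) ∧
      algMult (waveOp U a b) z₀ = analyticOrderNatAt (secularDet U α β) z₀ := by
  obtain ⟨u, hu, hfac⟩ := taylorHom_eq_X_pow_mul z₀ (secularMatrix U α β).det hdet
  rw [RingHom.map_det] at hfac
  set ν := analyticOrderNatAt (secularDet U α β) z₀ with hν
  change ((secularMatrix U α β).map (taylorHom z₀)).det = PowerSeries.X ^ ν * u at hfac
  have hgen : ∀ k, ν ≤ k + 1 → Module.finrank ℂ (genKer (waveOp U a b) z₀ (k + 1)) = ν ∧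
      FiniteDimensional ℂ (genKer (waveOp U a b) z₀ (k + 1)) := by
    intro k hk
    have e : formalState α β z₀ (k + 1) ∘ₗ mulX = formalState α β z₀ k :=
      LinearMap.ext fun c => formalState_mulX_succ α β z₀ k c
    rw [genKer_eq_map U α β hα hβ, e]
    exact rank_map_kerMod hu hfac hk _ fun c _ => formalState_eq_zero_iff α β z₀ k c
  -- The kernels form an increasing chain whose dimension is `ν` from exponent `ν + 1` on, so the
  -- chain is constant from there and equals its union.
  have hroot : rootSpace (waveOp U a b) z₀ = genKer (waveOp U a b) z₀ (ν + 1) := by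
    apply le_antisymm
    · refine iSup_le fun k => ?_
      refine (genKer_mono _ z₀ (le_max_left k (ν + 1))).trans ?_
      obtain ⟨m, hm⟩ : ∃ m, max k (ν + 1) = m + 1 := ⟨max k (ν + 1) - 1, by omega⟩
      have h1 := hgen m (by omega)
      have := h1.2
      rw [hm]
      refine (Submodule.eq_of_le_of_finrank_eq (genKer_mono _ z₀ (by omega)) ?_).ge
      rw [h1.1, (hgen ν (by omega)).1]
    · exact le_iSup (genKer (waveOp U a b) z₀) (ν + 1)
  rw [algMult, hroot]
  exact (hgen ν (by omega)).symm

/-- Finite dimensionality is essential here, because `finrank` takes the value 0 on infinite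
dimensional spaces. -/
theorem isEigenvalue_iff_secularDet
    (hα : ∀ e, ∀ x ∈ Set.Icc (0 : ℝ) 1, edgeExt (α e) x = a e x)
    (hβ : ∀ e, ∀ x ∈ Set.Icc (0 : ℝ) 1, edgeExt (β e) x = b e x)
    (hdet : secularDet U α β ≠ 0) (z : ℂ) :
    IsEigenvalue (waveOp U a b) z ↔ algMult (waveOp U a b) z ≠ 0 := by
  have := (algMult_eq_order U α β hα hβ hdet z).1
  rw [isEigenvalue_iff_rootSpace_ne_bot, algMult, Ne, Ne, Submodule.finrank_eq_zero]

end RootSpace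

/-! ### The projection attached to a unitary coupling and the normalisation of the coupling
condition. -/

section Coupling

variable {n : Type*} [Fintype n] [DecidableEq n]

/-- `P` is the orthogonal projection onto the range of `U + 1` and `G` the inverse of `U + 1` on
that range. -/
structure IsCouplingPair (U P G : Matrix n n ℂ) : Prop where
  mul_proj : (U + 1) * P = U + 1
  proj_mul : P * (U + 1) = U + 1
  inv_mul : G * (U + 1) = P
  mul_inv : (U + 1) * G = P
  proj_sq : P * P = P
  proj_inv : P * G = G
  inv_proj : G * P = G
  hermitian : P.conjTranspose = P
  commute : ∀ C : Matrix n n ℂ, C * U = U * C → C * P = P * C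

theorem conjTranspose_add_one {U : Matrix n n ℂ} (hU : U ∈ Matrix.unitaryGroup n ℂ) :
    (U + 1).conjTranspose = U.conjTranspose * (U + 1) := by
  have h : U.conjTranspose * U = 1 := Matrix.mem_unitaryGroup_iff'.1 hU
  rw [Matrix.conjTranspose_add, Matrix.conjTranspose_one, mul_add, h, mul_one, add_comm]

-- Unitarity gives (U+1)ᴴ = Uᴴ(U+1), so the Gram matrix of (U+1)A contains the factor (U+1)(U+1)A
-- and vanishes. In other words, −1 is a semisimple eigenvalue of U.
open ComplexOrder in
theorem add_one_mul_eq_zero_of_sq {U : Matrix n n ℂ} (hU : U ∈ Matrix.unitaryGroup n ℂ)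
    {A : Matrix n n ℂ} (h : (U + 1) * ((U + 1) * A) = 0) : (U + 1) * A = 0 := by
  rw [← Matrix.conjTranspose_mul_self_eq_zero, Matrix.conjTranspose_mul, conjTranspose_add_one hU,
    mul_assoc, mul_assoc, h, mul_zero, mul_zero]

theorem add_one_mul_eq_zero_of_pow {U : Matrix n n ℂ} (hU : U ∈ Matrix.unitaryGroup n ℂ)
    {A : Matrix n n ℂ} (k : ℕ) (h : (U + 1) ^ k * A = 0) : (U + 1) * A = 0 := by
  induction k with
  | zero => rw [pow_zero, one_mul] at h; rw [h, mul_zero]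
  | succ k ih =>
    cases k with
    | zero => simpa using h
    | succ k =>
      apply ih
      rw [pow_succ', pow_succ', mul_assoc, mul_assoc] at h
      have := add_one_mul_eq_zero_of_sq hU h
      rwa [pow_succ', mul_assoc]

/-- A group inverse of V = U + 1 as a polynomial in V: in the characteristic polynomial X^m q with
q(0) ≠ 0, semisimplicity reduces X^m to X, and V q(V) = 0 is solved for V. Being a polynomial, it
commutes with all matrices commuting with U. -/
theorem exists_sq_mul_eq {U : Matrix n n ℂ} (hU : U ∈ Matrix.unitaryGroup n ℂ) :
    ∃ p : Polynomial ℂ, (U + 1) * ((U + 1) * Polynomial.aeval (U + 1) p) = U + 1 := by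
  set V := U + 1 with hV
  have h0 : V.charpoly ≠ 0 := V.charpoly_monic.ne_zero
  obtain ⟨q, hq, hdvd⟩ := Polynomial.exists_eq_pow_rootMultiplicity_mul_and_not_dvd _ h0 0
  have h1 := Matrix.aeval_self_charpoly V
  rw [hq, map_mul, map_pow, map_sub, Polynomial.aeval_X, Polynomial.aeval_C, map_zero,
    sub_zero] at h1
  have h2 : V * Polynomial.aeval V q = 0 := add_one_mul_eq_zero_of_pow hU _ h1
  have hq0 : q.coeff 0 ≠ 0 := by
    intro h
    apply hdvd
    rw [map_zero, sub_zero]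
    exact Polynomial.X_dvd_iff.2 h
  have hdec := q.X_mul_divX_add
  have h3 : Polynomial.aeval V q = V * Polynomial.aeval V q.divX
      + algebraMap ℂ (Matrix n n ℂ) (q.coeff 0) := by
    conv_lhs => rw [← hdec]
    rw [map_add, map_mul, Polynomial.aeval_X, Polynomial.aeval_C]
  refine ⟨Polynomial.C (-(q.coeff 0)⁻¹) * q.divX, ?_⟩
  rw [h3, mul_add, Algebra.algebraMap_eq_smul_one, mul_smul_comm, mul_one] at h2
  rw [map_mul, Polynomial.aeval_C, ← Algebra.smul_def, mul_smul_comm, mul_smul_comm,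
    eq_neg_of_add_eq_zero_left h2, smul_neg, neg_smul, neg_neg, smul_smul, inv_mul_cancel₀ hq0,
    one_smul]

/-- With W the polynomial group inverse of V = U + 1, the choices are P = VW and G = VW². All
algebraic identities follow from V²W = V and commutativity. -/
theorem exists_isCouplingPair {U : Matrix n n ℂ} (hU : U ∈ Matrix.unitaryGroup n ℂ) :
    ∃ P G, IsCouplingPair U P G := by
  obtain ⟨p, hp⟩ := exists_sq_mul_eq hU
  set V := U + 1 with hV
  set W := Polynomial.aeval V p with hW
  have hWV : W * V = V * W := by
    have h := congrArg (Polynomial.aeval V) (mul_comm p Polynomial.X)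
    rwa [map_mul, map_mul, Polynomial.aeval_X] at h
  have hp' : V * (W * V) = V := by rw [hWV, hp]
  have hVWW : V * W * (V * W) = V * W := by
    rw [mul_assoc, ← mul_assoc W, hWV, ← mul_assoc V (V * W), hp]
  have hproj : V * W * V = V := by rw [mul_assoc, hp']
  have hinv : V * W * W * V = V * W := by rw [mul_assoc, hWV, ← mul_assoc, hproj]
  refine ⟨V * W, V * W * W, hp, hproj, hinv, ?_, hVWW, ?_, ?_, ?_, ?_⟩
  · rw [← mul_assoc, hp]
  · rw [← mul_assoc, hVWW]
  · rw [mul_assoc (V * W) W, ← mul_assoc W V W, hWV, ← mul_assoc, hVWW]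
  -- Self-adjointness is the place where unitarity enters: it yields P = PᴴP, and the right side is
  -- visibly hermitian.
  · have h1 : (V * W).conjTranspose * V = V := by
      have : V.conjTranspose * (V * W) = V.conjTranspose := by
        rw [hV, conjTranspose_add_one hU, mul_assoc, ← hV, hp]
      have h2 := congrArg Matrix.conjTranspose this
      rwa [Matrix.conjTranspose_mul, Matrix.conjTranspose_conjTranspose] at h2
    have h2 : (V * W).conjTranspose * (V * W) = V * W := by rw [← mul_assoc, h1]
    conv_rhs => rw [← h2]
    conv_lhs => rw [← h2]
    rw [Matrix.conjTranspose_mul, Matrix.conjTranspose_conjTranspose]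
  · intro C hC
    have h1 : Commute C V := by
      change C * (U + 1) = (U + 1) * C
      rw [mul_add, add_mul, hC, mul_one, one_mul]
    have h2 : Commute C W := by
      rw [hW, Polynomial.aeval_eq_sum_range]
      exact Commute.sum_right _ _ _ fun i _ => (h1.pow_right i).smul_right _
    exact h1.mul_right h2

namespace IsCouplingPair

variable {U P G : Matrix n n ℂ}

theorem comp_eq_zero (h : IsCouplingPair U P G) : (1 - P) * (U + 1) = 0 := by
  rw [sub_mul, one_mul, h.proj_mul, sub_self]

theorem inv_comp (h : IsCouplingPair U P G) : G * (1 - P) = 0 := by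
  rw [mul_sub, mul_one, h.inv_proj, sub_self]

theorem comp_sq (h : IsCouplingPair U P G) : (1 - P) * (1 - P) = 1 - P := by
  rw [mul_sub, mul_one, sub_mul, one_mul, h.proj_sq, sub_self, sub_zero]

/-- The scattering involution of the leading order. -/
theorem reflection_sq (h : IsCouplingPair U P G) : (2 • P - 1) * (2 • P - 1) = 1 := by
  have : (2 • P - 1) * (2 • P - 1) = 4 • (P * P) - 4 • P + 1 := by
    rw [two_smul]; noncomm_ring
  rw [this, h.proj_sq, sub_self, zero_add]

theorem reflection_eq_of_sq_eq_one (h : IsCouplingPair U P G) (hU : U * U = 1) :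
    2 • P - 1 = U := by
  have h1 : (U + 1) * (U + 1) = 2 • (U + 1) := by
    rw [two_smul, mul_add, add_mul, hU]; noncomm_ring
  have h2 : 2 • P = U + 1 := by
    rw [← h.mul_inv, ← smul_mul_assoc, ← h1, mul_assoc, h.mul_inv, h.mul_proj]
  rw [h2, add_sub_cancel_right]

/-- The matrix by which the coupling condition is multiplied from the left. -/
def leftFactor (P G : Matrix n n ℂ) (z : ℂ) : Matrix n n ℂ :=
  (Complex.I * z)⁻¹ • G - (2 : ℂ)⁻¹ • (1 - P)

/-- The inverse is explicit: `G` inverts `U + 1` on the range of `P`, and `1 - P` acts on the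
complement. -/
theorem det_leftFactor_ne_zero (h : IsCouplingPair U P G) {z : ℂ} (hz : z ≠ 0) :
    (leftFactor P G z).det ≠ 0 := by
  have hz' : Complex.I * z ≠ 0 := mul_ne_zero Complex.I_ne_zero hz
  have h1 : leftFactor P G z * ((Complex.I * z) • (U + 1) - (2 : ℂ) • (1 - P)) = 1 := by
    rw [leftFactor, sub_mul, mul_sub, mul_sub]
    simp only [smul_mul_smul_comm, h.inv_mul, h.inv_comp, h.comp_eq_zero, h.comp_sq,
      inv_mul_cancel₀ hz', one_smul, smul_zero, sub_zero, zero_sub]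
    rw [inv_mul_cancel₀ (two_ne_zero), one_smul]
    abel
  intro h2
  have h3 := congrArg Matrix.det h1
  rw [Matrix.det_mul, h2, zero_mul, Matrix.det_one] at h3
  exact zero_ne_one h3

theorem leftFactor_mul (h : IsCouplingPair U P G) (z : ℂ) :
    leftFactor P G z * (U + 1) = (Complex.I * z)⁻¹ • P := by
  rw [leftFactor, sub_mul, smul_mul_assoc, smul_mul_assoc, h.inv_mul, h.comp_eq_zero, smul_zero,
    sub_zero]

/-- Writing boundary values as out + in and inward derivatives as z(out − in), the coupling
condition applies (U − 1) + iz(U + 1) to the outgoing amplitudes. The left factor turns this into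
the identity up to O(1/z), and the matching matrix on the incoming side into the reflection 2P − 1.
-/
theorem leftFactor_mul_in (h : IsCouplingPair U P G) {z : ℂ} (hz : z ≠ 0) :
    leftFactor P G z * ((U - 1) + (Complex.I * z) • (U + 1))
      = 1 + (Complex.I * z)⁻¹ • (P - (2 : ℂ) • G) := by
  have hz' : Complex.I * z ≠ 0 := mul_ne_zero Complex.I_ne_zero hz
  have e : U - 1 = (U + 1) - (2 : ℂ) • 1 := by rw [two_smul]; abel
  rw [mul_add, mul_smul_comm, h.leftFactor_mul, e, mul_sub, h.leftFactor_mul, smul_smul,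
    mul_inv_cancel₀ hz', mul_smul_comm, mul_one, leftFactor, smul_sub, smul_smul, smul_smul,
    mul_inv_cancel₀ (two_ne_zero (α := ℂ)), one_smul ℂ (1 - P), one_smul ℂ P, smul_sub, smul_smul,
    mul_comm (2 : ℂ)]
  abel

theorem leftFactor_mul_out (h : IsCouplingPair U P G) {z : ℂ} (hz : z ≠ 0) :
    leftFactor P G z * (-(U - 1) + (Complex.I * z) • (U + 1))
      = (2 • P - 1) + (-(Complex.I * z)⁻¹) • (P - (2 : ℂ) • G) := by
  have hz' : Complex.I * z ≠ 0 := mul_ne_zero Complex.I_ne_zero hz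
  have e : -(U - 1) + (Complex.I * z) • (U + 1) = 2 • ((Complex.I * z) • (U + 1))
      - ((U - 1) + (Complex.I * z) • (U + 1)) := by
    rw [two_smul]; abel
  rw [e, mul_sub, h.leftFactor_mul_in hz, mul_smul_comm, mul_smul_comm, h.leftFactor_mul,
    smul_smul, mul_inv_cancel₀ hz', one_smul, neg_smul]
  abel

end IsCouplingPair

end Coupling

/-! ### Propagation of the two wave amplitudes along an edge at high frequency. -/

section Amplitudes

/-- The derivative of the corrected amplitude of the wave `ψ + ψ' / z`. -/
theorem hasDerivWithinAt_amplitude {z : ℂ} (hz : z ≠ 0) {a ϑ ψ ψ₁ : ℝ → ℂ} {a' b : ℂ}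
    {S : Set ℝ} {x : ℝ} (hϑ : HasDerivWithinAt ϑ (a x) S x) (ha : HasDerivWithinAt a a' S x)
    (hψ : HasDerivWithinAt ψ (ψ₁ x) S x)
    (hψ₁ : HasDerivWithinAt ψ₁ ((z * z + 2 * z * a x - b) * ψ x) S x) :
    HasDerivWithinAt
      (fun t : ℝ => Complex.exp (-(z * t + ϑ t)) *
        (ψ t + ψ₁ t / z + a t / (2 * z) * (ψ t - ψ₁ t / z)))
      (Complex.exp (-(z * x + ϑ x)) / z *
        ((-(3 / 2) * a x ^ 2 - b + a' / 2 + a x * b / (2 * z)) * ψ x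
          + (a x ^ 2 - a') / 2 * (ψ₁ x / z))) S x := by
  have h1 : HasDerivWithinAt (fun t : ℝ => z * (t : ℂ)) (z * 1) S x :=
    ((hasDerivAt_id x).ofReal_comp.hasDerivWithinAt).const_mul z
  have h2 := ((h1.add hϑ).neg).cexp
  have h3 := (hψ.add (hψ₁.div_const z)).add
    ((ha.div_const (2 * z)).mul (hψ.sub (hψ₁.div_const z)))
  refine HasDerivWithinAt.congr_deriv (h2.mul h3) ?_
  simp only [Pi.add_apply, Pi.neg_apply, Pi.sub_apply]
  field_simp
  ring

/-- Recovers the plain amplitudes from the corrected ones: a coupling of size at most 1/2 can be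
absorbed. -/
theorem norm_le_of_coupled_pair {p r c f g : ℂ} (hc : ‖c‖ ≤ 1 / 2) (hf : p + c * r = f)
    (hg : r + c * p = g) : ‖p‖ + ‖r‖ ≤ 2 * (‖f‖ + ‖g‖) := by
  have h1 : ‖p‖ ≤ ‖f‖ + 1 / 2 * ‖r‖ := by
    have : p = f - c * r := by rw [← hf]; ring
    rw [this]
    refine (norm_sub_le _ _).trans ?_
    rw [norm_mul]
    gcongr
  have h2 : ‖r‖ ≤ ‖g‖ + 1 / 2 * ‖p‖ := by
    have : r = g - c * p := by rw [← hg]; ring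
    rw [this]
    refine (norm_sub_le _ _).trans ?_
    rw [norm_mul]
    gcongr
  linarith

theorem norm_remainder_coeff_le {M : ℝ} (hM : 1 ≤ M) {z a a' b u v : ℂ} (hz : 1 ≤ ‖z‖)
    (ha : ‖a‖ ≤ M) (ha' : ‖a'‖ ≤ M) (hb : ‖b‖ ≤ M) {T : ℝ} (hu : ‖u‖ ≤ T) (hv : ‖v‖ ≤ T) :
    ‖(-(3 / 2) * a ^ 2 - b + a' / 2 + a * b / (2 * z)) * u + (a ^ 2 - a') / 2 * v‖
      ≤ 5 * M ^ 2 * T := by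
  have hM0 : 0 ≤ M := by linarith
  have h1 : ‖-(3 / 2) * a ^ 2 - b + a' / 2 + a * b / (2 * z)‖ ≤ 4 * M ^ 2 := by
    have e1 : ‖-(3 / 2) * a ^ 2‖ ≤ 3 / 2 * M ^ 2 := by
      rw [norm_mul, norm_pow, norm_neg]
      norm_num
      gcongr
    have e2 : ‖a' / 2‖ ≤ M / 2 := by
      rw [norm_div]
      norm_num
      gcongr
    have e3 : ‖a * b / (2 * z)‖ ≤ M * M / 2 := by
      rw [norm_div, norm_mul, norm_mul]
      norm_num
      gcongr
      linarith
    have e4 := norm_add_le (-(3 / 2) * a ^ 2 - b + a' / 2) (a * b / (2 * z))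
    have e5 := norm_add_le (-(3 / 2) * a ^ 2 - b) (a' / 2)
    have e6 := norm_sub_le (-(3 / 2) * a ^ 2) b
    nlinarith
  have h2 : ‖(a ^ 2 - a') / 2‖ ≤ M ^ 2 := by
    have e1 := norm_sub_le (a ^ 2) a'
    rw [norm_pow] at e1
    have e2 : ‖a‖ ^ 2 ≤ M ^ 2 := by gcongr
    rw [norm_div]
    norm_num
    nlinarith
  refine (norm_add_le _ _).trans ?_
  rw [norm_mul, norm_mul]
  have hT : 0 ≤ T := (norm_nonneg u).trans hu
  calc _ ≤ 4 * M ^ 2 * T + M ^ 2 * T := by gcongr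
    _ = 5 * M ^ 2 * T := by ring

theorem norm_exp_le_exp_norm_re {w : ℂ} {T : ℝ} (h : |w.re| ≤ T) :
    ‖Complex.exp w‖ ≤ Real.exp T := by
  rw [Complex.norm_exp]
  exact Real.exp_le_exp.2 ((le_abs_self _).trans h)

/-- Propagation of the two wave amplitudes along an edge, up to an error of order `1 / z` which is
uniform in a vertical strip. -/
theorem exists_amplitude_bound (K M : ℝ) (hM : 1 ≤ M) :
    ∃ C : ℝ, ∀ (z : ℂ) (a a' b ϑ ψ ψ₁ : ℝ → ℂ), |z.re| ≤ K → M ≤ ‖z‖ →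
      (∀ x ∈ Set.Icc (0 : ℝ) 1, HasDerivWithinAt ϑ (a x) (Set.Icc 0 1) x) → ϑ 0 = 0 →
      (∀ x ∈ Set.Icc (0 : ℝ) 1, ‖ϑ x‖ ≤ M) →
      (∀ x ∈ Set.Icc (0 : ℝ) 1, HasDerivWithinAt a (a' x) (Set.Icc 0 1) x) →
      (∀ x ∈ Set.Icc (0 : ℝ) 1, ‖a x‖ ≤ M) → (∀ x ∈ Set.Icc (0 : ℝ) 1, ‖a' x‖ ≤ M) →
      (∀ x ∈ Set.Icc (0 : ℝ) 1, ‖b x‖ ≤ M) →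
      (∀ x ∈ Set.Icc (0 : ℝ) 1, HasDerivWithinAt ψ (ψ₁ x) (Set.Icc 0 1) x) →
      (∀ x ∈ Set.Icc (0 : ℝ) 1,
        HasDerivWithinAt ψ₁ ((z * z + 2 * z * a x - b x) * ψ x) (Set.Icc 0 1) x) →
      ‖ψ 0 + ψ₁ 0 / z‖ ≤ 2 → ‖ψ 0 - ψ₁ 0 / z‖ ≤ 2 →
      ‖ψ 1 + ψ₁ 1 / z - Complex.exp (z + ϑ 1) * (ψ 0 + ψ₁ 0 / z)‖ ≤ C / ‖z‖ ∧
      ‖ψ 1 - ψ₁ 1 / z - Complex.exp (-(z + ϑ 1)) * (ψ 0 - ψ₁ 0 / z)‖ ≤ C / ‖z‖ := by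
  set C₀ := Real.exp (K + M) with hC₀
  -- The product of `C₀` for the exponential prefactor, `5 * M ^ 2` for the remainder coefficients,
  -- and `2 * C₀` for bounding ψ and ψ'/z by the corrected amplitudes.
  set ε := 10 * C₀ ^ 2 * M ^ 2 with hε
  -- The three summands bound the drift of the corrected amplitude over the edge, the correction
  -- term at x = 0, and the correction term at x = 1.
  refine ⟨3 * C₀ * ε * Real.exp ε + C₀ * M + 6 * M * C₀ * Real.exp ε, ?_⟩
  intro z a a' b ϑ ψ ψ₁ hzK hzM hϑ hϑ0 hϑM ha haM ha'M hbM hψ hψ₁ hp0 hr0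
  have hM0 : 0 < M := by linarith
  have hz1 : 1 ≤ ‖z‖ := hM.trans hzM
  have hzpos : 0 < ‖z‖ := by linarith
  have hz : z ≠ 0 := norm_pos_iff.1 hzpos
  have hC₀pos : 0 < C₀ := Real.exp_pos _
  have hεpos : 0 < ε := by positivity
  set p : ℝ → ℂ := fun t => ψ t + ψ₁ t / z with hp
  set r : ℝ → ℂ := fun t => ψ t - ψ₁ t / z with hr
  set θ : ℝ → ℂ := fun t => z * t + ϑ t with hθ
  -- Since p' = (z + a)p + a r + O(1/z) and r' ≈ −z r, the plain amplitude p is driven by r at order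
  -- one. Adding a/(2z)·r cancels this term, so that the derivative of the corrected and unwound
  -- amplitude is O(1/z).
  set f : ℝ → ℂ := fun t => Complex.exp (-θ t) * (p t + a t / (2 * z) * r t) with hf
  set g : ℝ → ℂ := fun t => Complex.exp (θ t) * (r t + a t / (2 * z) * p t) with hg
  have hθK : ∀ x ∈ Set.Icc (0 : ℝ) 1, |(θ x).re| ≤ K + M := by
    intro x hx
    have h1 : (θ x).re = z.re * x + (ϑ x).re := by simp [hθ]
    rw [h1]
    refine (abs_add_le _ _).trans (add_le_add ?_ ((Complex.abs_re_le_norm _).trans (hϑM x hx)))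
    rw [abs_mul, abs_of_nonneg hx.1]
    exact (mul_le_of_le_one_right (abs_nonneg _) hx.2).trans hzK
  have hexp : ∀ x ∈ Set.Icc (0 : ℝ) 1, ‖Complex.exp (θ x)‖ ≤ C₀ :=
    fun x hx => norm_exp_le_exp_norm_re (hθK x hx)
  have hexp' : ∀ x ∈ Set.Icc (0 : ℝ) 1, ‖Complex.exp (-θ x)‖ ≤ C₀ := fun x hx =>
    norm_exp_le_exp_norm_re (by rw [Complex.neg_re, abs_neg]; exact hθK x hx)
  have hcoef : ∀ x ∈ Set.Icc (0 : ℝ) 1, ‖a x / (2 * z)‖ ≤ M / (2 * ‖z‖) := by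
    intro x hx
    rw [norm_div, norm_mul]
    norm_num
    gcongr
    exact haM x hx
  have hcoef' : ∀ x ∈ Set.Icc (0 : ℝ) 1, ‖a x / (2 * z)‖ ≤ 1 / 2 := by
    intro x hx
    refine (hcoef x hx).trans ?_
    rw [div_le_div_iff₀ (by positivity) (by positivity)]
    linarith
  have hfe : ∀ x, Complex.exp (θ x) * f x = p x + a x / (2 * z) * r x := by
    intro x
    simp only [hf]
    rw [← mul_assoc, ← Complex.exp_add, add_neg_cancel, Complex.exp_zero, one_mul]
  have hge : ∀ x, Complex.exp (-θ x) * g x = r x + a x / (2 * z) * p x := by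
    intro x
    simp only [hg]
    rw [← mul_assoc, ← Complex.exp_add, neg_add_cancel, Complex.exp_zero, one_mul]
  have hpr : ∀ x ∈ Set.Icc (0 : ℝ) 1, ‖p x‖ + ‖r x‖ ≤ 4 * C₀ * ‖(f x, g x)‖ := by
    intro x hx
    have h1 := norm_le_of_coupled_pair (hcoef' x hx) (hfe x).symm (hge x).symm
    rw [norm_mul _ (f x), norm_mul _ (g x)] at h1
    have h2 : ‖f x‖ ≤ ‖(f x, g x)‖ := norm_fst_le (f x, g x)
    have h3 : ‖g x‖ ≤ ‖(f x, g x)‖ := norm_snd_le (f x, g x)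
    have h4 : ‖Complex.exp (θ x)‖ * ‖f x‖ ≤ C₀ * ‖(f x, g x)‖ :=
      mul_le_mul (hexp x hx) h2 (norm_nonneg _) hC₀pos.le
    have h5 : ‖Complex.exp (-θ x)‖ * ‖g x‖ ≤ C₀ * ‖(f x, g x)‖ :=
      mul_le_mul (hexp' x hx) h3 (norm_nonneg _) hC₀pos.le
    linarith
  have hψle : ∀ x ∈ Set.Icc (0 : ℝ) 1, ‖ψ x‖ ≤ 2 * C₀ * ‖(f x, g x)‖ := by
    intro x hx
    have h1 : ψ x = (p x + r x) / 2 := by simp only [hp, hr]; ring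
    have h2 := norm_add_le (p x) (r x)
    have h3 := hpr x hx
    rw [h1, norm_div, RCLike.norm_ofNat]
    linarith
  have hψ₁le : ∀ x ∈ Set.Icc (0 : ℝ) 1, ‖ψ₁ x / z‖ ≤ 2 * C₀ * ‖(f x, g x)‖ := by
    intro x hx
    have h1 : ψ₁ x / z = (p x - r x) / 2 := by simp only [hp, hr]; ring
    have h2 := norm_sub_le (p x) (r x)
    have h3 := hpr x hx
    rw [h1, norm_div, RCLike.norm_ofNat]
    linarith
  have hfd : ∀ x ∈ Set.Icc (0 : ℝ) 1, ∃ f', HasDerivWithinAt f f' (Set.Icc 0 1) x ∧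
      ‖f'‖ ≤ ε / ‖z‖ * ‖(f x, g x)‖ := by
    intro x hx
    refine ⟨_, hasDerivWithinAt_amplitude hz (hϑ x hx) (ha x hx) (hψ x hx) (hψ₁ x hx), ?_⟩
    rw [norm_mul, norm_div]
    have h1 := norm_remainder_coeff_le hM hz1 (haM x hx) (ha'M x hx) (hbM x hx) (hψle x hx)
      (hψ₁le x hx)
    calc _ ≤ C₀ / ‖z‖ * (5 * M ^ 2 * (2 * C₀ * ‖(f x, g x)‖)) := by
          gcongr
          exact hexp' x hx
      _ = ε / ‖z‖ * ‖(f x, g x)‖ := by rw [hε]; ring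
  have hgd : ∀ x ∈ Set.Icc (0 : ℝ) 1, ∃ g', HasDerivWithinAt g g' (Set.Icc 0 1) x ∧
      ‖g'‖ ≤ ε / ‖z‖ * ‖(f x, g x)‖ := by
    intro x hx
    -- The equation is invariant under changing the signs of z and a together, which exchanges the
    -- two waves; the second amplitude needs no separate computation.
    have h0 := hasDerivWithinAt_amplitude (neg_ne_zero.2 hz) (hϑ x hx).fun_neg (ha x hx).fun_neg (hψ x hx)
      (b := b x) (ψ₁ := ψ₁) (by convert hψ₁ x hx using 1; ring)
    have heq : ∀ t, g t = Complex.exp (-(-z * (t : ℂ) + -ϑ t)) *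
        (ψ t + ψ₁ t / -z + -a t / (2 * -z) * (ψ t - ψ₁ t / -z)) := by
      intro t
      simp only [hg, hθ, hp, hr]
      congr 1
      · congr 1; ring
      · field_simp; ring
    refine ⟨_, h0.congr (fun t _ => heq t) (heq x), ?_⟩
    · rw [norm_mul, norm_div, norm_neg]
      have h1 := norm_remainder_coeff_le (z := -z) (a := -a x) (a' := -a' x) (b := b x)
        (u := ψ x) (v := ψ₁ x / -z) hM (by rwa [norm_neg])
        (by rw [norm_neg]; exact haM x hx) (by rw [norm_neg]; exact ha'M x hx) (hbM x hx)
        (hψle x hx) (by rw [div_neg, norm_neg]; exact hψ₁le x hx)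
      have h2 : -(-z * (x : ℂ) + -ϑ x) = θ x := by simp only [hθ]; ring
      rw [h2]
      calc _ ≤ C₀ / ‖z‖ * (5 * M ^ 2 * (2 * C₀ * ‖(f x, g x)‖)) := by
            gcongr
            exact hexp x hx
        _ = ε / ‖z‖ * ‖(f x, g x)‖ := by rw [hε]; ring
  choose! f' hf' hf'le using hfd
  choose! g' hg' hg'le using hgd
  have hFd : ∀ x ∈ Set.Icc (0 : ℝ) 1, HasDerivWithinAt (fun t => (f t, g t)) (f' x, g' x)
      (Set.Icc 0 1) x := fun x hx => (hf' x hx).prodMk (hg' x hx)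
  have hFle : ∀ x ∈ Set.Icc (0 : ℝ) 1, ‖(f' x, g' x)‖ ≤ ε / ‖z‖ * ‖(f x, g x)‖ := fun x hx =>
    max_le (hf'le x hx) (hg'le x hx)
  have hzero : (0 : ℝ) ∈ Set.Icc (0 : ℝ) 1 := by simp
  have hone : (1 : ℝ) ∈ Set.Icc (0 : ℝ) 1 := by simp
  have hθ0 : θ 0 = 0 := by simp [hθ, hϑ0]
  have hf0 : f 0 = p 0 + a 0 / (2 * z) * r 0 := by rw [← hfe, hθ0, Complex.exp_zero, one_mul]
  have hg0 : g 0 = r 0 + a 0 / (2 * z) * p 0 := by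
    rw [← hge, hθ0, neg_zero, Complex.exp_zero, one_mul]
  have hF0 : ‖(f 0, g 0)‖ ≤ 3 := by
    refine max_le ?_ ?_
    · change ‖f 0‖ ≤ 3
      rw [hf0]
      refine (norm_add_le _ _).trans ?_
      rw [norm_mul]
      have := mul_le_mul (hcoef' 0 hzero) hr0 (norm_nonneg _) (by norm_num)
      change _ + _ * ‖r 0‖ ≤ 3
      linarith
    · change ‖g 0‖ ≤ 3
      rw [hg0]
      refine (norm_add_le _ _).trans ?_
      rw [norm_mul]
      have := mul_le_mul (hcoef' 0 hzero) hp0 (norm_nonneg _) (by norm_num)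
      change _ + _ * ‖p 0‖ ≤ 3
      linarith
  have hFbd : ∀ x ∈ Set.Icc (0 : ℝ) 1, ‖(f x, g x)‖ ≤ 3 * Real.exp ε := by
    intro x hx
    -- Grönwall first gives a bound uniform in z. Inserted into the derivative estimate, it yields
    -- below a total change of order 1/‖z‖.
    have h1 := norm_le_gronwallBound_of_norm_deriv_right_le (f := fun t => (f t, g t))
      (f' := fun x => (f' x, g' x)) (δ := 3) (K := ε / ‖z‖) (ε := 0) (a := 0) (b := 1)
      (fun x hx => (hFd x hx).continuousWithinAt)
      (fun x hx => (hFd x ⟨hx.1, hx.2.le⟩).mono_of_mem_nhdsWithin (Icc_mem_nhdsGE_of_mem hx))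
      hF0 (fun x hx => by rw [add_zero]; exact hFle x ⟨hx.1, hx.2.le⟩) x hx
    rw [gronwallBound_ε0] at h1
    refine h1.trans ?_
    gcongr
    rw [sub_zero]
    calc ε / ‖z‖ * x ≤ ε / ‖z‖ * 1 := by gcongr; exact hx.2
      _ ≤ ε := by rw [mul_one]; exact div_le_self hεpos.le hz1
  have hdiff : ‖(f 1, g 1) - (f 0, g 0)‖ ≤ ε / ‖z‖ * (3 * Real.exp ε) := by
    have h1 := norm_image_sub_le_of_norm_deriv_le_segment_01' (f := fun t => (f t, g t))
      (f' := fun x => (f' x, g' x)) (C := ε / ‖z‖ * (3 * Real.exp ε)) hFd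
      (fun x hx => (hFle x ⟨hx.1, hx.2.le⟩).trans
        (mul_le_mul_of_nonneg_left (hFbd x ⟨hx.1, hx.2.le⟩) (by positivity)))
    exact h1
  have hfdiff : ‖f 1 - f 0‖ ≤ ε / ‖z‖ * (3 * Real.exp ε) :=
    (norm_fst_le ((f 1, g 1) - (f 0, g 0))).trans hdiff
  have hgdiff : ‖g 1 - g 0‖ ≤ ε / ‖z‖ * (3 * Real.exp ε) :=
    (norm_snd_le ((f 1, g 1) - (f 0, g 0))).trans hdiff
  have hpr1 : ‖p 1‖ + ‖r 1‖ ≤ 4 * C₀ * (3 * Real.exp ε) :=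
    (hpr 1 hone).trans (mul_le_mul_of_nonneg_left (hFbd 1 hone) (by positivity))
  have hθ1 : θ 1 = z + ϑ 1 := by simp [hθ]
  have hfin : (3 * C₀ * ε * Real.exp ε + C₀ * M + 6 * M * C₀ * Real.exp ε) / ‖z‖
      = C₀ * (ε / ‖z‖ * (3 * Real.exp ε)) + C₀ * (M / (2 * ‖z‖) * 2)
        + M / (2 * ‖z‖) * (4 * C₀ * (3 * Real.exp ε)) := by
    field_simp
    ring
  constructor
  · have e1 : p 1 - Complex.exp (z + ϑ 1) * p 0 = Complex.exp (θ 1) * (f 1 - f 0)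
        + Complex.exp (θ 1) * (a 0 / (2 * z) * r 0) - a 1 / (2 * z) * r 1 := by
      rw [mul_sub _ (f 1), hfe, hf0, hθ1]; ring
    change ‖p 1 - Complex.exp (z + ϑ 1) * p 0‖ ≤ _
    rw [e1, hfin]
    refine (norm_sub_le _ _).trans (add_le_add ((norm_add_le _ _).trans (add_le_add ?_ ?_)) ?_)
    · rw [norm_mul]
      exact mul_le_mul (hexp 1 hone) hfdiff (norm_nonneg _) hC₀pos.le
    · rw [norm_mul, norm_mul]
      exact mul_le_mul (hexp 1 hone) (mul_le_mul (hcoef 0 hzero) hr0 (norm_nonneg _)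
        (by positivity)) (by positivity) hC₀pos.le
    · rw [norm_mul]
      exact mul_le_mul (hcoef 1 hone) (by linarith [norm_nonneg (p 1)]) (norm_nonneg _)
        (by positivity)
  · have e1 : r 1 - Complex.exp (-(z + ϑ 1)) * r 0 = Complex.exp (-θ 1) * (g 1 - g 0)
        + Complex.exp (-θ 1) * (a 0 / (2 * z) * p 0) - a 1 / (2 * z) * p 1 := by
      rw [mul_sub _ (g 1), hge, hg0, hθ1]; ring
    change ‖r 1 - Complex.exp (-(z + ϑ 1)) * r 0‖ ≤ _
    rw [e1, hfin]
    refine (norm_sub_le _ _).trans (add_le_add ((norm_add_le _ _).trans (add_le_add ?_ ?_)) ?_)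
    · rw [norm_mul]
      exact mul_le_mul (hexp' 1 hone) hgdiff (norm_nonneg _) hC₀pos.le
    · rw [norm_mul, norm_mul]
      exact mul_le_mul (hexp' 1 hone) (mul_le_mul (hcoef 0 hzero) hp0 (norm_nonneg _)
        (by positivity)) (by positivity) hC₀pos.le
    · rw [norm_mul]
      exact mul_le_mul (hcoef 1 hone) (by linarith [norm_nonneg (r 1)]) (norm_nonneg _)
        (by positivity)

end Amplitudes

/-! ### Calculus of bounded functions that agree up to o(1); boundedness is what makes products and
determinants stable. -/

section AsympEq

open Asymptotics

variable {ι : Type*} {l : Filter ι}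

/-- `f` and `g` are bounded along `l` and their difference tends to zero. -/
def AsympEq (l : Filter ι) (f g : ι → ℂ) : Prop :=
  (fun i => f i - g i) =o[l] (fun _ => (1 : ℝ)) ∧ g =O[l] fun _ => (1 : ℝ)

namespace AsympEq

variable {f g f' g' : ι → ℂ}

theorem const (c : ℂ) : AsympEq l (fun _ => c) fun _ => c :=
  ⟨by simpa using tendsto_const_nhds, isBigO_const_const c one_ne_zero l⟩

theorem of_isBigO (h : g =O[l] fun _ => (1 : ℝ)) : AsympEq l g g :=
  ⟨by simpa using tendsto_const_nhds, h⟩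

theorem of_tendsto_zero (h : Tendsto f l (𝓝 0)) : AsympEq l f fun _ => 0 :=
  ⟨by simpa using (isLittleO_one_iff ℝ).2 h, (isBigO_zero _ _)⟩

theorem tendsto (h : AsympEq l f g) : Tendsto (fun i => f i - g i) l (𝓝 0) :=
  (isLittleO_one_iff ℝ).1 h.1

theorem congr_left (h : AsympEq l f g) (hf : f' =ᶠ[l] f) : AsympEq l f' g :=
  ⟨h.1.congr' (hf.mono fun i hi => by simp only [hi]) EventuallyEq.rfl, h.2⟩

theorem add (h : AsympEq l f g) (h' : AsympEq l f' g') :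
    AsympEq l (fun i => f i + f' i) fun i => g i + g' i :=
  ⟨by simpa only [add_sub_add_comm] using h.1.add h'.1, h.2.add h'.2⟩

theorem mul (h : AsympEq l f g) (h' : AsympEq l f' g') :
    AsympEq l (fun i => f i * f' i) fun i => g i * g' i := by
  have e1 : (fun _ : ι => (1 : ℝ)) = fun _ => (1 : ℝ) * 1 := by simp
  constructor
  · have h1 := h.1.mul h'.1
    have h2 := h.1.mul_isBigO h'.2
    have h3 := h.2.mul_isLittleO h'.1
    simp only [mul_one] at h1 h2 h3
    refine ((h1.add h2).add h3).congr_left fun i => ?_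
    ring
  · rw [e1]
    exact h.2.mul h'.2

theorem sub (h : AsympEq l f g) (h' : AsympEq l f' g') :
    AsympEq l (fun i => f i - f' i) fun i => g i - g' i := by
  have := h.add ((const (-1)).mul h')
  simpa only [neg_one_mul, ← sub_eq_add_neg] using this

theorem sum {κ : Type*} (s : Finset κ) {F G : κ → ι → ℂ} (h : ∀ k ∈ s, AsympEq l (F k) (G k)) :
    AsympEq l (fun i => ∑ k ∈ s, F k i) fun i => ∑ k ∈ s, G k i := by
  classical
  induction s using Finset.induction_on with
  | empty => simpa using const (l := l) 0
  | insert a s ha ih =>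
    simp only [Finset.sum_insert ha]
    exact (h a (Finset.mem_insert_self a s)).add (ih fun k hk => h k (Finset.mem_insert_of_mem hk))

theorem prod {κ : Type*} (s : Finset κ) {F G : κ → ι → ℂ} (h : ∀ k ∈ s, AsympEq l (F k) (G k)) :
    AsympEq l (fun i => ∏ k ∈ s, F k i) fun i => ∏ k ∈ s, G k i := by
  classical
  induction s using Finset.induction_on with
  | empty => simpa using const (l := l) 1
  | insert a s ha ih =>
    simp only [Finset.prod_insert ha]
    exact (h a (Finset.mem_insert_self a s)).mul (ih fun k hk => h k (Finset.mem_insert_of_mem hk))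

variable {n : Type*} [Fintype n] [DecidableEq n] {A B A' B' : ι → Matrix n n ℂ}

theorem matrix_mul (h : ∀ p q, AsympEq l (fun i => A i p q) fun i => B i p q)
    (h' : ∀ p q, AsympEq l (fun i => A' i p q) fun i => B' i p q) (p q : n) :
    AsympEq l (fun i => (A i * A' i) p q) fun i => (B i * B' i) p q := by
  simp only [Matrix.mul_apply]
  exact sum _ fun k _ => (h p k).mul (h' k q)

theorem det (h : ∀ p q, AsympEq l (fun i => A i p q) fun i => B i p q) :
    AsympEq l (fun i => (A i).det) fun i => (B i).det := by
  simp only [Matrix.det_apply']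
  exact sum _ fun σ _ => (const _).mul (prod _ fun k _ => h _ _)

end AsympEq

theorem differentiableAt_det {n : Type*} [Fintype n] [DecidableEq n] {A : ℂ → Matrix n n ℂ} {z : ℂ}
    (h : ∀ p q, DifferentiableAt ℂ (fun w => A w p q) z) :
    DifferentiableAt ℂ (fun w => (A w).det) z := by
  simp only [Matrix.det_apply']
  refine DifferentiableAt.fun_sum fun σ _ => (differentiableAt_const _).mul ?_
  exact DifferentiableAt.fun_finsetProd fun k _ => h _ _

end AsympEq

/-! ### High frequency behaviour of the two basic waves in a vertical strip. -/

section EdgeAsymptotics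

/-- The filter of large imaginary parts in the strip of width `2 K`. -/
def stripFilter (K : ℝ) : Filter ℂ := comap (fun z : ℂ => |z.im|) atTop ⊓ 𝓟 {z : ℂ | |z.re| ≤ K}

theorem tendsto_norm_stripFilter (K : ℝ) : Tendsto (fun z : ℂ => ‖z‖) (stripFilter K) atTop :=
  tendsto_atTop_mono (fun z => Complex.abs_im_le_norm z) (tendsto_comap.mono_left inf_le_left)

theorem eventually_abs_re_le (K : ℝ) : ∀ᶠ z in stripFilter K, |z.re| ≤ K :=
  mem_inf_of_right (mem_principal_self _)

theorem tendsto_inv_stripFilter (K : ℝ) : Tendsto (fun z : ℂ => z⁻¹) (stripFilter K) (𝓝 0) :=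
  tendsto_inv₀_cobounded.comp (tendsto_norm_atTop_iff_cobounded.1 (tendsto_norm_stripFilter K))

theorem eventually_ne_zero_stripFilter (K : ℝ) : ∀ᶠ z in stripFilter K, z ≠ 0 :=
  ((tendsto_norm_stripFilter K).eventually_gt_atTop 0).mono fun _ hz => norm_pos_iff.1 hz

theorem isBigO_exp_stripFilter (K : ℝ) (c d : ℂ) (hd : d = 1 ∨ d = -1) :
    (fun z : ℂ => Complex.exp (d * (z + c))) =O[stripFilter K] fun _ => (1 : ℝ) := by
  refine Asymptotics.IsBigO.of_bound (Real.exp (K + ‖c‖)) ?_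
  filter_upwards [eventually_abs_re_le K] with z hz
  simp only [norm_one, mul_one]
  refine norm_exp_le_exp_norm_re ?_
  have h : |(z + c).re| ≤ K + ‖c‖ := by
    rw [Complex.add_re]
    exact (abs_add_le _ _).trans (add_le_add hz (Complex.abs_re_le_norm c))
  rcases hd with rfl | rfl
  · simpa using h
  · rw [neg_one_mul, Complex.neg_re, abs_neg]; exact h

/-- The solution with `ψ(0) = 1` and `ψ'(0) = σ z`. -/
def waveSol (α β : EdgeC) (σ z : ℂ) : EdgeC := fundSol α β 0 z + (σ * z) • fundSol α β 1 z

/-- The derivative of the solution with `ψ(0) = 1` and `ψ'(0) = σ z`. -/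
def waveSolDeriv (α β : EdgeC) (σ z : ℂ) : EdgeC :=
  fundSolDeriv α β 0 z + (σ * z) • fundSolDeriv α β 1 z

theorem waveSol_eq (α β : EdgeC) (σ z : ℂ) :
    waveSol α β σ z = 1 + edgeInt (waveSolDeriv α β σ z) := by
  rw [waveSol, waveSolDeriv, fundSol_eq, fundSol_eq α β 1, map_add, map_smul]
  simp [add_assoc]

theorem waveSolDeriv_eq (α β : EdgeC) (σ z : ℂ) :
    waveSolDeriv α β σ z = (σ * z) • 1 + edgeInt (edgeCoeff α β z * waveSol α β σ z) := by
  rw [waveSol, waveSolDeriv, fundSolDeriv, fundSolDeriv, mul_add, map_add, mul_smul_comm, map_smul]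
  simp only [zero_ne_one, if_false, if_true, zero_add, smul_add]
  abel

/-- The mean of the damping. -/
def edgeMean (α : EdgeC) : ℂ := evalOne (edgeInt α)

theorem exists_deriv_bound {a : ℝ → ℝ} (ha : ContDiffOn ℝ 2 a (Set.Icc 0 1)) :
    ∃ a' : ℝ → ℝ, (∀ x ∈ Set.Icc (0 : ℝ) 1, HasDerivWithinAt a (a' x) (Set.Icc 0 1) x) ∧
      ∃ C, ∀ x ∈ Set.Icc (0 : ℝ) 1, |a' x| ≤ C := by
  refine ⟨derivWithin a (Set.Icc 0 1), fun x hx =>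
    ((ha.differentiableOn (by norm_num)) x hx).hasDerivWithinAt, ?_⟩
  have := ha.continuousOn_derivWithin (uniqueDiffOn_Icc zero_lt_one) (by norm_num)
  exact isCompact_Icc.exists_bound_of_continuousOn this

/-- The initial amplitudes of the wave with data (1, σz) are 1 ± σ, hence 0 and 2, which is the
normalisation required by `exists_amplitude_bound`. The constants depend on the strip and the edge
data only, not on z. -/
theorem exists_waveSol_bound {α β : EdgeC} {a : ℝ → ℝ} (ha : ContDiffOn ℝ 2 a (Set.Icc 0 1))
    (hα : ∀ x ∈ Set.Icc (0 : ℝ) 1, edgeExt α x = a x) (K : ℝ) :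
    ∃ C M : ℝ, ∀ z σ : ℂ, (σ = 1 ∨ σ = -1) → |z.re| ≤ K → M ≤ ‖z‖ →
      ‖evalOne (waveSol α β σ z) + evalOne (waveSolDeriv α β σ z) / z
        - Complex.exp (z + edgeMean α) * (1 + σ)‖ ≤ C / ‖z‖ ∧
      ‖evalOne (waveSol α β σ z) - evalOne (waveSolDeriv α β σ z) / z
        - Complex.exp (-(z + edgeMean α)) * (1 - σ)‖ ≤ C / ‖z‖ := by
  obtain ⟨a', ha', D, hD⟩ := exists_deriv_bound ha
  set M : ℝ := max (max 1 D) (max ‖α‖ ‖β‖) with hM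
  have hM1 : 1 ≤ M := (le_max_left _ _).trans (le_max_left _ _)
  obtain ⟨C, hC⟩ := exists_amplitude_bound K M hM1
  refine ⟨C, M, fun z σ hσ hzK hzM => ?_⟩
  have hz : z ≠ 0 := norm_pos_iff.1 (by linarith)
  set u := waveSol α β σ z with hu
  set v := waveSolDeriv α β σ z with hv
  have hu' := waveSol_eq α β σ z
  have hv' := waveSolDeriv_eq α β σ z
  set ϑ : ℝ → ℂ := fun x => ∫ t in (0 : ℝ)..x, edgeExt α t with hϑ
  set ψ : ℝ → ℂ := fun x => 1 + ∫ t in (0 : ℝ)..x, edgeExt v t with hψ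
  set ψ₁ : ℝ → ℂ := fun x => σ * z + ∫ t in (0 : ℝ)..x, edgeExt (edgeCoeff α β z * u) t with hψ₁
  have eψ : ∀ x (hx : x ∈ Set.Icc (0 : ℝ) 1), ψ x = u ⟨x, hx⟩ := by
    intro x hx
    have := congrArg (fun f : EdgeC => f ⟨x, hx⟩) hu'
    simpa [edgeInt_apply] using this.symm
  have eψ₁ : ∀ x (hx : x ∈ Set.Icc (0 : ℝ) 1), ψ₁ x = v ⟨x, hx⟩ := by
    intro x hx
    have := congrArg (fun f : EdgeC => f ⟨x, hx⟩) hv'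
    simpa [edgeInt_apply] using this.symm
  have hone : (1 : ℝ) ∈ Set.Icc (0 : ℝ) 1 := by simp
  have h0 : ψ 0 = 1 := by simp [hψ]
  have h0' : ψ₁ 0 / z = σ := by simp [hψ₁, hz]
  have h1 : ψ 1 = evalOne u := eψ 1 hone
  have h1' : ψ₁ 1 = evalOne v := eψ₁ 1 hone
  have hϑ1 : ϑ 1 = edgeMean α := rfl
  have hσ' : ‖σ‖ = 1 := by rcases hσ with rfl | rfl <;> simp
  have key := hC z (edgeExt α) (fun x => a' x) (edgeExt β) ϑ ψ ψ₁ hzK hzM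
    (fun x _ => (hasDerivAt_integral_edgeExt α x).hasDerivWithinAt) (by simp [hϑ])
    (fun x hx => by
      refine (intervalIntegral.norm_integral_le_of_norm_le_const
        (C := ‖α‖) fun t _ => norm_edgeExt_le α t).trans ?_
      rw [sub_zero, abs_of_nonneg hx.1]
      exact (mul_le_of_le_one_right (norm_nonneg α) hx.2).trans
        ((le_max_left _ _).trans (le_max_right _ _)))
    (fun x hx => ((ha' x hx).ofReal_comp).congr (fun t ht => hα t ht) (hα x hx))
    (fun x _ => (norm_edgeExt_le α x).trans ((le_max_left _ _).trans (le_max_right _ _)))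
    (fun x hx => by
      rw [Complex.norm_real]
      exact (hD x hx).trans ((le_max_right _ _).trans (le_max_left _ _)))
    (fun x _ => (norm_edgeExt_le β x).trans ((le_max_right _ _).trans (le_max_right _ _)))
    (fun x hx => by
      have := (hasDerivAt_integral_edgeExt v x).const_add 1
      rw [edgeExt_of_mem v hx, ← eψ₁ x hx] at this
      exact this.hasDerivWithinAt)
    (fun x hx => by
      have := (hasDerivAt_integral_edgeExt (edgeCoeff α β z * u) x).const_add (σ * z)
      refine this.hasDerivWithinAt.congr_deriv ?_
      rw [edgeExt_mul, edgeExt_of_mem u hx, ← eψ x hx]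
      simp only [edgeExt_of_mem _ hx, edgeCoeff, EdgeC.add_apply, EdgeC.sub_apply,
        EdgeC.smul_apply, EdgeC.one_apply]
      ring)
    (by rw [h0, h0']; refine (norm_add_le _ _).trans ?_; rw [hσ', norm_one]; norm_num)
    (by rw [h0, h0']; refine (norm_sub_le _ _).trans ?_; rw [hσ', norm_one]; norm_num)
  rw [h0, h0', h1, h1', hϑ1] at key
  exact key

end EdgeAsymptotics

/-! ### The normalised secular determinant and its high frequency limit. -/

section ReducedDet

variable {N : ℕ}

/-- Evaluation of entire functions at a point. -/
def evalHom (z : ℂ) : entireFunctions →+* ℂ :=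
  (Pi.evalRingHom (fun _ : ℂ => ℂ) z).comp entireFunctions.val.toRingHom

theorem evalHom_apply (z : ℂ) (f : entireFunctions) : evalHom z f = f.1 z := rfl

theorem secularDet_apply (U : Matrix (Fin N × Fin 2) (Fin N × Fin 2) ℂ) (α β : Fin N → EdgeC)
    (z : ℂ) : secularDet U α β z = ((U - 1) * (valueMatrix α β).map (evalHom z)
      + (Complex.I • (U + 1)) * (derivMatrix α β).map (evalHom z)).det := by
  have h : secularDet U α β z = evalHom z (secularMatrix U α β).det := rfl
  have e : ∀ A : Matrix (Fin N × Fin 2) (Fin N × Fin 2) ℂ,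
      (A.map (algebraMap ℂ entireFunctions)).map (evalHom z) = A := fun A => by ext; rfl
  rw [h, RingHom.map_det, RingHom.mapMatrix_apply, secularMatrix,
    Matrix.map_add _ (map_add (evalHom z)), Matrix.map_mul, Matrix.map_mul, e, e]

theorem differentiable_secularDet (U : Matrix (Fin N × Fin 2) (Fin N × Fin 2) ℂ)
    (α β : Fin N → EdgeC) : Differentiable ℂ (secularDet U α β) :=
  (secularMatrix U α β).det.2

/-- The sign of the wave number of the two waves on an edge. -/
def waveSign (κ : Fin 2) : ℂ := if κ = 0 then 1 else -1

/-- The factor by which the two waves on an edge are normalised. -/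
def waveScale (α : Fin N → EdgeC) (z : ℂ) (c : Fin N × Fin 2) : ℂ :=
  if c.2 = 0 then 1 else Complex.exp (z + edgeMean (α c.1))

theorem waveScale_ne_zero (α : Fin N → EdgeC) (z : ℂ) (c : Fin N × Fin 2) :
    waveScale α z c ≠ 0 := by
  unfold waveScale
  split_ifs
  · exact one_ne_zero
  · exact Complex.exp_ne_zero _

/-- The initial values of the two normalised waves on each edge. -/
def waveMatrix (α : Fin N → EdgeC) (z : ℂ) : Matrix (Fin N × Fin 2) (Fin N × Fin 2) ℂ := fun r c =>
  if r.1 = c.1 then (if r.2 = 0 then 1 else waveSign c.2 * z) * waveScale α z c else 0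

theorem det_waveMatrix_ne_zero (α : Fin N → EdgeC) {z : ℂ} (hz : z ≠ 0) :
    (waveMatrix α z).det ≠ 0 := by
  set B : Matrix (Fin N × Fin 2) (Fin N × Fin 2) ℂ := fun c r =>
    if c.1 = r.1 then (if r.2 = 0 then 1 / 2 else waveSign c.2 / (2 * z)) * (waveScale α z c)⁻¹
    else 0 with hB
  have h : B * waveMatrix α z = 1 := by
    ext ⟨e, κ⟩ ⟨e', κ'⟩
    rw [Matrix.mul_apply, Fintype.sum_prod_type, Finset.sum_eq_single e]
    · have h1 := waveScale_ne_zero α z (e, κ)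
      by_cases he : e = e'
      · subst he
        rw [Fin.sum_univ_two]
        simp only [hB, waveMatrix, if_true]
        fin_cases κ <;> fin_cases κ' <;> simp [waveSign] at h1 ⊢ <;> field_simp <;>
          ring
      · simp [waveMatrix, he]
    · intro e'' _ he
      simp [hB, he.symm]
    · simp
  intro h2
  have h3 := congrArg Matrix.det h
  rw [Matrix.det_mul, h2, mul_zero, Matrix.det_one] at h3
  exact zero_ne_one h3

/-- The boundary values of the waves. -/
theorem valueMatrix_mul_waveMatrix (α β : Fin N → EdgeC) (z : ℂ) (p c : Fin N × Fin 2) :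
    ((valueMatrix α β).map (evalHom z) * waveMatrix α z) p c
      = if p.1 = c.1 then (if p.2 = 0 then 1 else
        evalOne (waveSol (α p.1) (β p.1) (waveSign c.2) z)) * waveScale α z c else 0 := by
  obtain ⟨e, s⟩ := p
  rw [Matrix.mul_apply, Fintype.sum_prod_type, Finset.sum_eq_single e]
  · rw [Fin.sum_univ_two]
    by_cases he : e = c.1
    · simp only [Matrix.map_apply, valueMatrix, waveMatrix, he, if_true, evalHom_apply]
      fin_cases s
      · simp
      · simp [endValue, waveSol, map_add, map_smul]; ring
    · simp [waveMatrix, he]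
  · intro e'' _ he
    simp [valueMatrix, he.symm]
  · simp

/-- The boundary derivatives of the waves. -/
theorem derivMatrix_mul_waveMatrix (α β : Fin N → EdgeC) (z : ℂ) (p c : Fin N × Fin 2) :
    ((derivMatrix α β).map (evalHom z) * waveMatrix α z) p c
      = if p.1 = c.1 then (if p.2 = 0 then waveSign c.2 * z else
        -evalOne (waveSolDeriv (α p.1) (β p.1) (waveSign c.2) z)) * waveScale α z c else 0 := by
  obtain ⟨e, s⟩ := p
  rw [Matrix.mul_apply, Fintype.sum_prod_type, Finset.sum_eq_single e]
  · rw [Fin.sum_univ_two]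
    by_cases he : e = c.1
    · simp only [Matrix.map_apply, derivMatrix, waveMatrix, he, if_true, evalHom_apply]
      fin_cases s
      · simp
      · simp [endDeriv, waveSolDeriv, map_add, map_smul]; ring
    · simp [waveMatrix, he]
  · intro e'' _ he
    simp [derivMatrix, he.symm]
  · simp

/-- The outgoing amplitudes at the edge ends. -/
def outMatrix (α β : Fin N → EdgeC) (z : ℂ) : Matrix (Fin N × Fin 2) (Fin N × Fin 2) ℂ :=
  (2 : ℂ)⁻¹ • ((valueMatrix α β).map (evalHom z) * waveMatrix α z
    + z⁻¹ • ((derivMatrix α β).map (evalHom z) * waveMatrix α z))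

/-- The incoming amplitudes at the edge ends. -/
def inMatrix (α β : Fin N → EdgeC) (z : ℂ) : Matrix (Fin N × Fin 2) (Fin N × Fin 2) ℂ :=
  (2 : ℂ)⁻¹ • ((valueMatrix α β).map (evalHom z) * waveMatrix α z
    - z⁻¹ • ((derivMatrix α β).map (evalHom z) * waveMatrix α z))

/-- The matrix which interchanges the two ends of each edge, with weights. -/
def edgeSwap (w : Fin N → ℂ) : Matrix (Fin N × Fin 2) (Fin N × Fin 2) ℂ := fun p c =>
  if p.1 = c.1 ∧ p.2 ≠ c.2 then w p.1 else 0

theorem tendsto_const_div_norm (K C : ℝ) :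
    Tendsto (fun z : ℂ => C / ‖z‖) (stripFilter K) (𝓝 0) :=
  (tendsto_norm_stripFilter K).const_div_atTop C

/-- At x = 1 the derivative into the edge changes sign, so outgoing means ψ + ψ'/z at 0 and ψ − ψ'/z
at 1. The first wave leaves 0 and the second leaves 1; `waveScale` is chosen to give the second one
outgoing amplitude 1 in the limit, so the identity matrix results. -/
theorem asympEq_outMatrix {α β : Fin N → EdgeC} {a : Fin N → ℝ → ℝ}
    (ha : ∀ e, ContDiffOn ℝ 2 (a e) (Set.Icc 0 1))
    (hα : ∀ e, ∀ x ∈ Set.Icc (0 : ℝ) 1, edgeExt (α e) x = a e x) (K : ℝ) (p c : Fin N × Fin 2) :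
    AsympEq (stripFilter K) (fun z => outMatrix α β z p c)
      fun _ => (1 : Matrix (Fin N × Fin 2) (Fin N × Fin 2) ℂ) p c := by
  simp only [outMatrix, Matrix.smul_apply, Matrix.add_apply, valueMatrix_mul_waveMatrix,
    derivMatrix_mul_waveMatrix]
  obtain ⟨e, s⟩ := p
  obtain ⟨e', κ⟩ := c
  by_cases he : e = e'
  swap
  · simp only [he, if_false, smul_zero, add_zero]
    rw [Matrix.one_apply_ne (by simp [he])]
    exact AsympEq.const 0
  subst he
  simp only [if_true]
  fin_cases s
  · refine (AsympEq.const _).congr_left ?_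
    filter_upwards [eventually_ne_zero_stripFilter K] with z hz
    fin_cases κ <;> simp [waveSign, waveScale, hz]
    norm_num
  · obtain ⟨C, M, hC⟩ := exists_waveSol_bound (β := β e) (ha e) (hα e) K
    have hσ : waveSign κ = 1 ∨ waveSign κ = -1 := by fin_cases κ <;> simp [waveSign]
    have h1 : AsympEq (stripFilter K) (fun z => evalOne (waveSol (α e) (β e) (waveSign κ) z)
        - evalOne (waveSolDeriv (α e) (β e) (waveSign κ) z) / z)
        (fun z => Complex.exp (-1 * (z + edgeMean (α e))) * (1 - waveSign κ)) := by
      have h2 := (AsympEq.of_isBigO (isBigO_exp_stripFilter K (edgeMean (α e)) (-1) (Or.inr rfl))).mul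
        (AsympEq.const (1 - waveSign κ))
      refine ⟨(Asymptotics.isLittleO_one_iff ℝ).2 ?_, h2.2⟩
      refine squeeze_zero_norm' ?_ (tendsto_const_div_norm K C)
      filter_upwards [eventually_abs_re_le K, (tendsto_norm_stripFilter K).eventually_ge_atTop M]
        with z hz1 hz2
      rw [neg_one_mul]
      exact (hC z (waveSign κ) hσ hz1 hz2).2
    have h3 : AsympEq (stripFilter K) (fun z => waveScale α z (e, κ))
        (fun z => waveScale α z (e, κ)) := by
      refine AsympEq.of_isBigO ?_
      fin_cases κ
      · simpa [waveScale] using Asymptotics.isBigO_const_const (1 : ℂ) (one_ne_zero (α := ℝ)) _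
      · simpa [waveScale] using isBigO_exp_stripFilter K (edgeMean (α e)) 1 (Or.inl rfl)
    have h4 := (AsympEq.const ((2 : ℂ)⁻¹)).mul (h1.mul h3)
    refine ⟨h4.1.congr_left fun z => ?_, (AsympEq.const _).2⟩
    fin_cases κ
    · simp [waveSign, waveScale]
      ring
    · simp [waveSign, waveScale]
      rw [mul_right_comm, ← Complex.exp_add]
      simp
      ring

/-- Each wave arrives only at the end opposite to the one it leaves, with the factor exp(z + ∫a)
accumulated along the edge. The limit is thus e^z times a weighted exchange of ends. -/
theorem asympEq_inMatrix {α β : Fin N → EdgeC} {a : Fin N → ℝ → ℝ}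
    (ha : ∀ e, ContDiffOn ℝ 2 (a e) (Set.Icc 0 1))
    (hα : ∀ e, ∀ x ∈ Set.Icc (0 : ℝ) 1, edgeExt (α e) x = a e x) (K : ℝ) (p c : Fin N × Fin 2) :
    AsympEq (stripFilter K) (fun z => inMatrix α β z p c)
      fun z => (Complex.exp z • edgeSwap fun e => Complex.exp (edgeMean (α e))) p c := by
  simp only [inMatrix, Matrix.smul_apply, Matrix.sub_apply, valueMatrix_mul_waveMatrix,
    derivMatrix_mul_waveMatrix]
  obtain ⟨e, s⟩ := p
  obtain ⟨e', κ⟩ := c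
  by_cases he : e = e'
  swap
  · simp only [he, if_false, smul_zero, sub_zero, edgeSwap, false_and]
    exact AsympEq.const 0
  subst he
  simp only [if_true, edgeSwap, true_and]
  have hbd := isBigO_exp_stripFilter K (edgeMean (α e)) 1 (Or.inl rfl)
  simp only [one_mul] at hbd
  have h3 : AsympEq (stripFilter K) (fun z => waveScale α z (e, κ))
      (fun z => waveScale α z (e, κ)) := by
    refine AsympEq.of_isBigO ?_
    fin_cases κ
    · simpa [waveScale] using Asymptotics.isBigO_const_const (1 : ℂ) (one_ne_zero (α := ℝ)) _
    · simpa [waveScale] using hbd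
  have h5 : AsympEq (stripFilter K) (fun z => Complex.exp z • if s ≠ κ then
      Complex.exp (edgeMean (α e)) else 0) (fun z => Complex.exp z • if s ≠ κ then
      Complex.exp (edgeMean (α e)) else 0) := by
    refine AsympEq.of_isBigO ?_
    by_cases hs : s ≠ κ
    · simp only [hs, if_true, smul_eq_mul, ← Complex.exp_add, ne_eq, not_false_eq_true]
      exact hbd
    · simp only [hs, if_false, smul_zero]
      exact Asymptotics.isBigO_const_const (0 : ℂ) (one_ne_zero (α := ℝ)) _
  fin_cases s
  · refine h5.congr_left ?_
    filter_upwards [eventually_ne_zero_stripFilter K] with z hz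
    fin_cases κ
    · simp [waveSign, waveScale, hz]
    · simp [waveSign, waveScale, hz, Complex.exp_add]
      ring
  · obtain ⟨C, M, hC⟩ := exists_waveSol_bound (β := β e) (ha e) (hα e) K
    have hσ : waveSign κ = 1 ∨ waveSign κ = -1 := by fin_cases κ <;> simp [waveSign]
    have h1 : AsympEq (stripFilter K) (fun z => evalOne (waveSol (α e) (β e) (waveSign κ) z)
        + evalOne (waveSolDeriv (α e) (β e) (waveSign κ) z) / z)
        (fun z => Complex.exp (z + edgeMean (α e)) * (1 + waveSign κ)) := by
      have h2 := (AsympEq.of_isBigO hbd).mul (AsympEq.const (1 + waveSign κ))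
      refine ⟨(Asymptotics.isLittleO_one_iff ℝ).2 ?_, h2.2⟩
      refine squeeze_zero_norm' ?_ (tendsto_const_div_norm K C)
      filter_upwards [eventually_abs_re_le K, (tendsto_norm_stripFilter K).eventually_ge_atTop M]
        with z hz1 hz2
      exact (hC z (waveSign κ) hσ hz1 hz2).1
    have h4 := (AsympEq.const ((2 : ℂ)⁻¹)).mul (h1.mul h3)
    refine ⟨h4.1.congr_left fun z => ?_, h5.2⟩
    fin_cases κ
    · simp [waveSign, waveScale, Complex.exp_add]
      ring
    · simp [waveSign, waveScale]
      ring

/-- The transfer matrix of the high frequency limit. -/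
def limitMatrix (P : Matrix (Fin N × Fin 2) (Fin N × Fin 2) ℂ) (α : Fin N → EdgeC) :
    Matrix (Fin N × Fin 2) (Fin N × Fin 2) ℂ :=
  (2 • P - 1) * edgeSwap fun e => Complex.exp (edgeMean (α e))

/-- The normalised secular function. -/
def reducedDet (U P G : Matrix (Fin N × Fin 2) (Fin N × Fin 2) ℂ) (α β : Fin N → EdgeC) (z : ℂ) :
    ℂ :=
  (IsCouplingPair.leftFactor P G z).det * secularDet U α β z * (waveMatrix α z).det

variable {U P G : Matrix (Fin N × Fin 2) (Fin N × Fin 2) ℂ}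

/-- Substituting Ψ = out + in and Ψ' = z(out − in) puts the coupling condition into scattering form,
with corrections of order 1/z. -/
theorem reducedDet_eq (h : IsCouplingPair U P G) (α β : Fin N → EdgeC) {z : ℂ} (hz : z ≠ 0) :
    reducedDet U P G α β z = ((1 + (Complex.I * z)⁻¹ • (P - (2 : ℂ) • G)) * outMatrix α β z
      - ((2 • P - 1) + (-(Complex.I * z)⁻¹) • (P - (2 : ℂ) • G)) * inMatrix α β z).det := by
  rw [reducedDet, secularDet_apply, ← Matrix.det_mul, ← Matrix.det_mul, ← h.leftFactor_mul_in hz,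
    ← h.leftFactor_mul_out hz]
  congr 1
  have h1 : (valueMatrix α β).map (evalHom z) * waveMatrix α z
      = outMatrix α β z + inMatrix α β z := by
    rw [outMatrix, inMatrix, ← smul_add, add_add_sub_cancel, ← two_smul ℂ, smul_smul,
      inv_mul_cancel₀ two_ne_zero, one_smul]
  have h2 : (derivMatrix α β).map (evalHom z) * waveMatrix α z
      = z • (outMatrix α β z - inMatrix α β z) := by
    rw [outMatrix, inMatrix, ← smul_sub, add_sub_sub_cancel, ← two_smul ℂ, smul_smul, smul_smul,
      mul_assoc, inv_mul_cancel₀ two_ne_zero, smul_smul, mul_one, mul_inv_cancel₀ hz, one_smul]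
  rw [mul_assoc, mul_assoc, mul_assoc, ← mul_sub, add_mul, mul_assoc, mul_assoc, h1, h2]
  congr 1
  rw [mul_add, add_mul, add_mul, neg_mul, smul_mul_assoc, smul_mul_assoc, smul_mul_assoc,
    mul_smul_comm, mul_sub, smul_smul, smul_sub]
  abel

theorem asympEq_reducedDet (h : IsCouplingPair U P G) {α β : Fin N → EdgeC} {a : Fin N → ℝ → ℝ}
    (ha : ∀ e, ContDiffOn ℝ 2 (a e) (Set.Icc 0 1))
    (hα : ∀ e, ∀ x ∈ Set.Icc (0 : ℝ) 1, edgeExt (α e) x = a e x) (K : ℝ) :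
    AsympEq (stripFilter K) (reducedDet U P G α β)
      fun z => (1 - Complex.exp z • limitMatrix P α).det := by
  have hη : Tendsto (fun z : ℂ => (Complex.I * z)⁻¹) (stripFilter K) (𝓝 0) := by
    have := (tendsto_inv_stripFilter K).const_mul (Complex.I⁻¹)
    rw [mul_zero] at this
    exact this.congr fun z => (mul_inv _ _).symm
  have hη' : Tendsto (fun z : ℂ => -(Complex.I * z)⁻¹) (stripFilter K) (𝓝 0) := by
    simpa using hη.neg
  have hpert : ∀ (η : ℂ → ℂ) (A B : Matrix (Fin N × Fin 2) (Fin N × Fin 2) ℂ),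
      Tendsto η (stripFilter K) (𝓝 0) → ∀ p q,
      AsympEq (stripFilter K) (fun z => (A + η z • B) p q) fun _ => A p q := by
    intro η A B hη p q
    have := (AsympEq.const (l := stripFilter K) (A p q)).add
      ((AsympEq.of_tendsto_zero hη).mul (AsympEq.const (B p q)))
    simpa using this
  have h1 := fun p q => (AsympEq.matrix_mul
    (hpert _ 1 (P - (2 : ℂ) • G) hη) (asympEq_outMatrix (β := β) ha hα K) p q).sub
    (AsympEq.matrix_mul (hpert _ (2 • P - 1) (P - (2 : ℂ) • G) hη')
      (asympEq_inMatrix (β := β) ha hα K) p q)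
  have h2 := (AsympEq.det (A := fun z => (1 + (Complex.I * z)⁻¹ • (P - (2 : ℂ) • G)) * outMatrix α β z
      - ((2 • P - 1) + (-(Complex.I * z)⁻¹) • (P - (2 : ℂ) • G)) * inMatrix α β z)
      (B := fun z => 1 - Complex.exp z • limitMatrix P α) fun p q => by
        have := h1 p q
        simp only [mul_smul_comm, one_mul] at this
        exact this)
  refine h2.congr_left ?_
  filter_upwards [eventually_ne_zero_stripFilter K] with z hz
  exact reducedDet_eq h α β hz

theorem analyticAt_leftFactor_det (P G : Matrix (Fin N × Fin 2) (Fin N × Fin 2) ℂ) {z : ℂ}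
    (hz : z ≠ 0) : AnalyticAt ℂ (fun w => (IsCouplingPair.leftFactor P G w).det) z := by
  refine DifferentiableOn.analyticAt (s := {0}ᶜ) (fun w hw => ?_)
    (isOpen_compl_singleton.mem_nhds hz)
  refine (differentiableAt_det fun p q => ?_).differentiableWithinAt
  have hw' : Complex.I * w ≠ 0 := mul_ne_zero Complex.I_ne_zero hw
  simp only [IsCouplingPair.leftFactor, Matrix.sub_apply, Matrix.smul_apply, smul_eq_mul]
  fun_prop (disch := assumption)

theorem differentiable_waveMatrix_det (α : Fin N → EdgeC) :
    Differentiable ℂ fun z => (waveMatrix α z).det := by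
  intro z
  refine differentiableAt_det fun p q => ?_
  simp only [waveMatrix, waveScale]
  split_ifs <;> fun_prop

theorem analyticAt_reducedDet (U P G : Matrix (Fin N × Fin 2) (Fin N × Fin 2) ℂ)
    (α β : Fin N → EdgeC) {z : ℂ} (hz : z ≠ 0) : AnalyticAt ℂ (reducedDet U P G α β) z :=
  ((analyticAt_leftFactor_det P G hz).mul ((differentiable_secularDet U α β).analyticAt z)).mul
    ((differentiable_waveMatrix_det α).analyticAt z)

/-- Away from 0 the two normalising determinants have no zeros, so multiplicities may be counted
with either function. -/
theorem analyticOrderAt_reducedDet (h : IsCouplingPair U P G) (α β : Fin N → EdgeC) {z : ℂ}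
    (hz : z ≠ 0) :
    analyticOrderAt (reducedDet U P G α β) z = analyticOrderAt (secularDet U α β) z := by
  have h1 := analyticAt_leftFactor_det P G hz
  have h2 := (differentiable_secularDet U α β).analyticAt z
  have h3 := (differentiable_waveMatrix_det α).analyticAt z
  have e : reducedDet U P G α β = ((fun w => (IsCouplingPair.leftFactor P G w).det)
    * secularDet U α β) * fun w => (waveMatrix α w).det := rfl
  rw [e, analyticOrderAt_mul (h1.mul h2) h3, analyticOrderAt_mul h1 h2,
    h1.analyticOrderAt_eq_zero.2 (h.det_leftFactor_ne_zero hz),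
    h3.analyticOrderAt_eq_zero.2 (det_waveMatrix_ne_zero α hz), zero_add, add_zero]

end ReducedDet

/-! ### Reality and size of the boundary term in the energy identity. -/

section BoundaryForm

variable {n : Type*} [Fintype n] [DecidableEq n] {U P G : Matrix n n ℂ}

/-- Unitarity in the form V + Vᴴ = VᴴV for V = U + 1, compressed by Gᴴ on the left and G on the
right. -/
theorem IsCouplingPair.inv_add_conjTranspose (h : IsCouplingPair U P G)
    (hU : U ∈ Matrix.unitaryGroup n ℂ) : G + G.conjTranspose = P := by
  have h1 : (U + 1) + (U + 1).conjTranspose = (U + 1).conjTranspose * (U + 1) := by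
    have h : U.conjTranspose * U = 1 := Matrix.mem_unitaryGroup_iff'.1 hU
    rw [Matrix.conjTranspose_add, Matrix.conjTranspose_one, add_mul, mul_add, mul_add, h]
    simp only [mul_one, one_mul]
    abel
  have h2 : G.conjTranspose * P = G.conjTranspose := by
    rw [← h.hermitian, ← Matrix.conjTranspose_mul, h.proj_inv]
  have h3 : G.conjTranspose * (U + 1).conjTranspose = P := by
    rw [← Matrix.conjTranspose_mul, h.mul_inv, h.hermitian]
  calc G + G.conjTranspose = G.conjTranspose * ((U + 1) + (U + 1).conjTranspose) * G := by
        rw [mul_add, add_mul, mul_assoc, h.mul_inv, h2, h3, h.proj_inv, add_comm]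
    _ = P := by rw [h1, ← mul_assoc, h3, mul_assoc, h.mul_inv, h.proj_sq]

/-- Under the coupling condition the boundary form is a hermitian form of the boundary values. -/
theorem IsCouplingPair.boundary_form_eq (h : IsCouplingPair U P G) {p q : n → ℂ}
    (hpq : (U - 1).mulVec p + Complex.I • (U + 1).mulVec q = 0) :
    star p ⬝ᵥ q = star p ⬝ᵥ (Complex.I • (P - 2 • G)).mulVec p := by
  have e : U - 1 = (U + 1) - 2 • 1 := by rw [two_smul]; abel
  -- Applying 1 − P removes both U + 1 terms and leaves (1 − P)p = 0, the Dirichlet part of the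
  -- condition. Applying G below expresses Pq through p, the Robin part.
  have h1 : P.mulVec p = p := by
    have h2 := congrArg ((1 - P).mulVec) hpq
    rw [Matrix.mulVec_add, Matrix.mulVec_smul, Matrix.mulVec_mulVec, Matrix.mulVec_mulVec,
      h.comp_eq_zero, e, mul_sub, h.comp_eq_zero, mul_smul_comm, mul_one, Matrix.zero_mulVec,
      smul_zero, add_zero, zero_sub, Matrix.neg_mulVec, Matrix.mulVec_zero, neg_eq_zero,
      Matrix.smul_mulVec, smul_eq_zero] at h2
    have h3 := h2.resolve_left two_ne_zero
    rw [Matrix.sub_mulVec, Matrix.one_mulVec, sub_eq_zero] at h3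
    exact h3.symm
  have h2 : P.mulVec q = (Complex.I • (P - 2 • G)).mulVec p := by
    have h2 := congrArg (G.mulVec) hpq
    rw [Matrix.mulVec_add, Matrix.mulVec_smul, Matrix.mulVec_mulVec, Matrix.mulVec_mulVec,
      h.inv_mul, e, mul_sub, h.inv_mul, mul_smul_comm, mul_one, Matrix.mulVec_zero] at h2
    have h3 := eq_neg_of_add_eq_zero_left h2
    rw [Matrix.smul_mulVec, h3, smul_neg, smul_smul, Complex.I_mul_I, neg_one_smul, neg_neg]
  rw [← h2]
  conv_lhs => rw [← h1]
  rw [Matrix.star_mulVec, h.hermitian, ← Matrix.dotProduct_mulVec]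

/-- The matrix i(P − 2G) is hermitian precisely because G + Gᴴ = P, so the boundary form is real. -/
theorem IsCouplingPair.boundary_form_im (h : IsCouplingPair U P G)
    (hU : U ∈ Matrix.unitaryGroup n ℂ) {p q : n → ℂ}
    (hpq : (U - 1).mulVec p + Complex.I • (U + 1).mulVec q = 0) : (star p ⬝ᵥ q).im = 0 := by
  have h1 : (Complex.I • (P - 2 • G)).IsHermitian := by
    change (Complex.I • (P - 2 • G)).conjTranspose = _
    rw [Matrix.conjTranspose_smul, Matrix.conjTranspose_sub, Matrix.conjTranspose_smul, h.hermitian,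
      ← h.inv_add_conjTranspose hU]
    simp only [Complex.star_def, Complex.conj_I, star_trivial, neg_smul, ← smul_neg]
    congr 1
    simp only [two_smul]
    abel
  rw [h.boundary_form_eq hpq]
  exact h1.im_star_dotProduct_mulVec_self p

theorem exists_norm_sesquilinear_le (D : Matrix n n ℂ) :
    ∃ C : ℝ, 0 ≤ C ∧ ∀ p : n → ℂ, ‖star p ⬝ᵥ D.mulVec p‖ ≤ C * ∑ i, ‖p i‖ ^ 2 := by
  refine ⟨∑ i, ∑ j, ‖D i j‖, by positivity, fun p => ?_⟩
  have h1 : ∀ i j, ‖p i‖ * ‖p j‖ ≤ ∑ i, ‖p i‖ ^ 2 := by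
    intro i j
    have h2 := Finset.single_le_sum (f := fun i => ‖p i‖ ^ 2) (fun k _ => by positivity)
      (Finset.mem_univ i)
    have h3 := Finset.single_le_sum (f := fun i => ‖p i‖ ^ 2) (fun k _ => by positivity)
      (Finset.mem_univ j)
    nlinarith [sq_nonneg (‖p i‖ - ‖p j‖)]
  have h2 : star p ⬝ᵥ D.mulVec p = ∑ i, ∑ j, star (p i) * (D i j * p j) := by
    simp only [dotProduct, Matrix.mulVec, Finset.mul_sum, Pi.star_apply]
  rw [h2, Finset.sum_mul]
  refine (norm_sum_le _ _).trans (Finset.sum_le_sum fun i _ => (norm_sum_le _ _).trans ?_)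
  rw [Finset.sum_mul]
  refine Finset.sum_le_sum fun j _ => ?_
  rw [norm_mul, norm_mul, norm_star]
  calc ‖p i‖ * (‖D i j‖ * ‖p j‖) = ‖D i j‖ * (‖p i‖ * ‖p j‖) := by ring
    _ ≤ _ := mul_le_mul_of_nonneg_left (h1 i j) (norm_nonneg _)

end BoundaryForm

/-! ### Energy identity and trace inequality on one edge. -/

section EdgeEnergy

/-- The square of the `L²` norm on an edge. -/
def edgeNormSq (u : EdgeC) : ℝ := ∫ x in (0 : ℝ)..1, ‖edgeExt u x‖ ^ 2

theorem edgeNormSq_nonneg (u : EdgeC) : 0 ≤ edgeNormSq u :=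
  intervalIntegral.integral_nonneg zero_le_one fun _ _ => by positivity

theorem edgeNormSq_pos {u : EdgeC} (hu : u ≠ 0) : 0 < edgeNormSq u := by
  have h : ∃ x, u x ≠ 0 := by
    by_contra! h
    exact hu (EdgeC.ext h)
  obtain ⟨x, hx⟩ := h
  refine intervalIntegral.integral_pos zero_lt_one
    ((continuous_edgeExt u).norm.pow 2).continuousOn (fun _ _ => by positivity) ⟨x, x.2, ?_⟩
  rw [edgeExt_of_mem u x.2]
  exact pow_pos (norm_pos_iff.2 hx) 2

variable {u v w : EdgeC} {c d : ℂ}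

theorem hasDerivAt_primitive (c : ℂ) (v : EdgeC) (x : ℝ) :
    HasDerivAt (fun x : ℝ => c + ∫ t in (0 : ℝ)..x, edgeExt v t) (edgeExt v x) x :=
  (hasDerivAt_integral_edgeExt v x).const_add c

theorem edgeExt_eq_primitive (hu : u = c • 1 + edgeInt v) {x : ℝ} (hx : x ∈ Set.Icc (0 : ℝ) 1) :
    edgeExt u x = c + ∫ t in (0 : ℝ)..x, edgeExt v t := by
  rw [edgeExt_of_mem u hx, hu]
  simp [edgeInt_apply]

/-- Integration of (v ū)' = w ū + |v|², where v = u' and w = u''. -/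
theorem edge_energy_identity (hu : u = c • 1 + edgeInt v) (hv : v = d • 1 + edgeInt w) :
    ∫ x in (0 : ℝ)..1, edgeExt w x * star (edgeExt u x)
      = v edgeOne * star (u edgeOne) - d * star c - (edgeNormSq v : ℂ) := by
  have h1 : ∀ x ∈ Set.uIcc (0 : ℝ) 1, HasDerivAt
      (fun x : ℝ => (d + ∫ t in (0 : ℝ)..x, edgeExt w t) * star (c + ∫ t in (0 : ℝ)..x, edgeExt v t))
      (edgeExt w x * star (edgeExt u x) + ((‖edgeExt v x‖ ^ 2 : ℝ) : ℂ)) x := by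
    intro x hx
    rw [Set.uIcc_of_le zero_le_one] at hx
    refine ((hasDerivAt_primitive d w x).mul ((hasDerivAt_primitive c v x).star)).congr_deriv ?_
    rw [← edgeExt_eq_primitive hu hx, ← edgeExt_eq_primitive hv hx, ← Complex.normSq_eq_norm_sq,
      Complex.normSq_eq_conj_mul_self]
    simp only [Complex.star_def]
    ring
  have hc1 : Continuous fun x => edgeExt w x * star (edgeExt u x) :=
    (continuous_edgeExt w).mul (continuous_edgeExt u).star
  have hc2 : Continuous fun x => ((‖edgeExt v x‖ ^ 2 : ℝ) : ℂ) :=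
    Complex.continuous_ofReal.comp ((continuous_edgeExt v).norm.pow 2)
  have h2 := intervalIntegral.integral_eq_sub_of_hasDerivAt h1
    ((hc1.add hc2).intervalIntegrable _ _)
  rw [intervalIntegral.integral_add (hc1.intervalIntegrable _ _) (hc2.intervalIntegrable _ _),
    intervalIntegral.integral_ofReal] at h2
  have e1 : u edgeOne = c + ∫ t in (0 : ℝ)..1, edgeExt v t := by rw [hu]; simp [edgeInt_apply]
  have e2 : v edgeOne = d + ∫ t in (0 : ℝ)..1, edgeExt w t := by
    conv_lhs => rw [hv]
    simp [edgeInt_apply]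
  rw [e1, e2, edgeNormSq]
  simp only [intervalIntegral.integral_same, add_zero] at h2
  linear_combination h2

/-- The derivative of (x − r)|u|² is integrated over the edge; r = 0 isolates the value at 1 and r =
1 the value at 0. A small δ makes the boundary values absorbable in the norm of the derivative. -/
theorem edge_trace_inequality (hu : u = c • 1 + edgeInt v) {δ : ℝ} (hδ : 0 < δ) :
    ‖u edgeOne‖ ^ 2 ≤ (1 + δ⁻¹) * edgeNormSq u + δ * edgeNormSq v ∧
      ‖c‖ ^ 2 ≤ (1 + δ⁻¹) * edgeNormSq u + δ * edgeNormSq v := by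
  have key : ∀ r : ℝ, r ∈ Set.Icc (0 : ℝ) 1 → (1 - r) * ‖u edgeOne‖ ^ 2 + r * ‖c‖ ^ 2
      ≤ (1 + δ⁻¹) * edgeNormSq u + δ * edgeNormSq v := by
    intro r hr
    have h1 : ∀ x ∈ Set.uIcc (0 : ℝ) 1, HasDerivAt
        (fun x : ℝ => (x - r) * ‖c + ∫ t in (0 : ℝ)..x, edgeExt v t‖ ^ 2)
        (‖edgeExt u x‖ ^ 2 + (x - r) * (2 * inner ℝ (edgeExt u x) (edgeExt v x))) x := by
      intro x hx
      rw [Set.uIcc_of_le zero_le_one] at hx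
      refine (((hasDerivAt_id x).sub_const r).mul (hasDerivAt_primitive c v x).norm_sq).congr_deriv
        ?_
      rw [← edgeExt_eq_primitive hu hx]
      simp
    have hc1 : Continuous fun x => ‖edgeExt u x‖ ^ 2 := (continuous_edgeExt u).norm.pow 2
    have hc3 : Continuous fun x => ‖edgeExt v x‖ ^ 2 := (continuous_edgeExt v).norm.pow 2
    have hc2 : Continuous fun x => ‖edgeExt u x‖ ^ 2
        + (x - r) * (2 * inner ℝ (edgeExt u x) (edgeExt v x)) :=
      hc1.add ((continuous_id.sub continuous_const).mul (continuous_const.mul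
        ((continuous_edgeExt u).inner (continuous_edgeExt v))))
    have h2 := intervalIntegral.integral_eq_sub_of_hasDerivAt h1 (hc2.intervalIntegrable _ _)
    have e1 : u edgeOne = c + ∫ t in (0 : ℝ)..1, edgeExt v t := by rw [hu]; simp [edgeInt_apply]
    rw [← e1] at h2
    simp only [intervalIntegral.integral_same, add_zero] at h2
    have h3 : (1 - r) * ‖u edgeOne‖ ^ 2 + r * ‖c‖ ^ 2 = ∫ x in (0 : ℝ)..1, (‖edgeExt u x‖ ^ 2
        + (x - r) * (2 * inner ℝ (edgeExt u x) (edgeExt v x))) := by rw [h2]; ring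
    have h4 : (1 + δ⁻¹) * edgeNormSq u + δ * edgeNormSq v
        = ∫ x in (0 : ℝ)..1, ((1 + δ⁻¹) * ‖edgeExt u x‖ ^ 2 + δ * ‖edgeExt v x‖ ^ 2) := by
      rw [intervalIntegral.integral_add ((hc1.intervalIntegrable _ _).const_mul _)
        ((hc3.intervalIntegrable _ _).const_mul _), intervalIntegral.integral_const_mul,
        intervalIntegral.integral_const_mul]
      rfl
    rw [h3, h4]
    refine intervalIntegral.integral_mono_on zero_le_one (hc2.intervalIntegrable _ _)
      (((hc1.const_mul _).add (hc3.const_mul _)).intervalIntegrable _ _) fun x hx => ?_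
    have h5 : |x - r| ≤ 1 := by rw [abs_le]; constructor <;> linarith [hx.1, hx.2, hr.1, hr.2]
    have h6 := abs_real_inner_le_norm (edgeExt u x) (edgeExt v x)
    have h7 : (x - r) * (2 * inner ℝ (edgeExt u x) (edgeExt v x))
        ≤ 2 * (‖edgeExt u x‖ * ‖edgeExt v x‖) := by
      refine (le_abs_self _).trans ?_
      rw [abs_mul, abs_mul, abs_two]
      calc |x - r| * (2 * |inner ℝ (edgeExt u x) (edgeExt v x)|)
          ≤ 1 * (2 * (‖edgeExt u x‖ * ‖edgeExt v x‖)) := by gcongr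
        _ = _ := one_mul _
    have h8 : 2 * (‖edgeExt u x‖ * ‖edgeExt v x‖)
        ≤ δ⁻¹ * ‖edgeExt u x‖ ^ 2 + δ * ‖edgeExt v x‖ ^ 2 := by
      have : δ⁻¹ * ‖edgeExt u x‖ ^ 2 + δ * ‖edgeExt v x‖ ^ 2 - 2 * (‖edgeExt u x‖ * ‖edgeExt v x‖)
          = δ⁻¹ * (‖edgeExt u x‖ - δ * ‖edgeExt v x‖) ^ 2 := by
        field_simp
        ring
      have h9 : 0 ≤ δ⁻¹ * (‖edgeExt u x‖ - δ * ‖edgeExt v x‖) ^ 2 := by positivity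
      linarith
    linarith
  constructor
  · simpa using key 0 (by simp)
  · simpa using key 1 (by simp)

/-- The quadratic form of a real multiplication operator. -/
def edgeForm (α u : EdgeC) : ℝ := ∫ x in (0 : ℝ)..1, (edgeExt α x).re * ‖edgeExt u x‖ ^ 2

theorem abs_edgeForm_le (α u : EdgeC) : |edgeForm α u| ≤ ‖α‖ * edgeNormSq u := by
  have hc1 : Continuous fun x => ‖edgeExt u x‖ ^ 2 := (continuous_edgeExt u).norm.pow 2
  rw [edgeForm, edgeNormSq, ← intervalIntegral.integral_const_mul, ← Real.norm_eq_abs]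
  refine intervalIntegral.norm_integral_le_of_norm_le zero_le_one
    (Eventually.of_forall fun x _ => ?_) ((hc1.const_mul _).intervalIntegrable _ _)
  rw [norm_mul, Real.norm_eq_abs, norm_pow, norm_norm]
  gcongr
  exact (Complex.abs_re_le_norm _).trans (norm_edgeExt_le α x)

theorem integral_edgeCoeff_form {α β : EdgeC} {a b : ℝ → ℝ}
    (hα : ∀ x ∈ Set.Icc (0 : ℝ) 1, edgeExt α x = a x)
    (hβ : ∀ x ∈ Set.Icc (0 : ℝ) 1, edgeExt β x = b x) (z : ℂ) (u : EdgeC) :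
    ∫ x in (0 : ℝ)..1, edgeExt (edgeCoeff α β z * u) x * star (edgeExt u x)
      = z * z * (edgeNormSq u : ℂ) + 2 * z * (edgeForm α u : ℂ) - (edgeForm β u : ℂ) := by
  have hc1 : Continuous fun x => ((‖edgeExt u x‖ ^ 2 : ℝ) : ℂ) :=
    Complex.continuous_ofReal.comp ((continuous_edgeExt u).norm.pow 2)
  have hc2 : ∀ α : EdgeC,
      Continuous fun x => (((edgeExt α x).re * ‖edgeExt u x‖ ^ 2 : ℝ) : ℂ) := fun α =>
    Complex.continuous_ofReal.comp ((Complex.continuous_re.comp (continuous_edgeExt α)).mul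
      ((continuous_edgeExt u).norm.pow 2))
  have i1 := (hc1.intervalIntegrable (μ := volume) 0 1).const_mul (z * z)
  have i2 := ((hc2 α).intervalIntegrable (μ := volume) 0 1).const_mul (2 * z)
  have i3 := (hc2 β).intervalIntegrable (μ := volume) 0 1
  rw [edgeNormSq, edgeForm, edgeForm, ← intervalIntegral.integral_ofReal,
    ← intervalIntegral.integral_ofReal, ← intervalIntegral.integral_ofReal,
    ← intervalIntegral.integral_const_mul, ← intervalIntegral.integral_const_mul,
    ← intervalIntegral.integral_add i1 i2, ← intervalIntegral.integral_sub (i1.add i2) i3]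
  refine intervalIntegral.integral_congr fun x hx => ?_
  rw [Set.uIcc_of_le zero_le_one] at hx
  have h1 : edgeExt (edgeCoeff α β z) x = z * z + 2 * z * edgeExt α x - edgeExt β x := by
    simp only [edgeExt_of_mem _ hx, edgeCoeff, EdgeC.add_apply, EdgeC.sub_apply,
        EdgeC.smul_apply, EdgeC.one_apply]
    ring
  simp only [Complex.ofReal_mul]
  rw [edgeExt_mul, h1, hα x hx, hβ x hx, Complex.ofReal_re, Complex.ofReal_re,
    ← Complex.normSq_eq_norm_sq, Complex.normSq_eq_conj_mul_self]
  simp only [Complex.star_def]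
  ring

end EdgeEnergy

/-! ### All zeros of the secular determinant lie in a vertical strip. -/

section StripBound

/-- For nonreal z the imaginary part of the equation gives Re z = −A/X. For real z the equation
gives z² ≤ 2M|z| + C, which bounds |z| as well. -/
theorem abs_re_le_of_quadratic {z : ℂ} {X A γ M C : ℝ} (hX : 0 < X) (hM : 0 ≤ M) (hC : 0 ≤ C)
    (hA : |A| ≤ M * X) (hγ : -(C * X) ≤ γ)
    (h : z * z * (X : ℂ) + 2 * z * (A : ℂ) + (γ : ℂ) = 0) : |z.re| ≤ 2 * M + C + 1 := by
  have hre := congrArg Complex.re h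
  have him := congrArg Complex.im h
  simp at hre him
  by_cases hy : z.im = 0
  · rw [hy] at hre
    by_contra! hlt
    have h1 : 2 * z.re * A ≥ -(2 * |z.re| * (M * X)) := by
      have h2 : |2 * z.re * A| ≤ 2 * |z.re| * (M * X) := by
        rw [abs_mul, abs_mul, abs_two]
        gcongr
      linarith [neg_abs_le (2 * z.re * A)]
    have h3 : z.re * z.re = |z.re| * |z.re| := (abs_mul_abs_self _).symm
    have h4 : 1 ≤ |z.re| := by linarith
    have h5 : |z.re| * |z.re| * X ≤ 2 * |z.re| * (M * X) + C * X := by nlinarith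
    have h6 : |z.re| * |z.re| ≤ 2 * |z.re| * M + C := by
      have : |z.re| * |z.re| * X ≤ (2 * |z.re| * M + C) * X := by linarith
      exact le_of_mul_le_mul_right this hX
    nlinarith
  · have h1 : z.re * X + A = 0 := by
      have : 2 * z.im * (z.re * X + A) = 0 := by linarith
      rcases mul_eq_zero.1 this with h2 | h2
      · exact absurd (by linarith) hy
      · exact h2
    have h2 : |z.re| * X ≤ M * X := by
      rw [← abs_of_pos hX, ← abs_mul, abs_of_pos hX, eq_neg_of_add_eq_zero_left h1, abs_neg]
      exact hA
    have h3 := le_of_mul_le_mul_right h2 hX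
    linarith

variable {N : ℕ} {U : Matrix (Fin N × Fin 2) (Fin N × Fin 2) ℂ}

/-- The solution with initial values `c` on each edge. -/
def edgeSol (α β : Fin N → EdgeC) (z : ℂ) (c : Fin N × Fin 2 → ℂ) (e : Fin N) : EdgeC :=
  c (e, 0) • fundSol (α e) (β e) 0 z + c (e, 1) • fundSol (α e) (β e) 1 z

/-- The derivative of the solution with initial values `c` on each edge. -/
def edgeSolDeriv (α β : Fin N → EdgeC) (z : ℂ) (c : Fin N × Fin 2 → ℂ) (e : Fin N) : EdgeC :=
  c (e, 0) • fundSolDeriv (α e) (β e) 0 z + c (e, 1) • fundSolDeriv (α e) (β e) 1 z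

theorem edgeSol_eq (α β : Fin N → EdgeC) (z : ℂ) (c : Fin N × Fin 2 → ℂ) (e : Fin N) :
    edgeSol α β z c e = c (e, 0) • 1 + edgeInt (edgeSolDeriv α β z c e) := by
  rw [edgeSol, edgeSolDeriv, fundSol_eq, fundSol_eq (α e) (β e) 1, map_add, map_smul, map_smul]
  simp [add_assoc]

theorem edgeSolDeriv_eq (α β : Fin N → EdgeC) (z : ℂ) (c : Fin N × Fin 2 → ℂ) (e : Fin N) :
    edgeSolDeriv α β z c e
      = c (e, 1) • 1 + edgeInt (edgeCoeff (α e) (β e) z * edgeSol α β z c e) := by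
  rw [edgeSol, edgeSolDeriv, fundSolDeriv, fundSolDeriv, mul_add, map_add, mul_smul_comm,
    mul_smul_comm, map_smul, map_smul]
  simp only [zero_ne_one, if_false, if_true, zero_add, smul_add]
  abel

theorem valueMatrix_mulVec (α β : Fin N → EdgeC) (z : ℂ) (c : Fin N × Fin 2 → ℂ)
    (p : Fin N × Fin 2) : ((valueMatrix α β).map (evalHom z)).mulVec c p
      = if p.2 = 0 then c (p.1, 0) else edgeSol α β z c p.1 edgeOne := by
  obtain ⟨e, s⟩ := p
  rw [Matrix.mulVec, dotProduct, Fintype.sum_prod_type, Finset.sum_eq_single e]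
  · rw [Fin.sum_univ_two]
    simp only [Matrix.map_apply, valueMatrix, if_true, evalHom_apply]
    fin_cases s
    · simp
    · simp [endValue, edgeSol, evalOne_apply]; ring
  · intro e'' _ he
    simp [valueMatrix, he.symm]
  · simp

theorem derivMatrix_mulVec (α β : Fin N → EdgeC) (z : ℂ) (c : Fin N × Fin 2 → ℂ)
    (p : Fin N × Fin 2) : ((derivMatrix α β).map (evalHom z)).mulVec c p
      = if p.2 = 0 then c (p.1, 1) else -edgeSolDeriv α β z c p.1 edgeOne := by
  obtain ⟨e, s⟩ := p
  rw [Matrix.mulVec, dotProduct, Fintype.sum_prod_type, Finset.sum_eq_single e]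
  · rw [Fin.sum_univ_two]
    simp only [Matrix.map_apply, derivMatrix, if_true, evalHom_apply]
    fin_cases s
    · simp
    · simp [endDeriv, edgeSolDeriv, evalOne_apply]; ring
  · intro e'' _ he
    simp [derivMatrix, he.symm]
  · simp

theorem edgeSol_ne_zero (α β : Fin N → EdgeC) (z : ℂ) {c : Fin N × Fin 2 → ℂ} (hc : c ≠ 0) :
    ∃ e, edgeSol α β z c e ≠ 0 := by
  by_contra! h
  apply hc
  funext ⟨e, s⟩
  have e0 := edgeSol_eq α β z c e
  have e1 := edgeSolDeriv_eq α β z c e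
  rw [h e] at e0
  have g0 := eq_zero_of_zero_eq_smul_one_add e0
  rw [g0, zero_smul, zero_add] at e0
  rw [edgeInt_injective e0.symm] at e1
  have g1 := eq_zero_of_zero_eq_smul_one_add e1
  fin_cases s
  · exact g0
  · exact g1

/-- Pairing the equation with its solution gives a quadratic equation for z with real coefficients:
the norm X, the damping form A, and a constant made of the derivative norm V, the potential B and
the boundary form s. Since |s| is at most V plus a multiple of X, the constant term is bounded below
by a multiple of X. -/
theorem exists_strip_bound (hU : U ∈ Matrix.unitaryGroup (Fin N × Fin 2) ℂ) {α β : Fin N → EdgeC}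
    {a b : Fin N → ℝ → ℝ}
    (hα : ∀ e, ∀ x ∈ Set.Icc (0 : ℝ) 1, edgeExt (α e) x = a e x)
    (hβ : ∀ e, ∀ x ∈ Set.Icc (0 : ℝ) 1, edgeExt (β e) x = b e x) :
    ∃ K : ℝ, ∀ z, secularDet U α β z = 0 → |z.re| ≤ K := by
  obtain ⟨P, G, h⟩ := exists_isCouplingPair hU
  obtain ⟨C₀, hC₀, hform⟩ := exists_norm_sesquilinear_le (Complex.I • (P - 2 • G))
  set M : ℝ := ‖α‖ + ‖β‖ with hM
  have hM0 : 0 ≤ M := by positivity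
  have hαM : ∀ e, ‖α e‖ ≤ M := fun e =>
    (norm_le_pi_norm α e).trans (le_add_of_nonneg_right (norm_nonneg _))
  have hβM : ∀ e, ‖β e‖ ≤ M := fun e =>
    (norm_le_pi_norm β e).trans (le_add_of_nonneg_left (norm_nonneg _))
  -- Chosen so that `2 * C₀ * δ ≤ 1`: the derivative part of the trace inequality, counted at both
  -- ends of each edge, then costs at most one full copy of V.
  set δ : ℝ := (2 * (C₀ + 1))⁻¹ with hδ
  have hδ0 : 0 < δ := by positivity
  set C₁ : ℝ := M + C₀ * (2 * (1 + δ⁻¹)) with hC₁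
  refine ⟨2 * M + C₁ + 1, fun z hz => ?_⟩
  rw [secularDet_apply] at hz
  obtain ⟨c, hc, hcz⟩ := Matrix.exists_mulVec_eq_zero_iff.2 hz
  set p := ((valueMatrix α β).map (evalHom z)).mulVec c with hp
  set q := ((derivMatrix α β).map (evalHom z)).mulVec c with hq
  have hpq : (U - 1).mulVec p + Complex.I • (U + 1).mulVec q = 0 := by
    rw [Matrix.add_mulVec, ← Matrix.mulVec_mulVec, ← Matrix.mulVec_mulVec,
      Matrix.smul_mulVec] at hcz
    exact hcz
  set u := edgeSol α β z c with hu
  set v := edgeSolDeriv α β z c with hv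
  obtain ⟨s, hs⟩ : ∃ s : ℝ, star p ⬝ᵥ q = s :=
    ⟨(star p ⬝ᵥ q).re, Complex.ext (by simp) (by simp [h.boundary_form_im hU hpq])⟩
  have hsum : star p ⬝ᵥ q = ∑ e, (star (c (e, 0)) * c (e, 1)
      + star (u e edgeOne) * -(v e edgeOne)) := by
    rw [dotProduct, Fintype.sum_prod_type]
    refine Finset.sum_congr rfl fun e _ => ?_
    rw [Fin.sum_univ_two]
    simp [hp, hq, valueMatrix_mulVec, derivMatrix_mulVec, hu, hv]
  have hnorm : ∑ i, ‖p i‖ ^ 2 = ∑ e, (‖c (e, 0)‖ ^ 2 + ‖u e edgeOne‖ ^ 2) := by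
    rw [Fintype.sum_prod_type]
    refine Finset.sum_congr rfl fun e _ => ?_
    rw [Fin.sum_univ_two]
    simp [hp, valueMatrix_mulVec, hu]
  set X : ℝ := ∑ e, edgeNormSq (u e) with hX
  set V : ℝ := ∑ e, edgeNormSq (v e) with hV
  set A : ℝ := ∑ e, edgeForm (α e) (u e) with hA
  set B : ℝ := ∑ e, edgeForm (β e) (u e) with hB
  have hV0 : 0 ≤ V := Finset.sum_nonneg fun e _ => edgeNormSq_nonneg _
  have hX0 : 0 < X := by
    obtain ⟨e, he⟩ := edgeSol_ne_zero α β z hc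
    exact Finset.sum_pos' (fun e _ => edgeNormSq_nonneg _) ⟨e, Finset.mem_univ e, edgeNormSq_pos he⟩
  have habs : ∀ γ : Fin N → EdgeC, (∀ e, ‖γ e‖ ≤ M) →
      |∑ e, edgeForm (γ e) (u e)| ≤ M * X := by
    intro γ hγ
    rw [hX, Finset.mul_sum]
    refine (Finset.abs_sum_le_sum_abs _ _).trans (Finset.sum_le_sum fun e _ => ?_)
    exact (abs_edgeForm_le _ _).trans
      (mul_le_mul_of_nonneg_right (hγ e) (edgeNormSq_nonneg _))
  have henergy : z * z * (X : ℂ) + 2 * z * (A : ℂ) + ((V - B + s : ℝ) : ℂ) = 0 := by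
    have h1 : ∀ e, z * z * (edgeNormSq (u e) : ℂ) + 2 * z * (edgeForm (α e) (u e) : ℂ)
        - (edgeForm (β e) (u e) : ℂ) = v e edgeOne * star (u e edgeOne)
          - c (e, 1) * star (c (e, 0)) - (edgeNormSq (v e) : ℂ) := by
      intro e
      rw [← integral_edgeCoeff_form (hα e) (hβ e) z (u e)]
      exact edge_energy_identity (edgeSol_eq α β z c e) (edgeSolDeriv_eq α β z c e)
    have h2 := Finset.sum_congr (rfl : (Finset.univ : Finset (Fin N)) = _) fun e _ => h1 e
    push_cast
    rw [← hs, hsum, hX, hV, hA, hB]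
    push_cast
    simp only [Finset.sum_add_distrib, Finset.sum_sub_distrib, ← Finset.mul_sum] at h2 ⊢
    have e1 : ∑ e, star (u e edgeOne) * -v e edgeOne = -∑ e, v e edgeOne * star (u e edgeOne) := by
      rw [← Finset.sum_neg_distrib]
      exact Finset.sum_congr rfl fun e _ => by ring
    have e2 : ∑ e, star (c (e, 0)) * c (e, 1) = ∑ e, c (e, 1) * star (c (e, 0)) :=
      Finset.sum_congr rfl fun e _ => by ring
    rw [e1, e2]
    linear_combination h2
  have hs' : |s| ≤ C₀ * (2 * (1 + δ⁻¹)) * X + V := by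
    have h1 := hform p
    rw [← h.boundary_form_eq hpq, hs, Complex.norm_real, Real.norm_eq_abs, hnorm] at h1
    have h2 : ∑ e, (‖c (e, 0)‖ ^ 2 + ‖u e edgeOne‖ ^ 2) ≤ 2 * ((1 + δ⁻¹) * X + δ * V) := by
      rw [hX, hV, Finset.mul_sum, Finset.mul_sum, ← Finset.sum_add_distrib, Finset.mul_sum]
      refine Finset.sum_le_sum fun e _ => ?_
      have := edge_trace_inequality (edgeSol_eq α β z c e) hδ0
      linarith [this.1, this.2]
    have h3 : C₀ * (2 * δ) ≤ 1 := by
      rw [hδ, mul_inv, ← mul_assoc 2, mul_inv_cancel₀ two_ne_zero, one_mul, ← div_eq_mul_inv,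
        div_le_one (by linarith)]
      linarith
    have h4 := mul_le_mul_of_nonneg_right h3 hV0
    have h5 := mul_le_mul_of_nonneg_left h2 hC₀
    linarith
  refine abs_re_le_of_quadratic hX0 hM0 (by positivity) (habs α hαM) ?_ henergy
  have hB' := (abs_le.1 (habs β hβM)).2
  have := (abs_le.1 hs').1
  rw [hC₁]
  linarith

end StripBound

/-! ### The periodic limit function and its zeros. -/

section LimitFunction

open Complex

/-- The function `∏ (1 - τ exp z)`. -/
def limitFun (S : Multiset ℂ) (z : ℂ) : ℂ := (S.map fun τ => 1 - τ * exp z).prod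

theorem limitFun_cons (τ : ℂ) (S : Multiset ℂ) :
    limitFun (τ ::ₘ S) = (fun z => 1 - τ * exp z) * limitFun S := by
  funext z
  simp [limitFun]

theorem differentiable_limitFun (S : Multiset ℂ) : Differentiable ℂ (limitFun S) := by
  induction S using Multiset.induction_on with
  | empty =>
    have : limitFun 0 = fun _ => 1 := by funext z; simp [limitFun]
    rw [this]
    fun_prop
  | cons τ S ih =>
    rw [limitFun_cons]
    exact Differentiable.mul (by fun_prop) ih

/-- Up to the factor e^(nz), with n the size of T, the left side is the characteristic polynomial of
T at e^(−z), which splits into linear factors. -/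
theorem det_one_sub_exp_smul {n : Type*} [Fintype n] [DecidableEq n] (T : Matrix n n ℂ) (z : ℂ) :
    (1 - exp z • T).det = limitFun T.charpoly.roots z := by
  have h0 := exp_ne_zero z
  have h1 : 1 - exp z • T = exp z • (Matrix.scalar n (exp z)⁻¹ - T) := by
    rw [smul_sub, Matrix.scalar_apply, ← Matrix.smul_one_eq_diagonal, smul_smul, mul_inv_cancel₀ h0,
      one_smul]
  have hsplit := IsAlgClosed.splits T.charpoly
  have hcard : Fintype.card n = Multiset.card T.charpoly.roots := by
    rw [← hsplit.natDegree_eq_card_roots, Matrix.charpoly_natDegree_eq_dim]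
  rw [h1, Matrix.det_smul, ← Matrix.eval_charpoly,
    hsplit.eval_eq_prod_roots_of_monic T.charpoly_monic, hcard, limitFun]
  induction T.charpoly.roots using Multiset.induction_on with
  | empty => simp
  | cons τ S ih =>
    simp only [Multiset.card_cons, Multiset.map_cons, Multiset.prod_cons, pow_succ]
    rw [← ih]
    have : 1 - τ * exp z = exp z * ((exp z)⁻¹ - τ) := by field_simp
    rw [this]
    ring

theorem limitFun_periodic (S : Multiset ℂ) (z : ℂ) (n : ℤ) :
    limitFun S (z + n * (2 * Real.pi * I)) = limitFun S z := by
  simp only [limitFun, exp_add, exp_int_mul_two_pi_mul_I, mul_one]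

theorem limitFun_eq_zero_iff (S : Multiset ℂ) (z : ℂ) : limitFun S z = 0 ↔ exp (-z) ∈ S := by
  rw [limitFun, Multiset.prod_eq_zero_iff, Multiset.mem_map]
  constructor
  · rintro ⟨τ, hτ, h⟩
    have : τ = exp (-z) := by
      rw [exp_neg]
      exact eq_inv_of_mul_eq_one_left (sub_eq_zero.1 h).symm
    rwa [← this]
  · intro h
    exact ⟨_, h, by rw [← exp_add]; simp⟩

theorem analyticOrderAt_one_sub_mul_exp (τ z : ℂ) :
    analyticOrderAt (fun z => 1 - τ * exp z) z = if τ = exp (-z) then 1 else 0 := by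
  have han : AnalyticAt ℂ (fun z => 1 - τ * exp z) z := by fun_prop
  split_ifs with h
  · have h1 : τ * exp z = 1 := by rw [h, ← exp_add]; simp
    refine han.analyticOrderAt_eq_one_of_zero_deriv_ne_zero (by rw [h1, sub_self]) ?_
    have : HasDerivAt (fun z => 1 - τ * exp z) (-(τ * exp z)) z :=
      ((hasDerivAt_exp z).const_mul τ).const_sub 1
    rw [this.deriv, h1]
    norm_num
  · rw [han.analyticOrderAt_eq_zero, sub_ne_zero]
    intro h1
    apply h
    rw [exp_neg]
    exact eq_inv_of_mul_eq_one_left h1.symm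

/-- Each factor 1 − τe^z has only simple zeros, so the order at z just counts how often e^(−z)
occurs among the τ. -/
theorem analyticOrderAt_limitFun (S : Multiset ℂ) (z : ℂ) :
    analyticOrderAt (limitFun S) z = S.count (exp (-z)) := by
  induction S using Multiset.induction_on with
  | empty =>
    rw [(differentiable_limitFun 0).analyticAt z |>.analyticOrderAt_eq_zero.2 (by simp [limitFun])]
    simp
  | cons τ S ih =>
    rw [limitFun_cons, analyticOrderAt_mul (by fun_prop) ((differentiable_limitFun S).analyticAt z),
      ih, analyticOrderAt_one_sub_mul_exp, Multiset.count_cons]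
    simp only [eq_comm (a := τ)]
    split_ifs
    · push_cast; ring
    · simp

theorem analyticOrderNatAt_limitFun (S : Multiset ℂ) (z : ℂ) :
    analyticOrderNatAt (limitFun S) z = S.count (exp (-z)) := by
  rw [analyticOrderNatAt, analyticOrderAt_limitFun, ENat.toNat_natCast]

/-- The branch of the logarithm with imaginary part in `[s, s + 2π)`. -/
def logFrom (s : ℝ) (w : ℂ) : ℂ := ⟨Real.log ‖w‖, toIcoMod Real.two_pi_pos s (arg w)⟩

theorem exp_logFrom (s : ℝ) {w : ℂ} (hw : w ≠ 0) : exp (logFrom s w) = w := by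
  have h : logFrom s w
      = log w + (-toIcoDiv Real.two_pi_pos s (arg w) : ℤ) * (2 * Real.pi * I) := by
    apply Complex.ext
    · simp [logFrom, log_re]
    · have h1 := self_sub_toIcoDiv_zsmul Real.two_pi_pos s (arg w)
      rw [zsmul_eq_mul] at h1
      simp [logFrom, log_im]
      linarith
  rw [h, exp_add, exp_int_mul_two_pi_mul_I, mul_one, exp_log hw]

theorem logFrom_im_mem (s : ℝ) (w : ℂ) : (logFrom s w).im ∈ Set.Ico s (s + 2 * Real.pi) :=
  toIcoMod_mem_Ico _ _ _

theorem logFrom_eq {s : ℝ} {z : ℂ} (hz : z.im ∈ Set.Ico s (s + 2 * Real.pi)) :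
    logFrom s (exp z) = z := by
  have h1 := exp_logFrom s (exp_ne_zero z)
  obtain ⟨n, hn⟩ := exp_eq_exp_iff_exists_int.1 h1
  have h2 := congrArg Complex.im hn
  simp at h2
  have h3 := logFrom_im_mem s (exp z)
  have hn0 : n = 0 := by
    have hpi := Real.two_pi_pos
    have h4 : ((n : ℝ)) * (2 * Real.pi) < 1 * (2 * Real.pi) := by linarith [h3.2, hz.1]
    have h5 : (-1 : ℝ) * (2 * Real.pi) < n * (2 * Real.pi) := by linarith [h3.1, hz.2]
    have h6 := lt_of_mul_lt_mul_right h4 hpi.le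
    have h7 := lt_of_mul_lt_mul_right h5 hpi.le
    have h8 : n < 1 := by exact_mod_cast h6
    have h9 : -1 < n := by exact_mod_cast h7
    omega
  rw [hn, hn0]
  simp

/-- The abscissa which belongs to an eigenvalue of the limit matrix. -/
def rootAbscissa (τ : ℂ) : ℝ := -Real.log ‖τ‖

theorem re_eq_rootAbscissa (z : ℂ) : z.re = rootAbscissa (exp (-z)) := by
  rw [rootAbscissa, norm_exp, Real.log_exp, neg_re, neg_neg]

/-- A zero with imaginary part in (−π, π) has imaginary part −arg τ, so only finitely many heights
must be avoided. The horizontal edges of the period boxes can then be kept free of zeros of the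
limit. -/
theorem exists_generic_shift (S : Multiset ℂ) :
    ∃ s ∈ Set.Ioo (-Real.pi) Real.pi, ∀ z, limitFun S z = 0 → z.im ≠ s := by
  classical
  set A : Finset ℝ := S.toFinset.image fun τ => -arg τ with hA
  obtain ⟨s, hs, hsA⟩ := ((Set.Ioo_infinite (show -Real.pi < Real.pi by
    linarith [Real.pi_pos])).sdiff A.finite_toSet).nonempty
  refine ⟨s, hs, fun z hz him => hsA ?_⟩
  rw [limitFun_eq_zero_iff] at hz
  refine Finset.mem_coe.2 (Finset.mem_image.2 ⟨_, Multiset.mem_toFinset.2 hz, ?_⟩)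
  have h1 : arg (exp (-z)) = -s := by
    rw [← log_im, log_exp, neg_im, him]
    · rw [neg_im, him]; linarith [hs.2]
    · rw [neg_im, him]; linarith [hs.1]
  rw [h1, neg_neg]

end LimitFunction

/-! ### Number of zeros in high period boxes. -/

section BoxCount

open Complex Metric

/-- Integers of large absolute value. -/
def intLarge : Filter ℤ := comap (fun n : ℤ => |(n : ℝ)|) atTop

instance : intLarge.IsCountablyGenerated := by unfold intLarge; infer_instance

theorem tendsto_intLarge : Tendsto (fun n : ℤ => |(n : ℝ)|) intLarge atTop := tendsto_comap

/-- The translate by `2 π i n`. -/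
def periodShift (n : ℤ) (z : ℂ) : ℂ := z + n * (2 * Real.pi * I)

theorem periodShift_re (n : ℤ) (z : ℂ) : (periodShift n z).re = z.re := by simp [periodShift]

theorem periodShift_im (n : ℤ) (z : ℂ) : (periodShift n z).im = z.im + n * (2 * Real.pi) := by
  simp [periodShift]

theorem periodShift_injective (n : ℤ) : Function.Injective (periodShift n) :=
  fun _ _ h => add_right_cancel h

/-- The part of one period strip over `I`. -/
def box (s : ℝ) (I : Set ℝ) (n : ℤ) : Set ℂ :=
  {z | z.re ∈ I ∧ s + n * (2 * Real.pi) ≤ z.im ∧ z.im < s + (n + 1) * (2 * Real.pi)}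

theorem image_periodShift_box (s : ℝ) (I : Set ℝ) (n : ℤ) :
    periodShift n '' box s I 0 = box s I n := by
  ext z
  constructor
  · rintro ⟨w, ⟨h1, h2, h3⟩, rfl⟩
    refine ⟨by rwa [periodShift_re], ?_, ?_⟩ <;> rw [periodShift_im]
    · push_cast at h2; linarith
    · push_cast at h3; linarith
  · rintro ⟨h1, h2, h3⟩
    refine ⟨periodShift (-n) z, ⟨by rwa [periodShift_re], ?_, ?_⟩, ?_⟩
    · rw [periodShift_im]; push_cast; linarith
    · rw [periodShift_im]; push_cast; linarith
    · simp [periodShift]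

theorem eventually_im_periodShift (R ρ : ℝ) :
    ∀ᶠ n in intLarge, ∀ z : ℂ, ‖z‖ ≤ ρ → R ≤ |(periodShift n z).im| := by
  filter_upwards [tendsto_intLarge.eventually_ge_atTop (R + ρ)] with n hn z hz
  rw [periodShift_im]
  have h1 : |z.im| ≤ ρ := (abs_im_le_norm z).trans hz
  have h2 : |(n : ℝ)| ≤ |n * (2 * Real.pi)| := by
    rw [abs_mul, abs_of_pos Real.two_pi_pos]
    exact le_mul_of_one_le_right (abs_nonneg _) (by linarith [Real.pi_gt_three])
  have h3 : |n * (2 * Real.pi)| ≤ |z.im + n * (2 * Real.pi)| + |z.im| := by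
    have := abs_sub (z.im + n * (2 * Real.pi)) z.im
    rwa [add_sub_cancel_left] at this
  linarith

variable {D f : ℂ → ℂ} {S : Multiset ℂ}

/-- Periodicity converts closeness to `limitFun` far up or down the strip into uniform convergence
of the translates on a fixed disc, the setting of Hurwitz's theorem. -/
theorem tendstoUniformlyOn_periodShift
    (hlim : ∀ K, AsympEq (stripFilter K) f (limitFun S)) (ρ : ℝ) :
    TendstoUniformlyOn (fun n : ℤ => f ∘ periodShift n) (limitFun S) intLarge (closedBall 0 ρ) := by
  rw [Metric.tendstoUniformlyOn_iff]
  intro ε hε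
  have h1 := (Metric.tendsto_nhds.1 (hlim ρ).tendsto ε hε)
  rw [stripFilter, eventually_inf_principal, eventually_comap] at h1
  obtain ⟨R, hR⟩ := eventually_atTop.1 h1
  filter_upwards [eventually_im_periodShift R ρ] with n hn z hz
  rw [mem_closedBall_zero_iff] at hz
  have h2 := hR _ (hn z hz) _ rfl (by
    rw [Set.mem_ofPred_eq, periodShift_re]
    exact (abs_re_le_norm z).trans hz)
  rw [dist_zero_right] at h2
  rw [dist_comm, dist_eq_norm, Function.comp_apply, ← limitFun_periodic S z n]
  exact h2

theorem finsum_mem_eq_sum_of_cover {ι : Type*} {h : ℂ → ℕ} {A : Set ℂ} (J : Finset ι)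
    {B : ι → Set ℂ} (hB : ∀ i ∈ J, B i ⊆ A) (hfin : (A ∩ Function.support h).Finite)
    (hdisj : (J : Set ι).PairwiseDisjoint B)
    (hcov : ∀ z ∈ A, h z ≠ 0 → ∃ i ∈ J, z ∈ B i) :
    ∑ᶠ z ∈ A, h z = ∑ i ∈ J, ∑ᶠ z ∈ B i, h z := by
  have h1 : ∀ i ∈ J, (B i ∩ Function.support h).Finite := fun i hi =>
    hfin.subset (Set.inter_subset_inter_left _ (hB i hi))
  have h2 : A ∩ Function.support h = ⋃ i ∈ (J : Set ι), (B i ∩ Function.support h) := by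
    ext z
    simp only [Set.mem_inter_iff, Function.mem_support, Set.mem_iUnion, Finset.mem_coe]
    constructor
    · rintro ⟨hz, hz'⟩
      obtain ⟨i, hi, hzi⟩ := hcov z hz hz'
      exact ⟨i, hi, hzi, hz'⟩
    · rintro ⟨i, hi, hzi, hz'⟩
      exact ⟨hB i hi hzi, hz'⟩
  rw [← finsum_mem_inter_support, h2, finsum_mem_biUnion
    (hdisj.mono fun i => Set.inter_subset_left) J.finite_toSet h1, finsum_mem_coe_finset]
  exact Finset.sum_congr rfl fun i _ => finsum_mem_inter_support h (B i)

/-- The zeros of the limit function in one period strip. -/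
def limitZeros (s : ℝ) (S : Multiset ℂ) : Finset ℂ :=
  S.toFinset.image fun τ => logFrom s τ⁻¹

theorem mem_limitZeros {s : ℝ} (h0 : (0 : ℂ) ∉ S) (z : ℂ) :
    z ∈ limitZeros s S ↔ limitFun S z = 0 ∧ z.im ∈ Set.Ico s (s + 2 * Real.pi) := by
  rw [limitZeros, Finset.mem_image]
  constructor
  · rintro ⟨τ, hτ, rfl⟩
    rw [Multiset.mem_toFinset] at hτ
    have hτ0 : τ ≠ 0 := fun h => h0 (h ▸ hτ)
    refine ⟨?_, logFrom_im_mem _ _⟩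
    rw [limitFun_eq_zero_iff, exp_neg, exp_logFrom s (inv_ne_zero hτ0), inv_inv]
    exact hτ
  · rintro ⟨h1, h2⟩
    rw [limitFun_eq_zero_iff] at h1
    refine ⟨exp (-z), Multiset.mem_toFinset.2 h1, ?_⟩
    rw [exp_neg, inv_inv, logFrom_eq h2]

open Classical in
/-- The number of eigenvalues of the limit matrix with abscissa in `I`. -/
def abscissaCount (S : Multiset ℂ) (I : Set ℝ) : ℕ :=
  Multiset.card (S.filter fun τ => rootAbscissa τ ∈ I)

open Classical in
theorem sum_count_limitZeros {s : ℝ} (h0 : (0 : ℂ) ∉ S) (I : Set ℝ) :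
    ∑ z ∈ (limitZeros s S).filter (fun z => z.re ∈ I), S.count (exp (-z)) = abscissaCount S I := by
  have hne : ∀ τ ∈ S.toFinset, τ ≠ 0 := fun τ hτ h => h0 (h ▸ Multiset.mem_toFinset.1 hτ)
  have hexp : ∀ τ ∈ S.toFinset, exp (-logFrom s τ⁻¹) = τ := fun τ hτ => by
    rw [exp_neg, exp_logFrom s (inv_ne_zero (hne τ hτ)), inv_inv]
  rw [abscissaCount, ← Multiset.toFinset_sum_count_eq, Finset.sum_filter, limitZeros,
    Finset.sum_image]
  · rw [Multiset.toFinset_filter, Finset.sum_filter]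
    refine Finset.sum_congr rfl fun τ hτ => ?_
    rw [re_eq_rootAbscissa, hexp τ hτ]
    split_ifs with h
    · exact (Multiset.count_filter_of_pos (p := fun τ => rootAbscissa τ ∈ I) h).symm
    · rfl
  · intro τ hτ τ' hτ' h
    rw [← hexp τ hτ, ← hexp τ' hτ']
    exact congrArg (fun z => exp (-z)) h

theorem exists_separating_radius (Z : Finset ℂ) {O : ℂ → Set ℂ} (hO : ∀ ζ ∈ Z, O ζ ∈ 𝓝 ζ) :
    ∃ δ > 0, (∀ ζ ∈ Z, closedBall ζ δ ⊆ O ζ) ∧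
      ∀ ζ ∈ Z, ∀ ζ' ∈ Z, ζ ≠ ζ' → δ + δ < dist ζ ζ' := by
  have h1 : ∀ᶠ δ in 𝓝 (0 : ℝ), ∀ ζ ∈ Z, closedBall ζ δ ⊆ O ζ :=
    (Finset.eventually_all Z).2 fun ζ hζ => eventually_closedBall_subset (hO ζ hζ)
  have h2 : ∀ᶠ δ in 𝓝 (0 : ℝ), ∀ ζ ∈ Z, ∀ ζ' ∈ Z, ζ ≠ ζ' → δ + δ < dist ζ ζ' := by
    refine (Finset.eventually_all Z).2 fun ζ hζ => (Finset.eventually_all Z).2 fun ζ' hζ' => ?_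
    by_cases h : ζ = ζ'
    · simp [h]
    · have hc : Tendsto (fun δ : ℝ => δ + δ) (𝓝 0) (𝓝 (0 + 0)) := tendsto_id.add tendsto_id
      rw [add_zero] at hc
      filter_upwards [hc.eventually_lt_const (dist_pos.2 h)] with δ hδ _
      exact hδ
  obtain ⟨δ, ⟨h3, h4⟩, h5⟩ :=
    (((h1.and h2).filter_mono nhdsWithin_le_nhds).and (self_mem_nhdsWithin (s := Set.Ioi (0 : ℝ)))).exists
  exact ⟨δ, h5, h3, h4⟩

theorem eventually_mem_iff_of_notMem_frontier {I : Set ℝ} {ζ : ℂ} (h : ζ.re ∉ frontier I) :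
    {z : ℂ | z.re ∈ I ↔ ζ.re ∈ I} ∈ 𝓝 ζ := by
  have hc : Tendsto Complex.re (𝓝 ζ) (𝓝 ζ.re) := continuous_re.continuousAt
  by_cases hI : ζ.re ∈ I
  · have h1 : ζ.re ∈ interior I := by
      by_contra h2
      exact h ⟨subset_closure hI, h2⟩
    filter_upwards [hc.eventually (mem_interior_iff_mem_nhds.1 h1)] with z hz
    exact ⟨fun _ => hI, fun _ => hz⟩
  · have h1 : ζ.re ∈ (closure I)ᶜ := fun h2 => h ⟨h2, fun h3 => hI (interior_subset h3)⟩
    filter_upwards [hc.eventually (isClosed_closure.isOpen_compl.mem_nhds h1)] with z hz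
    exact ⟨fun h3 => absurd (subset_closure h3) hz, fun h3 => absurd h3 hI⟩

/-- Around each zero of the limit in one period, a small disc is placed that stays inside the open
period and on one side of the frontier of `I`. Hurwitz's theorem counts the zeros in the discs. On
the rest of the compact rectangle the limit is bounded away from zero, so no further zeros occur
there, and the strip bound excludes zeros outside the rectangle even for unbounded `I`. -/
theorem eventually_box_count (h0 : (0 : ℂ) ∉ S)
    (hf : ∀ z ≠ 0, AnalyticAt ℂ f z) (hD : Differentiable ℂ D)
    (hord : ∀ z ≠ 0, analyticOrderAt f z = analyticOrderAt D z)
    (hlim : ∀ K, AsympEq (stripFilter K) f (limitFun S)) {K : ℝ}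
    (hK : ∀ z, D z = 0 → |z.re| ≤ K)
    (hfin : ∀ R : ℝ, {z | analyticOrderNatAt D z ≠ 0 ∧ |z.im| < R}.Finite)
    {s : ℝ} (hs : ∀ z, limitFun S z = 0 → z.im ≠ s) {I : Set ℝ}
    (hI : ∀ τ ∈ S, rootAbscissa τ ∉ frontier I) :
    ∀ᶠ n in intLarge, ∑ᶠ z ∈ box s I n, analyticOrderNatAt D z = abscissaCount S I := by
  classical
  have hpi := Real.two_pi_pos
  set Z := limitZeros s S with hZ
  have hZim : ∀ ζ ∈ Z, ζ.im ∈ Set.Ioo s (s + 2 * Real.pi) := by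
    intro ζ hζ
    obtain ⟨h1, h2⟩ := (mem_limitZeros h0 ζ).1 hζ
    exact ⟨lt_of_le_of_ne h2.1 (hs ζ h1).symm, h2.2⟩
  set O : ℂ → Set ℂ := fun ζ => {z | z.im ∈ Set.Ioo s (s + 2 * Real.pi)}
    ∩ {z | z.re ∈ I ↔ ζ.re ∈ I} with hO
  obtain ⟨δ, hδ, hδO, hδd⟩ := exists_separating_radius Z (O := O) fun ζ hζ => by
    refine inter_mem (continuous_im.continuousAt (isOpen_Ioo.mem_nhds (hZim ζ hζ)))
      (eventually_mem_iff_of_notMem_frontier ?_)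
    rw [re_eq_rootAbscissa]
    exact hI _ ((limitFun_eq_zero_iff S ζ).1 ((mem_limitZeros h0 ζ).1 hζ).1)
  have hball : ∀ ζ ∈ Z, ∀ z ∈ closedBall ζ δ, limitFun S z = 0 → z = ζ := by
    intro ζ hζ z hz hz0
    have hzZ : z ∈ Z := (mem_limitZeros h0 z).2 ⟨hz0, Set.Ioo_subset_Ico_self (hδO ζ hζ hz).1⟩
    by_contra hne
    have := hδd z hzZ ζ hζ hne
    rw [mem_closedBall] at hz
    linarith
  -- the compact set without zeros
  set rect : Set ℂ := {z | |z.re| ≤ K ∧ z.im ∈ Set.Icc s (s + 2 * Real.pi)} with hrect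
  set C : Set ℂ := rect \ ⋃ ζ ∈ Z, ball ζ δ with hC
  have hrect_bdd : ∃ ρ, 0 < ρ ∧ rect ⊆ closedBall 0 ρ ∧ ∀ ζ ∈ Z, closedBall ζ δ ⊆ ball 0 ρ := by
    set ρ₀ := |K| + (|s| + 2 * Real.pi) with hρ₀
    have h1 : rect ⊆ closedBall 0 ρ₀ := by
      rintro z ⟨h1, h2, h3⟩
      rw [mem_closedBall_zero_iff]
      refine (norm_le_abs_re_add_abs_im z).trans (add_le_add (h1.trans (le_abs_self K)) ?_)
      rw [abs_le]
      constructor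
      · linarith [neg_abs_le s]
      · linarith [le_abs_self s]
    have h2 : ∃ ρ₁, ∀ ζ ∈ Z, ‖ζ‖ ≤ ρ₁ := by
      obtain ⟨ρ₁, h⟩ := (Z.finite_toSet.isBounded (α := ℂ)).exists_norm_le
      exact ⟨ρ₁, fun ζ hζ => h ζ hζ⟩
    obtain ⟨ρ₁, hρ₁⟩ := h2
    refine ⟨ρ₀ + |ρ₁| + δ + 1, by positivity, h1.trans (closedBall_subset_closedBall ?_),
      fun ζ hζ z hz => ?_⟩
    · linarith [abs_nonneg ρ₁]
    · rw [mem_closedBall, dist_eq_norm] at hz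
      rw [mem_ball_zero_iff]
      have h3 : ‖z‖ ≤ ‖z - ζ‖ + ‖ζ‖ := by simpa using norm_add_le (z - ζ) ζ
      have h4 := hρ₁ ζ hζ
      have h5 : 0 ≤ ρ₀ := by positivity
      linarith [le_abs_self ρ₁]
  obtain ⟨ρ, hρ, hrectρ, hballρ⟩ := hrect_bdd
  have hunif := tendstoUniformlyOn_periodShift hlim ρ
  have hCcompact : IsCompact C := by
    refine (isCompact_closedBall (0 : ℂ) ρ).of_isClosed_subset ?_ (Set.sdiff_subset.trans hrectρ)
    refine IsClosed.sdiff ?_ (isOpen_biUnion fun ζ _ => isOpen_ball)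
    exact (isClosed_le (continuous_abs.comp continuous_re) continuous_const).inter
      (isClosed_Icc.preimage continuous_im)
  have hCne : ∀ z ∈ C, limitFun S z ≠ 0 := by
    rintro z ⟨⟨h1, h2, h3⟩, h4⟩ hz
    -- The compact rectangle includes its top edge, which does not belong to the half-open period; a
    -- zero there would by periodicity give one at height `s`.
    have h5 : z.im ≠ s + 2 * Real.pi := by
      intro h6
      have h7 := hs (z + (-1 : ℤ) * (2 * Real.pi * Complex.I)) (by rw [limitFun_periodic, hz])
      apply h7
      simp [h6]
    have hzZ : z ∈ Z := (mem_limitZeros h0 z).2 ⟨hz, h2, lt_of_le_of_ne h3 h5⟩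
    exact h4 (Set.mem_biUnion hzZ (mem_ball_self hδ))
  have hCev : ∀ᶠ n in intLarge, ∀ z ∈ C, f (periodShift n z) ≠ 0 := by
    rcases C.eq_empty_or_nonempty with hCe | hCn
    · simp [hCe]
    obtain ⟨z₀, hz₀, hmin⟩ := hCcompact.exists_isMinOn hCn
      (f := fun z => ‖limitFun S z‖) (differentiable_limitFun S).continuous.norm.continuousOn
    have hpos : 0 < ‖limitFun S z₀‖ := norm_pos_iff.2 (hCne z₀ hz₀)
    filter_upwards [Metric.tendstoUniformlyOn_iff.1 hunif _ hpos] with n hn z hz hz0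
    have h1 := hn z (hrectρ hz.1)
    rw [Function.comp_apply, hz0, dist_zero_right] at h1
    exact absurd (hmin hz) (not_le.2 h1)
  have hneq : ∀ᶠ n in intLarge, ∀ z : ℂ, ‖z‖ ≤ ρ → periodShift n z ≠ 0 := by
    filter_upwards [eventually_im_periodShift 1 ρ] with n hn z hz h
    have := hn z hz
    rw [h] at this
    simp at this
    linarith
  have hhur : ∀ᶠ n in intLarge, ∀ ζ ∈ Z, ∑ᶠ z ∈ ball ζ δ, analyticOrderNatAt (f ∘ periodShift n) z
      = ∑ᶠ z ∈ ball ζ δ, analyticOrderNatAt (limitFun S) z := by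
    refine (Finset.eventually_all Z).2 fun ζ hζ => ?_
    refine eventually_sum_order_eq hδ (isOpen_ball (x := (0 : ℂ)) (ε := ρ)) (hballρ ζ hζ) ?_
      (differentiable_limitFun S).differentiableOn
      (hunif.mono ball_subset_closedBall).tendstoLocallyUniformlyOn fun z hz hz0 => ?_
    · filter_upwards [hneq] with n hn z hz
      have h1 := (hf _ (hn z (mem_ball_zero_iff.1 hz).le)).differentiableAt
      refine (h1.comp z ?_).differentiableWithinAt
      unfold periodShift
      fun_prop
    · have := hball ζ hζ z (sphere_subset_closedBall hz) hz0
      rw [this, mem_sphere, dist_self] at hz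
      exact hδ.ne hz
  filter_upwards [hhur, hneq, hCev, tendsto_intLarge.eventually_ge_atTop 0] with n hn1 hn2 hn3 _
  set h : ℂ → ℕ := fun w => analyticOrderNatAt D (periodShift n w) with hh
  have hcomp : ∀ w, ‖w‖ ≤ ρ → analyticOrderNatAt (f ∘ periodShift n) w = h w := by
    intro w hw
    have hd : HasDerivAt (periodShift n) 1 w := (hasDerivAt_id w).add_const _
    have ha : AnalyticAt ℂ (periodShift n) w := by unfold periodShift; fun_prop
    change (analyticOrderAt _ w).toNat = (analyticOrderAt D (periodShift n w)).toNat
    rw [analyticOrderAt_comp_of_deriv_ne_zero ha (by rw [hd.deriv]; exact one_ne_zero),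
      hord _ (hn2 w hw)]
  have hzero : ∀ w, h w ≠ 0 → D (periodShift n w) = 0 := by
    intro w hw
    by_contra hne
    apply hw
    change (analyticOrderAt D (periodShift n w)).toNat = 0
    rw [((hD.analyticAt (periodShift n w)).analyticOrderAt_eq_zero).2 hne, ENat.toNat_zero]
  rw [← image_periodShift_box, finsum_mem_image ((periodShift_injective n).injOn)]
  change ∑ᶠ w ∈ box s I 0, h w = _
  rw [finsum_mem_eq_sum_of_cover (Z.filter fun ζ => ζ.re ∈ I) (B := fun ζ => ball ζ δ)]
  · rw [← sum_count_limitZeros (s := s) h0]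
    refine Finset.sum_congr rfl fun ζ hζ => ?_
    have hζZ : ζ ∈ Z := (Finset.mem_filter.1 hζ).1
    rw [← analyticOrderNatAt_limitFun]
    have h1 : ∑ᶠ w ∈ ball ζ δ, h w = ∑ᶠ w ∈ ball ζ δ, analyticOrderNatAt (f ∘ periodShift n) w :=
      finsum_mem_congr rfl fun w hw =>
        (hcomp w (mem_ball_zero_iff.1 (hballρ ζ hζZ (ball_subset_closedBall hw))).le).symm
    rw [h1, hn1 ζ hζZ]
    -- The centre is the only zero of the limit in its disc, so the sum of orders is the order at
    -- the centre.
    rw [finsum_mem_inter_support_eq' (t := {ζ}), finsum_mem_singleton]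
    intro w hw
    constructor
    · intro hwb
      refine hball ζ hζZ w (ball_subset_closedBall hwb) ?_
      by_contra hne
      apply hw
      rw [analyticOrderNatAt, (((differentiable_limitFun S).analyticAt w).analyticOrderAt_eq_zero).2
        hne, ENat.toNat_zero]
    · rintro rfl
      exact mem_ball_self hδ
  · intro ζ hζ z hz
    obtain ⟨hζZ, hζI⟩ := Finset.mem_filter.1 hζ
    have h1 := hδO ζ hζZ (ball_subset_closedBall hz)
    refine ⟨h1.2.2 hζI, ?_, ?_⟩
    · simpa using h1.1.1.le
    · simpa using h1.1.2
  · refine Set.Finite.of_finite_image ((hfin (|s| + (|(n : ℝ)| + 1) * (2 * Real.pi))).subset ?_)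
      (periodShift_injective n).injOn
    rintro _ ⟨w, ⟨hw, hw'⟩, rfl⟩
    refine ⟨hw', ?_⟩
    rw [periodShift_im]
    have h1 : s ≤ w.im := by simpa using hw.2.1
    have h2 : w.im < s + 2 * Real.pi := by simpa using hw.2.2
    have h3 : |(n : ℝ) * (2 * Real.pi)| = |(n : ℝ)| * (2 * Real.pi) := by
      rw [abs_mul, abs_of_pos hpi]
    have h4 := abs_le.1 h3.le
    rw [abs_lt]
    constructor
    · linarith [neg_abs_le s, h4.1]
    · linarith [le_abs_self s, h4.2]
  · intro ζ hζ ζ' hζ' hne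
    have h1 := hδd ζ (Finset.mem_filter.1 hζ).1 ζ' (Finset.mem_filter.1 hζ').1 hne
    exact ball_disjoint_ball h1.le
  · intro w hw hw'
    have hD0 := hzero w hw'
    have h1 : w ∈ rect := by
      refine ⟨by simpa only [periodShift_re] using hK _ hD0, ?_, ?_⟩
      · simpa using hw.2.1
      · have := hw.2.2
        simp at this
        exact this.le
    have hwρ : ‖w‖ ≤ ρ := mem_closedBall_zero_iff.1 (hrectρ h1)
    have hf0 : f (periodShift n w) = 0 := by
      have h2 := hn2 w hwρ
      rw [← (hf _ h2).analyticOrderAt_ne_zero, hord _ h2,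
        (hD.analyticAt _).analyticOrderAt_ne_zero]
      exact hD0
    have h2 : w ∉ C := fun h3 => hn3 w h3 hf0
    have h3 : w ∈ ⋃ ζ ∈ Z, ball ζ δ := by
      by_contra h4
      exact h2 ⟨h1, h4⟩
    obtain ⟨ζ, hζ, hwζ⟩ := Set.mem_iUnion₂.1 h3
    refine ⟨ζ, Finset.mem_filter.2 ⟨hζ, ?_⟩, hwζ⟩
    exact ((hδO ζ hζ (ball_subset_closedBall hwζ)).2).1 hw.1

end BoxCount

/-! ### From box counts to densities and high frequency abscissas. -/

section Counting

theorem finsum_mem_le_of_subset {h : ℂ → ℕ} {A B : Set ℂ} (hAB : A ⊆ B)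
    (hB : (B ∩ Function.support h).Finite) : ∑ᶠ z ∈ A, h z ≤ ∑ᶠ z ∈ B, h z := by
  have hA : (A ∩ Function.support h).Finite := hB.subset (Set.inter_subset_inter_left _ hAB)
  rw [← finsum_mem_inter_support h A, ← finsum_mem_inter_support h B,
    finsum_mem_eq_finite_toFinset_sum _ hA, finsum_mem_eq_finite_toFinset_sum _ hB]
  exact Finset.sum_le_sum_of_subset
    (Set.Finite.toFinset_subset_toFinset.2 (Set.inter_subset_inter_left _ hAB))

/-- A union of `2 M` period boxes. -/
def boxes (s : ℝ) (I : Set ℝ) (M : ℕ) : Set ℂ :=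
  {z | z.re ∈ I ∧ s - M * (2 * Real.pi) ≤ z.im ∧ z.im < s + M * (2 * Real.pi)}

theorem box_disjoint {s : ℝ} {I : Set ℝ} {m n : ℤ} (h : m ≠ n) : Disjoint (box s I m) (box s I n) := by
  rw [Set.disjoint_left]
  rintro z ⟨-, h1, h2⟩ ⟨-, h3, h4⟩
  have hpi := Real.two_pi_pos
  have h5 : (m : ℝ) * (2 * Real.pi) < (n + 1) * (2 * Real.pi) := by linarith
  have h6 : (n : ℝ) * (2 * Real.pi) < (m + 1) * (2 * Real.pi) := by linarith
  have h7 := lt_of_mul_lt_mul_right h5 hpi.le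
  have h8 := lt_of_mul_lt_mul_right h6 hpi.le
  norm_cast at h7 h8
  omega

theorem finsum_boxes {h : ℂ → ℕ} (hfin : ∀ R : ℝ, {z | h z ≠ 0 ∧ |z.im| < R}.Finite) (s : ℝ)
    (I : Set ℝ) (M : ℕ) :
    ∑ᶠ z ∈ boxes s I M, h z = ∑ n ∈ Finset.Ico (-M : ℤ) M, ∑ᶠ z ∈ box s I n, h z := by
  have hpi := Real.two_pi_pos
  refine finsum_mem_eq_sum_of_cover _ ?_ ?_ (fun m _ n _ hmn => box_disjoint hmn) ?_
  · rintro n hn z ⟨h1, h2, h3⟩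
    rw [Finset.mem_Ico] at hn
    have h4 : (-M : ℝ) ≤ n := by exact_mod_cast hn.1
    have h5 : (n : ℝ) + 1 ≤ M := by exact_mod_cast hn.2
    refine ⟨h1, ?_, ?_⟩
    · have := mul_le_mul_of_nonneg_right h4 hpi.le
      linarith
    · have := mul_le_mul_of_nonneg_right h5 hpi.le
      linarith
  · refine (hfin (|s| + M * (2 * Real.pi) + 1)).subset ?_
    rintro z ⟨⟨-, h1, h2⟩, hz⟩
    refine ⟨hz, ?_⟩
    rw [abs_lt]
    constructor
    · linarith [neg_abs_le s]
    · linarith [le_abs_self s]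
  · rintro z ⟨h1, h2, h3⟩ -
    have h4 : ∀ x : ℝ, x * (2 * Real.pi) / (2 * Real.pi) = x := fun x => by field_simp
    refine ⟨⌊(z.im - s) / (2 * Real.pi)⌋, ?_, h1, ?_, ?_⟩
    · rw [Finset.mem_Ico]
      constructor
      · rw [Int.le_floor, le_div_iff₀ hpi]
        push_cast
        linarith
      · rw [Int.floor_lt, div_lt_iff₀ hpi]
        push_cast
        linarith
    · have := Int.floor_le ((z.im - s) / (2 * Real.pi))
      rw [le_div_iff₀ hpi] at this
      linarith
    · have := Int.lt_floor_add_one ((z.im - s) / (2 * Real.pi))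
      rw [div_lt_iff₀ hpi] at this
      linarith

/-- Only finitely many boxes deviate from the limiting count, so the total error is bounded
independently of the number of boxes. -/
theorem exists_sum_bound {b : ℤ → ℕ} {m : ℕ} (hb : ∀ᶠ n in intLarge, b n = m) :
    ∃ C : ℝ, ∀ M : ℕ, |(∑ n ∈ Finset.Ico (-M : ℤ) M, b n : ℕ) - 2 * M * (m : ℝ)| ≤ C := by
  rw [intLarge, eventually_comap] at hb
  obtain ⟨R, hR⟩ := eventually_atTop.1 hb
  obtain ⟨k, hk⟩ := exists_nat_ge R
  refine ⟨∑ n ∈ Finset.Icc (-k : ℤ) k, |(b n : ℝ) - m|, fun M => ?_⟩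
  have h1 : ((∑ n ∈ Finset.Ico (-M : ℤ) M, b n : ℕ) : ℝ) - 2 * M * (m : ℝ)
      = ∑ n ∈ Finset.Ico (-M : ℤ) M, ((b n : ℝ) - m) := by
    rw [Finset.sum_sub_distrib, Finset.sum_const, Int.card_Ico]
    push_cast
    rw [nsmul_eq_mul]
    have : ((M : ℤ) - -(M : ℤ)).toNat = 2 * M := by omega
    rw [this]
    push_cast
    ring
  rw [h1]
  refine (Finset.abs_sum_le_sum_abs _ _).trans ?_
  rw [← Finset.sum_filter_ne_zero]
  refine Finset.sum_le_sum_of_subset_of_nonneg (fun n hn => ?_) fun _ _ _ => abs_nonneg _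
  rw [Finset.mem_filter] at hn
  by_contra hlt
  apply hn.2
  have h2 : R ≤ |(n : ℝ)| := by
    refine hk.trans ?_
    rw [Finset.mem_Icc, ← abs_le, not_le] at hlt
    exact_mod_cast hlt.le
  rw [hR _ h2 n rfl, sub_self, abs_zero]

/-- The band |Im z| < R has height 2R and each box height 2π, which gives about R/π boxes with m
zeros each. -/
theorem tendsto_count_div {h : ℂ → ℕ} (hfin : ∀ R : ℝ, {z | h z ≠ 0 ∧ |z.im| < R}.Finite)
    {s : ℝ} (hs : s ∈ Set.Ioo (-Real.pi) Real.pi) {I : Set ℝ} {m : ℕ}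
    (hbox : ∀ᶠ n in intLarge, ∑ᶠ z ∈ box s I n, h z = m) :
    Tendsto (fun R : ℝ => ((∑ᶠ z ∈ {z : ℂ | z.re ∈ I ∧ |z.im| < R}, h z : ℕ) : ℝ) / R) atTop
      (𝓝 (m / Real.pi)) := by
  have hpi := Real.pi_pos
  have h2pi := Real.two_pi_pos
  obtain ⟨C, hC⟩ := exists_sum_bound hbox
  -- As |s| < π, the band is sandwiched between unions of 2M₂ and 2M₁ boxes with 2πM₂ ≤ R − π and
  -- 2πM₁ ≥ R + π. Rounding keeps 2M₁ and 2M₂ within 3 of R/π, whence the error 3m plus the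
  -- contribution of the irregular boxes.
  have hmain : ∀ R : ℝ, Real.pi ≤ R →
      |((∑ᶠ z ∈ {z : ℂ | z.re ∈ I ∧ |z.im| < R}, h z : ℕ) : ℝ) - m / Real.pi * R| ≤ 3 * m + C := by
    intro R hR
    set E := ∑ᶠ z ∈ {z : ℂ | z.re ∈ I ∧ |z.im| < R}, h z with hE
    have hm0 : (0 : ℝ) ≤ m := Nat.cast_nonneg m
    have hRm : m / Real.pi * R = (R / Real.pi) * m := by ring
    obtain ⟨M₁, hM₁, hM₁'⟩ : ∃ M : ℕ, (R + Real.pi) / (2 * Real.pi) ≤ M ∧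
        (M : ℝ) < (R + Real.pi) / (2 * Real.pi) + 1 :=
      ⟨_, Nat.le_ceil _, Nat.ceil_lt_add_one (div_nonneg (by linarith) h2pi.le)⟩
    obtain ⟨M₂, hM₂, hM₂'⟩ : ∃ M : ℕ, (M : ℝ) ≤ (R - Real.pi) / (2 * Real.pi) ∧
        (R - Real.pi) / (2 * Real.pi) < M + 1 :=
      ⟨_, Nat.floor_le (div_nonneg (by linarith) h2pi.le), Nat.lt_floor_add_one _⟩
    have hup : (E : ℝ) ≤ 2 * M₁ * m + C := by
      have h1 : E ≤ ∑ᶠ z ∈ boxes s I M₁, h z := by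
        refine finsum_mem_le_of_subset ?_ ((hfin (|s| + M₁ * (2 * Real.pi) + 1)).subset ?_)
        · rintro z ⟨hz1, hz2⟩
          rw [abs_lt] at hz2
          rw [div_le_iff₀ h2pi] at hM₁
          exact ⟨hz1, by linarith [hs.2], by linarith [hs.1]⟩
        · rintro z ⟨⟨-, h1, h2⟩, hz⟩
          refine ⟨hz, ?_⟩
          rw [abs_lt]
          constructor
          · linarith [neg_abs_le s]
          · linarith [le_abs_self s]
      rw [finsum_boxes hfin] at h1
      have h2 := (abs_le.1 (hC M₁)).2
      have h3 : (E : ℝ) ≤ ((∑ n ∈ Finset.Ico (-M₁ : ℤ) M₁, ∑ᶠ z ∈ box s I n, h z : ℕ) : ℝ) := by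
        exact_mod_cast h1
      linarith
    have hlow : 2 * M₂ * m - C ≤ (E : ℝ) := by
      have h1 : ∑ᶠ z ∈ boxes s I M₂, h z ≤ E := by
        refine finsum_mem_le_of_subset ?_ ((hfin R).subset ?_)
        · rintro z ⟨hz1, hz2, hz3⟩
          rw [le_div_iff₀ h2pi] at hM₂
          refine ⟨hz1, ?_⟩
          rw [abs_lt]
          constructor
          · linarith [hs.1]
          · linarith [hs.2]
        · rintro z ⟨⟨-, h1⟩, hz⟩
          exact ⟨hz, h1⟩
      rw [finsum_boxes hfin] at h1
      have h2 := (abs_le.1 (hC M₂)).1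
      have h3 : ((∑ n ∈ Finset.Ico (-M₂ : ℤ) M₂, ∑ᶠ z ∈ box s I n, h z : ℕ) : ℝ) ≤ (E : ℝ) := by
        exact_mod_cast h1
      linarith
    have e1 : (R + Real.pi) / (2 * Real.pi) = R / Real.pi / 2 + 1 / 2 := by field_simp
    have e2 : (R - Real.pi) / (2 * Real.pi) = R / Real.pi / 2 - 1 / 2 := by field_simp
    rw [e1] at hM₁'
    rw [e2] at hM₂'
    rw [hRm, abs_le]
    constructor
    · have h1 : (R / Real.pi - 3) * m ≤ 2 * M₂ * m :=
        mul_le_mul_of_nonneg_right (by linarith) hm0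
      linarith
    · have h1 : 2 * M₁ * m ≤ (R / Real.pi + 3) * m :=
        mul_le_mul_of_nonneg_right (by linarith) hm0
      linarith
  rw [tendsto_iff_norm_sub_tendsto_zero]
  refine squeeze_zero_norm' ?_ (tendsto_id.const_div_atTop (3 * m + C))
  filter_upwards [eventually_ge_atTop Real.pi] with R hR
  have hR0 : 0 < R := hpi.trans_le hR
  rw [norm_norm, Real.norm_eq_abs, id, le_div_iff₀ hR0]
  calc _ = |((∑ᶠ z ∈ {z : ℂ | z.re ∈ I ∧ |z.im| < R}, h z : ℕ) : ℝ) / R - m / Real.pi| * |R| := by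
        rw [abs_of_pos hR0]
        rfl
    _ = |((∑ᶠ z ∈ {z : ℂ | z.re ∈ I ∧ |z.im| < R}, h z : ℕ) : ℝ) - m / Real.pi * R| := by
        rw [← abs_mul, sub_mul, div_mul_cancel₀ _ hR0.ne']
    _ ≤ _ := hmain R hR

variable {N : ℕ}

/-- The number of eigenvalues in high period boxes is given by the multiset `S` of eigenvalues of
the limit matrix. -/
structure HasBoxCounts (H : Submodule ℂ (StateSpace N × StateSpace N)) (S : Multiset ℂ) : Prop where
  finite : ∀ R : ℝ, {z : ℂ | IsEigenvalue H z ∧ |z.im| < R}.Finite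
  eigenvalue_iff : ∀ z, IsEigenvalue H z ↔ algMult H z ≠ 0
  box_count : ∃ s ∈ Set.Ioo (-Real.pi) Real.pi, ∀ I : Set ℝ,
    (∀ τ ∈ S, rootAbscissa τ ∉ frontier I) →
    ∀ᶠ n in intLarge, ∑ᶠ z ∈ box s I n, algMult H z = abscissaCount S I

namespace HasBoxCounts

variable {H : Submodule ℂ (StateSpace N × StateSpace N)} {S : Multiset ℂ}

theorem tendsto_eigenCount_div (h : HasBoxCounts H S) {I : Set ℝ}
    (hI : ∀ τ ∈ S, rootAbscissa τ ∉ frontier I) :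
    Tendsto (fun R : ℝ => (eigenCount H I R : ℝ) / R) atTop
      (𝓝 (abscissaCount S I / Real.pi)) := by
  obtain ⟨s, hs, hbox⟩ := h.box_count
  have hfin : ∀ R : ℝ, {z : ℂ | algMult H z ≠ 0 ∧ |z.im| < R}.Finite := by
    simpa only [h.eigenvalue_iff] using h.finite
  refine (tendsto_count_div hfin hs (hbox I hI)).congr fun R => ?_
  have : eigenCount H I R = ∑ᶠ z ∈ {z : ℂ | z.re ∈ I ∧ |z.im| < R}, algMult H z := by
    refine finsum_mem_inter_support_eq' _ _ _ fun z hz => ?_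
    have := (h.eigenvalue_iff z).2 hz
    exact ⟨fun h => h.2, fun h => ⟨this, h⟩⟩
  rw [this]

theorem abscissaCount_univ (S : Multiset ℂ) : abscissaCount S Set.univ = Multiset.card S := by
  simp [abscissaCount]

/-- Both counts grow linearly in R, so μ is the quotient of their densities and the factor π drops
out. -/
theorem muEq (h : HasBoxCounts H S) (hS : 0 < Multiset.card S) {I : Set ℝ}
    (hI : ∀ τ ∈ S, rootAbscissa τ ∉ frontier I) :
    MuEq H I ((abscissaCount S I : ℝ) / (Multiset.card S : ℝ)) := by
  have hpi := Real.pi_pos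
  have h1 := h.tendsto_eigenCount_div hI
  have h2 := h.tendsto_eigenCount_div (I := Set.univ) (by simp)
  rw [abscissaCount_univ] at h2
  have hS' : (0 : ℝ) < Multiset.card S := by exact_mod_cast hS
  have h3 := h1.div h2 (by positivity)
  have e : (abscissaCount S I / Real.pi : ℝ) / (Multiset.card S / Real.pi)
      = (abscissaCount S I : ℝ) / (Multiset.card S : ℝ) := by field_simp
  rw [e] at h3
  refine h3.congr' ?_
  filter_upwards [eventually_gt_atTop (0 : ℝ)] with R hR
  simp only [Pi.div_apply, muR]
  field_simp

theorem frontier_Ioo_subset (x y : ℝ) : frontier (Set.Ioo x y) ⊆ {x, y} := by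
  by_cases h : x < y
  · rw [frontier_Ioo h]
  · simp [Set.Ioo_eq_empty h]

theorem abscissaCount_eq_zero {I : Set ℝ} (h : ∀ τ ∈ S, rootAbscissa τ ∉ I) :
    abscissaCount S I = 0 := by
  classical
  rw [abscissaCount, Multiset.card_eq_zero]
  exact Multiset.filter_eq_nil.2 h

theorem abscissaCount_pos {I : Set ℝ} {τ : ℂ} (hτ : τ ∈ S) (h : rootAbscissa τ ∈ I) :
    0 < abscissaCount S I := by
  classical
  rw [abscissaCount, Multiset.card_pos_iff_exists_mem]
  exact ⟨τ, Multiset.mem_filter.2 ⟨hτ, h⟩⟩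

theorem abscissaCount_congr {I J : Set ℝ} (h : ∀ τ ∈ S, rootAbscissa τ ∈ I ↔ rootAbscissa τ ∈ J) :
    abscissaCount S I = abscissaCount S J := by
  classical
  rw [abscissaCount, abscissaCount]
  exact congrArg _ (Multiset.filter_congr h)

/-- The finite set of abscissas. -/
def abscissas (S : Multiset ℂ) : Finset ℝ := S.toFinset.image rootAbscissa

theorem mem_abscissas {c : ℝ} : c ∈ abscissas S ↔ ∃ τ ∈ S, rootAbscissa τ = c := by
  simp [abscissas]

theorem exists_isolating (S : Multiset ℂ) (c : ℝ) :
    ∃ ε₀ > 0, ∀ c' ∈ abscissas S, c' ≠ c → ε₀ ≤ |c' - c| := by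
  have h : ∀ᶠ ε in 𝓝[>] (0 : ℝ), ∀ c' ∈ abscissas S, c' ≠ c → ε ≤ |c' - c| := by
    refine (Finset.eventually_all _).2 fun c' _ => ?_
    by_cases hc : c' = c
    · simp [hc]
    · have : ∀ᶠ ε in 𝓝 (0 : ℝ), ε ≤ |c' - c| :=
        eventually_le_nhds (abs_pos.2 (sub_ne_zero.2 hc))
      filter_upwards [this.filter_mono nhdsWithin_le_nhds] with ε hε _
      exact hε
  obtain ⟨ε, h1, h2⟩ := (h.and self_mem_nhdsWithin).exists
  exact ⟨ε, h2, h1⟩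

theorem notMem_frontier_Ioo {c ε : ℝ} (hε : 0 < ε)
    (h : ∀ c' ∈ abscissas S, c' ≠ c → ε < |c' - c|) :
    ∀ τ ∈ S, rootAbscissa τ ∉ frontier (Set.Ioo (c - ε) (c + ε)) := by
  intro τ hτ hfr
  have h1 := h _ (mem_abscissas.2 ⟨τ, hτ, rfl⟩)
  rcases frontier_Ioo_subset _ _ hfr with h2 | h2
  · rw [h2] at h1
    have := h1 (by linarith)
    rw [sub_right_comm, sub_self, zero_sub, abs_neg, abs_of_pos hε] at this
    exact lt_irrefl _ this
  · rw [Set.mem_singleton_iff] at h2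
    rw [h2] at h1
    have := h1 (by linarith)
    rw [add_sub_cancel_left, abs_of_pos hε] at this
    exact lt_irrefl _ this

theorem abscissaCount_Ioo {c ε : ℝ} (hε : 0 < ε)
    (h : ∀ c' ∈ abscissas S, c' ≠ c → ε < |c' - c|) :
    abscissaCount S (Set.Ioo (c - ε) (c + ε)) = abscissaCount S {c} := by
  refine abscissaCount_congr fun τ hτ => ?_
  rw [Set.mem_singleton_iff]
  constructor
  · intro h1
    by_contra hne
    have h2 := h _ (mem_abscissas.2 ⟨τ, hτ, rfl⟩) hne
    have h3 : |rootAbscissa τ - c| < ε := by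
      rw [abs_lt]
      constructor
      · linarith [h1.1]
      · linarith [h1.2]
    linarith
  · intro h1
    rw [h1]
    exact ⟨by linarith, by linarith⟩

theorem sum_abscissaCount (S : Multiset ℂ) :
    ∑ c ∈ abscissas S, abscissaCount S {c} = Multiset.card S := by
  classical
  have h1 : ∀ c, abscissaCount S {c} = (S.map rootAbscissa).count c := by
    intro c
    rw [Multiset.count_map, abscissaCount]
    congr 1
    refine Multiset.filter_congr fun τ _ => ?_
    rw [Set.mem_singleton_iff, eq_comm]
  simp only [h1]
  rw [Multiset.sum_count_eq_card, Multiset.card_map]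
  intro c hc
  rw [Multiset.mem_map] at hc
  exact mem_abscissas.2 hc

/-- A small window around `c` containing no other abscissa has positive count in every high box, and
the box index `k` is taken large enough to lie above height R. -/
theorem exists_eigenvalue_of_box (h : HasBoxCounts H S) {c ε : ℝ} (hc : c ∈ abscissas S)
    (hε : 0 < ε) (R : ℝ) : ∃ z, IsEigenvalue H z ∧ |z.re - c| < ε ∧ R < z.im := by
  obtain ⟨ε₀, hε₀, hiso⟩ := exists_isolating S c
  obtain ⟨s, hs, hbox⟩ := h.box_count
  set ε' := min ε (ε₀ / 2) with hε'
  have hε'0 : 0 < ε' := lt_min hε (by linarith)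
  have hiso' : ∀ c' ∈ abscissas S, c' ≠ c → ε' < |c' - c| := fun c' h1 h2 =>
    (min_le_right _ _).trans_lt (by linarith [hiso c' h1 h2])
  obtain ⟨τ, hτ, rfl⟩ := mem_abscissas.1 hc
  have h1 := hbox _ (notMem_frontier_Ioo hε'0 hiso')
  have hpos : 0 < abscissaCount S (Set.Ioo (rootAbscissa τ - ε') (rootAbscissa τ + ε')) :=
    abscissaCount_pos hτ ⟨by linarith, by linarith⟩
  rw [intLarge, eventually_comap] at h1
  obtain ⟨R₁, hR₁⟩ := eventually_atTop.1 h1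
  obtain ⟨k, hk⟩ := exists_nat_ge (max R₁ (|R| + Real.pi + 1))
  have hk1 := hR₁ |((k : ℤ) : ℝ)| (by
    rw [Int.cast_natCast, abs_of_nonneg (Nat.cast_nonneg k)]
    exact (le_max_left _ _).trans hk) k rfl
  have h2 : ∃ z ∈ box s (Set.Ioo (rootAbscissa τ - ε') (rootAbscissa τ + ε')) k, algMult H z ≠ 0 := by
    by_contra! h3
    rw [finsum_mem_congr rfl h3, finsum_mem_zero] at hk1
    omega
  obtain ⟨z, ⟨hz1, hz2, -⟩, hz⟩ := h2
  refine ⟨z, (h.eigenvalue_iff z).2 hz, ?_, ?_⟩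
  · rw [abs_lt]
    have := min_le_left ε (ε₀ / 2)
    constructor
    · linarith [hz1.1]
    · linarith [hz1.2]
  · have h3 : |R| + Real.pi + 1 ≤ k := (le_max_right _ _).trans hk
    push_cast at hz2
    have h4 : (k : ℝ) ≤ k * (2 * Real.pi) :=
      le_mul_of_one_le_right (Nat.cast_nonneg k) (by linarith [Real.pi_gt_three])
    linarith [le_abs_self R, hs.1]

/-- If `c` is not a limit abscissa, a window around it contains no eigenvalue in any high box, so no
sequence can accumulate there. Conversely, shrinking windows with rising boxes provide the sequence.
-/
theorem isHighFreqAbscissa_iff (h : HasBoxCounts H S) (c : ℝ) :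
    IsHighFreqAbscissa H c ↔ c ∈ abscissas S := by
  constructor
  · rintro ⟨z, hz, him, hre⟩
    by_contra hc
    obtain ⟨ε₀, hε₀, hiso⟩ := exists_isolating S c
    obtain ⟨s, hs, hbox⟩ := h.box_count
    have hiso' : ∀ c' ∈ abscissas S, c' ≠ c → ε₀ / 2 < |c' - c| := fun c' h1 h2 => by
      linarith [hiso c' h1 h2]
    have h1 := hbox _ (notMem_frontier_Ioo (half_pos hε₀) hiso')
    rw [abscissaCount_Ioo (half_pos hε₀) hiso', abscissaCount_eq_zero (fun τ hτ h2 =>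
      hc (mem_abscissas.2 ⟨τ, hτ, h2⟩))] at h1
    rw [intLarge, eventually_comap] at h1
    obtain ⟨R₁, hR₁⟩ := eventually_atTop.1 h1
    have him' : Tendsto (fun n => |(z n).im|) atTop atTop := by
      rcases him with h2 | h2
      · exact tendsto_abs_atTop_atTop.comp h2
      · exact tendsto_abs_atBot_atTop.comp h2
    -- The threshold is such that the box containing `z n` must have index at least `R₁` in absolute
    -- value, with room for |s| < π and for rounding to the floor.
    obtain ⟨n, hn1, hn2⟩ := ((him'.eventually_ge_atTop ((|R₁| + 2) * (2 * Real.pi) + Real.pi)).and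
      (hre.eventually (Ioo_mem_nhds (by linarith : c - ε₀ / 2 < c)
        (by linarith : c < c + ε₀ / 2)))).exists
    have hpi := Real.two_pi_pos
    set k := ⌊((z n).im - s) / (2 * Real.pi)⌋ with hk
    have hk1 := Int.floor_le (((z n).im - s) / (2 * Real.pi))
    have hk2 := Int.lt_floor_add_one (((z n).im - s) / (2 * Real.pi))
    rw [le_div_iff₀ hpi, ← hk] at hk1
    rw [div_lt_iff₀ hpi, ← hk] at hk2
    have hmem : z n ∈ box s (Set.Ioo (c - ε₀ / 2) (c + ε₀ / 2)) k :=
      ⟨hn2, by linarith, by linarith⟩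
    have hkR : R₁ ≤ |(k : ℝ)| := by
      by_contra! hlt
      have h3 : |(k : ℝ)| < |R₁| := hlt.trans_le (le_abs_self _)
      have h4 := abs_lt.1 h3
      have h5 : (k : ℝ) * (2 * Real.pi) < |R₁| * (2 * Real.pi) :=
        mul_lt_mul_of_pos_right h4.2 hpi
      have h6 : -|R₁| * (2 * Real.pi) < (k : ℝ) * (2 * Real.pi) :=
        mul_lt_mul_of_pos_right h4.1 hpi
      have h7 : |(z n).im| < (|R₁| + 2) * (2 * Real.pi) + Real.pi := by
        rw [abs_lt]
        constructor
        · linarith [hs.1, hs.2]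
        · linarith [hs.1, hs.2]
      linarith
    have h3 := hR₁ _ hkR k rfl
    have hfin : (box s (Set.Ioo (c - ε₀ / 2) (c + ε₀ / 2)) k ∩
        Function.support (algMult H)).Finite := by
      refine (h.finite (|s| + (|(k : ℝ)| + 1) * (2 * Real.pi))).subset ?_
      rintro w ⟨⟨-, hw1, hw2⟩, hw⟩
      refine ⟨(h.eigenvalue_iff w).2 hw, ?_⟩
      have h4 : |(k : ℝ) * (2 * Real.pi)| = |(k : ℝ)| * (2 * Real.pi) := by
        rw [abs_mul, abs_of_pos hpi]
      have h5 := abs_le.1 h4.le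
      rw [abs_lt]
      constructor
      · linarith [neg_abs_le s, h5.1]
      · linarith [le_abs_self s, h5.2]
    have h4 := finsum_mem_le_of_subset (Set.singleton_subset_iff.2 hmem) hfin
    rw [finsum_mem_singleton, h3] at h4
    exact (h.eigenvalue_iff _).1 (hz n) (Nat.le_zero.1 h4)
  · intro hc
    choose z hz1 hz2 hz3 using fun n : ℕ =>
      h.exists_eigenvalue_of_box hc (Nat.one_div_pos_of_nat (n := n) (α := ℝ)) n
    refine ⟨z, hz1, Or.inl ?_, ?_⟩
    · exact tendsto_atTop_mono (fun n => (hz3 n).le) tendsto_natCast_atTop_atTop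
    · rw [tendsto_iff_norm_sub_tendsto_zero]
      exact squeeze_zero (fun _ => norm_nonneg _) (fun n => (hz2 n).le)
        tendsto_one_div_add_atTop_nhds_zero_nat

end HasBoxCounts

end Counting

/-! ### The limit matrix of the graph and the spectrum of the operator. -/

section Spectrum

variable {N : ℕ} {U P G : Matrix (Fin N × Fin 2) (Fin N × Fin 2) ℂ}

theorem edgeSwap_mul_edgeSwap (w w' : Fin N → ℂ) :
    edgeSwap w * edgeSwap w' = Matrix.diagonal fun p => w p.1 * w' p.1 := by
  ext ⟨e, s⟩ ⟨e', s'⟩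
  rw [Matrix.mul_apply, Fintype.sum_prod_type, Finset.sum_eq_single e]
  · rw [Fin.sum_univ_two, Matrix.diagonal_apply]
    by_cases he : e = e'
    · subst he
      fin_cases s <;> fin_cases s' <;> simp [edgeSwap]
    · simp [edgeSwap, he]
  · intro e'' _ he
    simp [edgeSwap, he.symm]
  · simp

/-- Exchanging the ends twice, with inverse weights the second time, gives the identity. -/
theorem det_edgeSwap_ne_zero {w : Fin N → ℂ} (hw : ∀ e, w e ≠ 0) : (edgeSwap w).det ≠ 0 := by
  intro h
  have h1 := congrArg Matrix.det (edgeSwap_mul_edgeSwap w fun e => (w e)⁻¹)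
  rw [Matrix.det_mul, h, zero_mul, Matrix.det_diagonal] at h1
  refine Finset.prod_ne_zero_iff.2 (fun p _ => ?_) h1.symm
  rw [mul_inv_cancel₀ (hw p.1)]
  exact one_ne_zero

theorem det_limitMatrix_ne_zero (h : IsCouplingPair U P G) (α : Fin N → EdgeC) :
    (limitMatrix P α).det ≠ 0 := by
  rw [limitMatrix, Matrix.det_mul]
  refine mul_ne_zero (fun h1 => ?_) (det_edgeSwap_ne_zero fun e => Complex.exp_ne_zero _)
  have h2 := congrArg Matrix.det h.reflection_sq
  rw [Matrix.det_mul, h1, zero_mul, Matrix.det_one] at h2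
  exact zero_ne_one h2

theorem zero_notMem_roots_charpoly {n : Type*} [Fintype n] [DecidableEq n] {T : Matrix n n ℂ}
    (hT : T.det ≠ 0) : (0 : ℂ) ∉ T.charpoly.roots := by
  intro h
  have h1 := (Polynomial.mem_roots'.1 h).2
  rw [Polynomial.IsRoot.def, Matrix.eval_charpoly, map_zero, zero_sub, Matrix.det_neg] at h1
  exact mul_ne_zero (pow_ne_zero _ (by norm_num)) hT h1

theorem card_roots_charpoly {n : Type*} [Fintype n] [DecidableEq n] (T : Matrix n n ℂ) :
    Multiset.card T.charpoly.roots = Fintype.card n := by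
  rw [← (IsAlgClosed.splits T.charpoly).natDegree_eq_card_roots, Matrix.charpoly_natDegree_eq_dim]

theorem exists_limitFun_ne_zero (S : Multiset ℂ) : ∃ x : ℝ, limitFun S x ≠ 0 := by
  classical
  obtain ⟨x, hx⟩ := Infinite.exists_notMem_finset (S.toFinset.image rootAbscissa)
  refine ⟨x, fun h => hx ?_⟩
  rw [limitFun_eq_zero_iff] at h
  refine Finset.mem_image.2 ⟨_, Multiset.mem_toFinset.2 h, ?_⟩
  rw [← re_eq_rootAbscissa, Complex.ofReal_re]

/-- Otherwise the normalised determinant would vanish identically, while its translates converge to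
the limit function, which is nonzero at some real point. This nonvanishing is what makes all orders,
and hence all multiplicities, finite. -/
theorem secularDet_ne_zero (h : IsCouplingPair U P G) {α β : Fin N → EdgeC} {a : Fin N → ℝ → ℝ}
    (ha : ∀ e, ContDiffOn ℝ 2 (a e) (Set.Icc 0 1))
    (hα : ∀ e, ∀ x ∈ Set.Icc (0 : ℝ) 1, edgeExt (α e) x = a e x) : secularDet U α β ≠ 0 := by
  intro hD
  obtain ⟨x, hx⟩ := exists_limitFun_ne_zero (limitMatrix P α).charpoly.roots
  have hlim : ∀ K, AsympEq (stripFilter K) (reducedDet U P G α β)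
      (limitFun (limitMatrix P α).charpoly.roots) := fun K => by
    have := asympEq_reducedDet (β := β) h ha hα K
    simpa only [det_one_sub_exp_smul] using this
  have hf : reducedDet U P G α β = fun _ => 0 := by
    funext z
    simp [reducedDet, hD]
  have h1 := Metric.tendstoUniformlyOn_iff.1 (tendstoUniformlyOn_periodShift hlim ‖(x : ℂ)‖) _
    (norm_pos_iff.2 hx)
  have hne : intLarge.NeBot := by
    refine comap_neBot fun t ht => ?_
    obtain ⟨R, hR⟩ := mem_atTop_sets.1 ht
    obtain ⟨k, hk⟩ := exists_nat_ge R
    exact ⟨k, hR _ (by rwa [Int.cast_natCast, abs_of_nonneg (Nat.cast_nonneg k)])⟩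
  obtain ⟨n, hn⟩ := h1.exists
  have h2 := hn x (by simp)
  rw [hf, Function.comp_apply, dist_zero_right] at h2
  exact lt_irrefl _ h2

theorem finite_zeros_of_isCompact {D : ℂ → ℂ} (hD : Differentiable ℂ D) (h0 : D ≠ 0) {C : Set ℂ}
    (hC : IsCompact C) : (C ∩ {z | D z = 0}).Finite := by
  by_contra hinf
  obtain ⟨z, -, hz⟩ := Set.Infinite.exists_accPt_of_subset_isCompact hinf hC Set.inter_subset_left
  apply h0
  have han : AnalyticOnNhd ℂ D Set.univ := fun w _ => hD.analyticAt w
  have hfreq : ∃ᶠ w in 𝓝[≠] z, D w = 0 :=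
    (accPt_iff_frequently_nhdsNE.1 hz).mono fun w hw => hw.2
  funext w
  exact han.eqOn_zero_of_preconnected_of_frequently_eq_zero isPreconnected_univ (Set.mem_univ z)
    hfreq (Set.mem_univ w)

theorem isCompact_rectangle (K R : ℝ) : IsCompact {z : ℂ | |z.re| ≤ K ∧ |z.im| ≤ R} := by
  refine (isCompact_closedBall (0 : ℂ) (K + R)).of_isClosed_subset ?_ fun z hz => ?_
  · exact (isClosed_le (continuous_abs.comp Complex.continuous_re) continuous_const).inter
      (isClosed_le (continuous_abs.comp Complex.continuous_im) continuous_const)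
  · rw [mem_closedBall_zero_iff]
    exact (Complex.norm_le_abs_re_add_abs_im z).trans (add_le_add hz.1 hz.2)

theorem hasBoxCounts (hU : U ∈ Matrix.unitaryGroup (Fin N × Fin 2) ℂ) (h : IsCouplingPair U P G)
    {α β : Fin N → EdgeC} {a b : Fin N → ℝ → ℝ}
    (ha : ∀ e, ContDiffOn ℝ 2 (a e) (Set.Icc 0 1))
    (hα : ∀ e, ∀ x ∈ Set.Icc (0 : ℝ) 1, edgeExt (α e) x = a e x)
    (hβ : ∀ e, ∀ x ∈ Set.Icc (0 : ℝ) 1, edgeExt (β e) x = b e x) :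
    HasBoxCounts (waveOp U a b) (limitMatrix P α).charpoly.roots ∧
      ∀ z, FiniteDimensional ℂ (rootSpace (waveOp U a b) z) := by
  have hD0 : secularDet U α β ≠ 0 := secularDet_ne_zero h ha hα
  have hD := differentiable_secularDet U α β
  have hmult := fun z => algMult_eq_order U α β hα hβ hD0 z
  have heig := fun z => isEigenvalue_iff_secularDet U α β hα hβ hD0 z
  have hzero : ∀ z, analyticOrderNatAt (secularDet U α β) z ≠ 0 → secularDet U α β z = 0 := by
    intro z hz
    by_contra hne
    apply hz
    rw [analyticOrderNatAt, (hD.analyticAt z).analyticOrderAt_eq_zero.2 hne, ENat.toNat_zero]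
  obtain ⟨K, hK⟩ := exists_strip_bound hU hα hβ
  have hfin : ∀ R : ℝ, {z | analyticOrderNatAt (secularDet U α β) z ≠ 0 ∧ |z.im| < R}.Finite := by
    intro R
    refine (finite_zeros_of_isCompact hD hD0 (isCompact_rectangle K R)).subset ?_
    rintro z ⟨h1, h2⟩
    exact ⟨⟨hK z (hzero z h1), h2.le⟩, hzero z h1⟩
  refine ⟨⟨fun R => ?_, heig, ?_⟩, fun z => (hmult z).1⟩
  · simpa only [heig, (hmult _).2] using hfin R
  · obtain ⟨s, hs, hs'⟩ := exists_generic_shift (limitMatrix P α).charpoly.roots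
    refine ⟨s, hs, fun I hI => ?_⟩
    have hlim : ∀ K, AsympEq (stripFilter K) (reducedDet U P G α β)
        (limitFun (limitMatrix P α).charpoly.roots) := fun K => by
      have := asympEq_reducedDet (β := β) h ha hα K
      simpa only [det_one_sub_exp_smul] using this
    have := eventually_box_count (zero_notMem_roots_charpoly (det_limitMatrix_ne_zero h α))
      (fun z hz => analyticAt_reducedDet U P G α β hz) hD
      (fun z hz => analyticOrderAt_reducedDet h α β hz) hlim hK hfin hs' hI
    simpa only [(hmult _).2] using this

theorem exists_edgeC {a : Fin N → ℝ → ℝ} (ha : ∀ e, ContinuousOn (a e) (Set.Icc 0 1)) :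
    ∃ α : Fin N → EdgeC, ∀ e, ∀ x ∈ Set.Icc (0 : ℝ) 1, edgeExt (α e) x = a e x := by
  refine ⟨fun e => EdgeC.mk (fun x => (a e x : ℂ))
    (Complex.continuous_ofReal.comp (continuousOn_iff_continuous_domRestrict.1 (ha e))),
    fun e x hx => ?_⟩
  rw [edgeExt_of_mem _ hx]
  rfl

end Spectrum

/-! ### Symmetry of the limit spectrum for bipartite graphs. -/

section Parity

variable {N : ℕ} {V : Type*}

/-- A multiset of nonzero complex numbers which is symmetric under `τ ↦ -τ` has an even number of
elements in each symmetric set. -/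
theorem even_abscissaCount {S : Multiset ℂ} (h0 : (0 : ℂ) ∉ S) (hS : S.map (fun τ => -τ) = S)
    (I : Set ℝ) : Even (abscissaCount S I) := by
  classical
  set A := S.filter fun τ => rootAbscissa τ ∈ I with hA
  have hA0 : ∀ τ ∈ A, τ ≠ 0 := fun τ hτ h => h0 (h ▸ (Multiset.mem_filter.1 hτ).1)
  have hAneg : A.map (fun τ => -τ) = A := by
    conv_rhs => rw [hA, ← hS]
    rw [Multiset.filter_map, hA]
    congr 1
    refine Multiset.filter_congr fun τ _ => ?_
    simp [rootAbscissa]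
  -- An open half plane together with half of its boundary line: it contains exactly one of τ and −τ
  -- whenever τ ≠ 0, and hence half of a symmetric multiset.
  set p : ℂ → Prop := fun τ => 0 < τ.re ∨ (τ.re = 0 ∧ 0 < τ.im) with hp
  have hpneg : ∀ τ ∈ A, (¬ p τ ↔ p (-τ)) := by
    intro τ hτ
    have hne := hA0 τ hτ
    simp only [hp, Complex.neg_re, Complex.neg_im]
    rcases lt_trichotomy τ.re 0 with h1 | h1 | h1
    · simp [h1, h1.not_gt, h1.ne]
    · have him : τ.im ≠ 0 := fun h2 => hne (Complex.ext h1 h2)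
      simp only [h1, lt_irrefl, false_or, true_and, neg_zero, not_lt, Left.neg_pos_iff]
      exact ⟨fun h => lt_of_le_of_ne h him, le_of_lt⟩
    · simp [h1, h1.not_gt, h1.ne']
  have hsplit := Multiset.filter_add_not p A
  have h1 : Multiset.card (A.filter fun τ => ¬ p τ) = Multiset.card (A.filter p) := by
    have h2 : A.filter (fun τ => ¬ p τ) = A.filter (fun τ => p (-τ)) :=
      Multiset.filter_congr hpneg
    have h3 : A.filter p = (A.filter (fun τ => p (-τ))).map fun τ => -τ := by
      conv_lhs => rw [← hAneg]
      rw [Multiset.filter_map]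
      rfl
    rw [h2, h3, Multiset.card_map]
  have h2 : abscissaCount S I = Multiset.card A := by
    rw [abscissaCount, hA]
  rw [h2, ← hsplit, Multiset.card_add, h1]
  exact ⟨_, rfl⟩

/-- The involution `C` makes `T` similar to `-T`, so the two characteristic polynomials agree; the
roots of that of `-T` are the negatives of the roots of that of `T`. -/
theorem roots_charpoly_neg_symm {n : Type*} [Fintype n] [DecidableEq n] {T C : Matrix n n ℂ}
    (hC : C * C = 1) (h : C * T * C = -T) :
    T.charpoly.roots.map (fun τ => -τ) = T.charpoly.roots := by
  have h1 : (-T).charpoly = T.charpoly := by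
    rw [← h, Matrix.charpoly_mul_comm (C * T) C, ← mul_assoc, hC, one_mul]
  have h2 : (-T).charpoly = ((T.charpoly.roots.map fun τ => -τ).map
      fun τ => Polynomial.X - Polynomial.C τ).prod := by
    refine Polynomial.funext fun t => ?_
    have h3 := (IsAlgClosed.splits T.charpoly).eval_eq_prod_roots_of_monic T.charpoly_monic (-t)
    have h4 : Matrix.scalar n t - -T = -(Matrix.scalar n (-t) - T) := by
      rw [map_neg]
      abel
    rw [Matrix.eval_charpoly, h4, Matrix.det_neg, ← Matrix.eval_charpoly, h3,
      Polynomial.eval_multiset_prod, ← card_roots_charpoly T, Multiset.map_map, Multiset.map_map]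
    have h5 : ((-1 : ℂ)) ^ Multiset.card T.charpoly.roots
        = (T.charpoly.roots.map fun _ => (-1 : ℂ)).prod := by
      rw [Multiset.map_const', Multiset.prod_replicate]
    rw [h5, ← Multiset.prod_map_mul]
    congr 1
    refine Multiset.map_congr rfl fun τ _ => ?_
    simp
    ring
  conv_rhs => rw [← h1, h2, Polynomial.roots_multiset_prod_X_sub_C]

/-- For a local coupling of a bipartite graph the eigenvalues of the limit matrix are symmetric. -/
theorem roots_limitMatrix_symm {Γ : EdgeGraph V N} (hΓ : Γ.IsBipartite)
    {U P G : Matrix (Fin N × Fin 2) (Fin N × Fin 2) ℂ} (hloc : Γ.IsLocal U)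
    (h : IsCouplingPair U P G) (α : Fin N → EdgeC) :
    (limitMatrix P α).charpoly.roots.map (fun τ => -τ) = (limitMatrix P α).charpoly.roots := by
  classical
  obtain ⟨col, hcol⟩ := hΓ
  -- The sign of an edge end is the colour of its vertex. It is constant on vertex blocks, so it
  -- commutes with `U` and therefore with `P`; it differs at the two ends of an edge, so it
  -- anticommutes with `edgeSwap`.
  set σ : Fin N × Fin 2 → ℂ := fun p => if col (Γ.vert p) then 1 else -1 with hσ
  set C : Matrix (Fin N × Fin 2) (Fin N × Fin 2) ℂ := Matrix.diagonal σ with hCdef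
  have hCC : C * C = 1 := by
    rw [hCdef, Matrix.diagonal_mul_diagonal, ← Matrix.diagonal_one]
    congr 1
    funext p
    simp only [hσ]
    split_ifs <;> norm_num
  refine roots_charpoly_neg_symm hCC ?_
  have hCU : C * U = U * C := by
    ext p q
    rw [hCdef, Matrix.diagonal_mul, Matrix.mul_diagonal, mul_comm]
    by_cases hpq : Γ.vert p = Γ.vert q
    · simp only [hσ, hpq]
    · rw [hloc p q hpq, zero_mul, zero_mul]
  have hCP := h.commute C hCU
  have hCS : C * (2 • P - 1) = (2 • P - 1) * C := by
    rw [mul_sub, sub_mul, mul_smul_comm, smul_mul_assoc, hCP, mul_one, one_mul]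
  have hCJ : ∀ w : Fin N → ℂ, C * edgeSwap w * C = -edgeSwap w := by
    intro w
    ext ⟨e, s⟩ ⟨e', s'⟩
    rw [hCdef, Matrix.mul_diagonal, Matrix.diagonal_mul, Matrix.neg_apply]
    by_cases he : e = e'
    · subst he
      have h1 := hcol e
      by_cases hs : s = s'
      · simp [edgeSwap, hs]
      · have h2 : σ (e, s) * σ (e, s') = -1 := by
          have key : ∀ x y : Bool, x ≠ y →
              (if x then (1 : ℂ) else -1) * (if y then 1 else -1) = -1 := by
            intro x y hxy
            cases x <;> cases y <;> simp at hxy ⊢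
          simp only [hσ]
          fin_cases s <;> fin_cases s'
          · exact absurd rfl hs
          · exact key _ _ h1
          · exact key _ _ h1.symm
          · exact absurd rfl hs
        linear_combination edgeSwap w (e, s) (e, s') * h2
    · simp [edgeSwap, he]
  rw [limitMatrix, ← mul_assoc, hCS, mul_assoc, mul_assoc, ← mul_assoc C, hCJ, mul_neg]

end Parity

/-! ### Persistence of zeros under perturbation. -/

section Roots

/-- A zero of a nonconstant entire function persists under small perturbations. -/
theorem eventually_exists_zero {X : Type*} [TopologicalSpace X] {F : X → ℂ → ℂ} {x₀ : X} {y₀ y₁ : ℂ}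
    (hF : Continuous fun p : X × ℂ => F p.1 p.2) (hd : ∀ x, Differentiable ℂ (F x))
    (h0 : F x₀ y₀ = 0) (h1 : F x₀ y₁ ≠ 0) {r : ℝ} (hr : 0 < r) :
    ∀ᶠ x in 𝓝 x₀, ∃ y ∈ Metric.closedBall y₀ r, F x y = 0 := by
  have han : ∀ x, AnalyticOnNhd ℂ (F x) Set.univ := fun x =>
    (hd x).differentiableOn.analyticOnNhd isOpen_univ
  have hiso : ∀ᶠ z in 𝓝[≠] y₀, F x₀ z ≠ 0 := by
    rcases (han x₀ y₀ trivial).eventually_eq_zero_or_eventually_ne_zero with h | h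
    · exact absurd ((han x₀).eqOn_zero_of_preconnected_of_eventuallyEq_zero isPreconnected_univ
        trivial h (Set.mem_univ y₁)) h1
    · exact h
  obtain ⟨δ, hδ, hδ'⟩ := Metric.mem_nhdsWithin_iff.1 hiso
  set ρ := min r (δ / 2) with hρ
  have hρ0 : 0 < ρ := lt_min hr (half_pos hδ)
  have hsph : ∀ z ∈ Metric.sphere y₀ ρ, F x₀ z ≠ 0 := by
    intro z hz
    rw [Metric.mem_sphere] at hz
    refine hδ' ⟨?_, ?_⟩
    · rw [Metric.mem_ball, hz]
      exact (min_le_right _ _).trans_lt (half_lt_self hδ)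
    · rintro rfl
      rw [dist_self] at hz
      exact hρ0.ne hz
  obtain ⟨z₁, hz₁, hmin⟩ := (isCompact_sphere y₀ ρ).exists_isMinOn
    (NormedSpace.sphere_nonempty.2 hρ0.le) (hd x₀).continuous.norm.continuousOn
  set m := ‖F x₀ z₁‖ with hm
  have hm0 : 0 < m := norm_pos_iff.2 (hsph z₁ hz₁)
  have hcont : Continuous fun p : X × ℂ => ‖F p.1 p.2 - F p.1 y₀‖ :=
    (hF.sub (hF.comp (continuous_fst.prodMk continuous_const))).norm
  -- Input for a quantitative open mapping theorem: a lower bound m/2 on the circle makes the image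
  -- of the closed disc contain the ball of radius m/4 around `F x y₀`, and for `x` near `x₀` this
  -- ball contains 0.
  have hev1 : ∀ᶠ x in 𝓝 x₀, ∀ z ∈ Metric.sphere y₀ ρ, m / 2 < ‖F x z - F x y₀‖ := by
    refine (isCompact_sphere y₀ ρ).eventually_forall_of_forall_eventually fun z hz => ?_
    refine (hcont.tendsto (x₀, z)).eventually (lt_mem_nhds ?_)
    simp only [h0, sub_zero]
    exact (half_lt_self hm0).trans_le (hmin hz)
  have hev2 : ∀ᶠ x in 𝓝 x₀, ‖F x y₀‖ < m / 4 := by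
    have h2 : Continuous fun x => ‖F x y₀‖ :=
      (hF.comp (continuous_id.prodMk continuous_const)).norm
    refine (h2.tendsto x₀).eventually (gt_mem_nhds ?_)
    rw [h0, norm_zero]
    positivity
  filter_upwards [hev1, hev2] with x hx1 hx2
  have hfreq : ∃ᶠ z in 𝓝 y₀, F x z ≠ F x y₀ := by
    intro hcon
    have hcon' : F x =ᶠ[𝓝 y₀] fun _ => F x y₀ := hcon.mono fun z hz => not_not.1 hz
    have h3 := (han x).eqOn_of_preconnected_of_eventuallyEq analyticOnNhd_const
      isPreconnected_univ trivial hcon' (Set.mem_univ z₁)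
    have h4 := hx1 z₁ hz₁
    rw [h3, sub_self, norm_zero] at h4
    linarith
  have h5 := (hd x).diffContOnCl.ball_subset_image_closedBall hρ0
    (fun z hz => (hx1 z hz).le) hfreq
  obtain ⟨y, hy, hy0⟩ := h5 (show (0 : ℂ) ∈ _ by
    rw [Metric.mem_ball, dist_comm, dist_zero_right]
    linarith)
  exact ⟨y, Metric.closedBall_subset_closedBall (min_le_left _ _) hy, hy0⟩

end Roots

/-! ### Standard coupling with odd degrees: separating the abscissas by damping at different scales.
-/

section Standard

variable {V : Type*} {N : ℕ} {Γ : EdgeGraph V N}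

open Classical in
theorem degree_eq_card_filter (Γ : EdgeGraph V N) (v : V) :
    Γ.degree v = (Finset.univ.filter fun p => Γ.vert p = v).card := by
  rw [EdgeGraph.degree, Nat.card_eq_fintype_card, Fintype.card_subtype]

theorem degree_vert_ne_zero (Γ : EdgeGraph V N) (p : Fin N × Fin 2) :
    (Γ.degree (Γ.vert p) : ℂ) ≠ 0 := by
  classical
  rw [degree_eq_card_filter, Nat.cast_ne_zero, Finset.card_ne_zero]
  exact ⟨p, by simp⟩

open Classical in
theorem standardCoupling_mulVec (Γ : EdgeGraph V N) (x : Fin N × Fin 2 → ℂ) (p : Fin N × Fin 2) :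
    (Γ.standardCoupling.mulVec x) p = 2 / (Γ.degree (Γ.vert p) : ℂ) *
      (∑ q ∈ Finset.univ.filter fun q => Γ.vert q = Γ.vert p, x q) - x p := by
  simp only [Matrix.mulVec, dotProduct, EdgeGraph.standardCoupling, sub_mul, ite_mul, zero_mul,
    one_mul, Finset.sum_sub_distrib, Finset.sum_ite_eq, Finset.mem_univ, if_true,
    Finset.mul_sum, Finset.sum_filter]
  simp only [eq_comm (a := Γ.vert p), mul_ite, mul_zero]

theorem standardCoupling_mul_self (Γ : EdgeGraph V N) :
    Γ.standardCoupling * Γ.standardCoupling = 1 := by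
  classical
  refine Matrix.toLin'.injective (LinearMap.ext fun x => funext fun p => ?_)
  rw [Matrix.toLin'_apply, ← Matrix.mulVec_mulVec, Matrix.toLin'_one, LinearMap.id_apply,
    standardCoupling_mulVec, standardCoupling_mulVec]
  have h1 : ∑ q ∈ Finset.univ.filter (fun q => Γ.vert q = Γ.vert p),
      (Γ.standardCoupling.mulVec x) q
      = ∑ q ∈ Finset.univ.filter (fun q => Γ.vert q = Γ.vert p), x q := by
    rw [Finset.sum_congr rfl (g := fun q => 2 / (Γ.degree (Γ.vert p) : ℂ) *
      (∑ q ∈ Finset.univ.filter fun q => Γ.vert q = Γ.vert p, x q) - x q)]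
    · rw [Finset.sum_sub_distrib, Finset.sum_const, ← degree_eq_card_filter, nsmul_eq_mul]
      field_simp [degree_vert_ne_zero Γ p]
      ring
    · intro q hq
      rw [standardCoupling_mulVec, (Finset.mem_filter.1 hq).2]
  rw [h1]
  ring

theorem standardCoupling_mem_unitaryGroup (Γ : EdgeGraph V N) :
    Γ.standardCoupling ∈ Matrix.unitaryGroup (Fin N × Fin 2) ℂ := by
  classical
  have h1 : star Γ.standardCoupling = Γ.standardCoupling := by
    ext p q
    rw [Matrix.star_apply]
    simp only [EdgeGraph.standardCoupling, eq_comm (a := q)]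
    by_cases h : Γ.vert p = Γ.vert q
    · simp only [h, if_true, star_sub]
      split_ifs <;> simp
    · rw [if_neg h, if_neg (Ne.symm h)]
      split_ifs <;> simp
  rw [Matrix.mem_unitaryGroup_iff, h1, standardCoupling_mul_self]

/-- If all degrees are odd, the submatrix of the standard coupling that belongs to a set of edges is
invertible. -/
theorem eq_zero_of_standardCoupling_mulVec (hodd : ∀ v, Odd (Γ.degree v)) {A : Set (Fin N × Fin 2)}
    {x : Fin N × Fin 2 → ℂ} (hA : ∀ p ∈ A, (Γ.standardCoupling.mulVec x) p = 0)
    (hx : ∀ p, p ∉ A → x p = 0) : x = 0 := by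
  classical
  funext p
  by_cases hp : p ∈ A
  · set D : Finset (Fin N × Fin 2) := Finset.univ.filter fun q => Γ.vert q = Γ.vert p with hD
    set d : ℂ := (Γ.degree (Γ.vert p) : ℂ) with hd
    have hd0 : d ≠ 0 := degree_vert_ne_zero Γ p
    set s : ℂ := ∑ q ∈ D, x q with hs
    have h1 : ∀ q ∈ D, q ∈ A → x q = 2 / d * s := by
      intro q hq hqA
      have h2 := hA q hqA
      rw [standardCoupling_mulVec, (Finset.mem_filter.1 hq).2] at h2
      exact (sub_eq_zero.1 h2).symm
    -- At a vertex of degree d with m ends in `A`, the vector equals 2s/d on these ends and 0 on the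
    -- others. Summing gives (d − 2m)s = 0, and d − 2m cannot vanish for odd d.
    have h3 : s = (D.filter fun q => q ∈ A).card * (2 / d * s) := by
      rw [← nsmul_eq_mul, ← Finset.sum_const, Finset.sum_filter, hs]
      refine Finset.sum_congr rfl fun q hq => ?_
      split_ifs with hqA
      · exact h1 q hq hqA
      · exact hx q hqA
    have h4 : ((Γ.degree (Γ.vert p) : ℂ) - 2 * (D.filter fun q => q ∈ A).card) * s = 0 := by
      have h5 : d * s = 2 * (D.filter fun q => q ∈ A).card * s := by
        conv_lhs => rw [h3]
        field_simp
      linear_combination h5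
    have h6 : (Γ.degree (Γ.vert p) : ℂ) - 2 * (D.filter fun q => q ∈ A).card ≠ 0 := by
      intro h
      have h7 : Γ.degree (Γ.vert p) = 2 * (D.filter fun q => q ∈ A).card := by
        exact_mod_cast sub_eq_zero.1 h
      have := hodd (Γ.vert p)
      rw [h7] at this
      exact absurd this (by simp)
    have h8 : s = 0 := (mul_eq_zero.1 h4).resolve_left h6
    rw [h1 p (by simp [hD]) hp, h8, mul_zero]
    rfl
  · exact hx p hp

/-- The other end of the same edge. -/
def otherEnd (p : Fin N × Fin 2) : Fin N × Fin 2 := (p.1, p.2 + 1)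

theorem otherEnd_otherEnd (p : Fin N × Fin 2) : otherEnd (otherEnd p) = p := by
  obtain ⟨e, s⟩ := p
  fin_cases s <;> simp [otherEnd]

theorem edgeSwap_mulVec (w : Fin N → ℂ) (x : Fin N × Fin 2 → ℂ) (p : Fin N × Fin 2) :
    ((edgeSwap w).mulVec x) p = w p.1 * x (otherEnd p) := by
  obtain ⟨e, s⟩ := p
  have h1 : ∀ q : Fin N × Fin 2, edgeSwap w (e, s) q * x q
      = if q = otherEnd (e, s) then w e * x (otherEnd (e, s)) else 0 := by
    rintro ⟨e', s'⟩
    by_cases he : e = e'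
    · subst he
      fin_cases s <;> fin_cases s' <;> simp [edgeSwap, otherEnd]
    · simp [edgeSwap, otherEnd, he, Ne.symm he]
  simp only [Matrix.mulVec, dotProduct, h1, Finset.sum_ite_eq', Finset.mem_univ, if_true]

/-- In a kernel vector the exchange rows force the entries at both ends of every edge outside `A` to
vanish; the remaining block of the standard coupling is invertible because the degrees are odd. -/
theorem det_ne_zero_of_rows (hodd : ∀ v, Odd (Γ.degree v)) (A : Set (Fin N))
    {c : ℂ} (hc : c ≠ 0) {M : Matrix (Fin N × Fin 2) (Fin N × Fin 2) ℂ}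
    (h1 : ∀ p : Fin N × Fin 2, p.1 ∈ A → M p = Γ.standardCoupling p)
    (h2 : ∀ p : Fin N × Fin 2, p.1 ∉ A → M p = c • (edgeSwap fun _ => 1) p) : M.det ≠ 0 := by
  intro hdet
  obtain ⟨x, hx0, hx⟩ := Matrix.exists_mulVec_eq_zero_iff.2 hdet
  refine hx0 (eq_zero_of_standardCoupling_mulVec hodd (A := {p | p.1 ∈ A}) ?_ ?_)
  · intro p hp
    have := congrFun hx p
    rw [Matrix.mulVec, h1 p hp] at this
    exact this
  · intro p hp
    have h3 := congrFun hx (otherEnd p)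
    rw [Matrix.mulVec, h2 (otherEnd p) hp, smul_dotProduct] at h3
    have h4 := edgeSwap_mulVec (fun _ => 1) x (otherEnd p)
    rw [Matrix.mulVec] at h4
    rw [h4, otherEnd_otherEnd, one_mul] at h3
    exact (smul_eq_zero.1 h3).resolve_left hc

/-- The matrix `U - y ε ^ k J E` with `E = ε ^ (-e)` on the edge `e`, and with the rows of the edges
`e > k` multiplied by `ε ^ (e - k)`. -/
def scaledMatrix (U : Matrix (Fin N × Fin 2) (Fin N × Fin 2) ℂ) (k : Fin N) (ε y : ℂ) :
    Matrix (Fin N × Fin 2) (Fin N × Fin 2) ℂ := fun p q =>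
  ε ^ ((p.1 : ℕ) - k) * U p q - y * ε ^ ((k : ℕ) - p.1) * edgeSwap (fun _ => 1) p q

theorem continuous_det_scaledMatrix (U : Matrix (Fin N × Fin 2) (Fin N × Fin 2) ℂ) (k : Fin N) :
    Continuous fun p : ℂ × ℂ => (scaledMatrix U k p.1 p.2).det := by
  refine Continuous.matrix_det (continuous_matrix fun p q => ?_)
  unfold scaledMatrix
  fun_prop

theorem differentiable_det_scaledMatrix (U : Matrix (Fin N × Fin 2) (Fin N × Fin 2) ℂ) (k : Fin N)
    (ε : ℂ) : Differentiable ℂ fun y => (scaledMatrix U k ε y).det := fun y =>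
  differentiableAt_det fun p q => by
    unfold scaledMatrix
    fun_prop

/-- The rows of the edges below `k` are those of `U`, the rows of the edges above `k` those of `-J`,
and the rows of the edge `k` are those of `x U - y J`. -/
def pencilMatrix (U : Matrix (Fin N × Fin 2) (Fin N × Fin 2) ℂ) (k : Fin N) (x y : ℂ) :
    Matrix (Fin N × Fin 2) (Fin N × Fin 2) ℂ := fun p q =>
  if p.1 < k then U p q else if p.1 = k then x * U p q - y * edgeSwap (fun _ => 1) p q
    else -edgeSwap (fun _ => 1) p q

theorem continuous_det_pencilMatrix (U : Matrix (Fin N × Fin 2) (Fin N × Fin 2) ℂ) (k : Fin N) :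
    Continuous fun p : ℂ × ℂ => (pencilMatrix U k p.1 p.2).det := by
  refine Continuous.matrix_det (continuous_matrix fun p q => ?_)
  unfold pencilMatrix
  split_ifs <;> fun_prop

/-- Truncated subtraction makes one of the two exponents zero in every row, and 0⁰ = 1 keeps the
corresponding term at ε = 0. Thus U survives on the edges up to k, and the exchange term on the
edges from k upwards. -/
theorem scaledMatrix_zero (U : Matrix (Fin N × Fin 2) (Fin N × Fin 2) ℂ) (k : Fin N) (y : ℂ) :
    scaledMatrix U k 0 y
      = Matrix.diagonal (fun p => if k < p.1 then y else 1) * pencilMatrix U k 1 y := by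
  ext p q
  rw [Matrix.diagonal_mul, scaledMatrix, pencilMatrix]
  rcases lt_trichotomy p.1 k with h | h | h
  · have h1 : (k : ℕ) - p.1 ≠ 0 := Nat.sub_ne_zero_of_lt h
    have h2 : (p.1 : ℕ) - k = 0 := Nat.sub_eq_zero_of_le (le_of_lt h)
    simp [h, h.not_gt, h1, h2]
  · simp [h]
  · have h1 : (p.1 : ℕ) - k ≠ 0 := Nat.sub_ne_zero_of_lt h
    have h2 : (k : ℕ) - p.1 = 0 := Nat.sub_eq_zero_of_le (le_of_lt h)
    simp [h, h.not_gt, h.ne', h1, h2]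

theorem pencilMatrix_eq (U : Matrix (Fin N × Fin 2) (Fin N × Fin 2) ℂ) (k : Fin N) {t : ℂ}
    (ht : t ≠ 0) : pencilMatrix U k t 1
      = Matrix.diagonal (fun p => if p.1 = k then t else 1) * pencilMatrix U k 1 t⁻¹ := by
  ext p q
  rw [Matrix.diagonal_mul, pencilMatrix, pencilMatrix]
  by_cases h : p.1 = k
  · simp [h, mul_sub, ht]
  · simp [h]

theorem det_pencilMatrix_one_zero (hodd : ∀ v, Odd (Γ.degree v)) (k : Fin N) :
    (pencilMatrix Γ.standardCoupling k 1 0).det ≠ 0 := by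
  refine det_ne_zero_of_rows hodd (Set.Iic k) (c := -1) (by norm_num) ?_ ?_
  · intro p hp
    funext q
    rcases lt_or_eq_of_le (Set.mem_Iic.1 hp) with h | h
    · simp [pencilMatrix, h]
    · simp [pencilMatrix, h]
  · intro p hp
    have h : k < p.1 := not_le.1 hp
    funext q
    simp [pencilMatrix, h.not_gt, h.ne']

theorem det_pencilMatrix_zero_one (hodd : ∀ v, Odd (Γ.degree v)) (k : Fin N) :
    (pencilMatrix Γ.standardCoupling k 0 1).det ≠ 0 := by
  refine det_ne_zero_of_rows hodd (Set.Iio k) (c := -1) (by norm_num) ?_ ?_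
  · intro p hp
    funext q
    simp [pencilMatrix, Set.mem_Iio.1 hp]
  · intro p hp
    have h : k ≤ p.1 := not_lt.1 hp
    funext q
    simp [pencilMatrix, h.not_gt]

theorem exists_polynomial_det_pencilMatrix (U : Matrix (Fin N × Fin 2) (Fin N × Fin 2) ℂ)
    (k : Fin N) : ∃ Q : Polynomial ℂ, ∀ y, Q.eval y = (pencilMatrix U k 1 y).det := by
  refine ⟨Matrix.det (Matrix.of fun p q => if p.1 < k then Polynomial.C (U p q) else
    if p.1 = k then Polynomial.C (U p q) - Polynomial.X * Polynomial.C (edgeSwap (fun _ => 1) p q)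
    else -Polynomial.C (edgeSwap (fun _ => 1) p q)), fun y => ?_⟩
  rw [← Polynomial.coe_evalRingHom, RingHom.map_det]
  congr 1
  ext p q
  simp only [RingHom.mapMatrix_apply, Matrix.map_apply, Matrix.of_apply, pencilMatrix,
    Polynomial.coe_evalRingHom]
  split_ifs
  · simp
  · simp
    ring
  · simp

/-- As a polynomial in y the determinant is nonzero at 0, so it suffices to exclude that it is
constant. A constant would make the homogenised determinant a multiple of a positive power of t,
hence zero at t = 0, where the rows of edge k become exchange rows and the determinant is nonzero.
-/
theorem exists_det_pencilMatrix_eq_zero (hodd : ∀ v, Odd (Γ.degree v)) (k : Fin N) :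
    ∃ y, y ≠ 0 ∧ (pencilMatrix Γ.standardCoupling k 1 y).det = 0 := by
  obtain ⟨Q, hQ⟩ := exists_polynomial_det_pencilMatrix Γ.standardCoupling k
  have h0 := det_pencilMatrix_one_zero hodd k
  by_cases hdeg : Q.degree = 0
  · exfalso
    obtain ⟨c, hc⟩ : ∃ c, Q = Polynomial.C c := ⟨_, Polynomial.eq_C_of_degree_eq_zero hdeg⟩
    have h1 : (fun t => (pencilMatrix Γ.standardCoupling k t 1).det)
        = fun t => (∏ p : Fin N × Fin 2, if p.1 = k then t else 1) * c := by
      refine Continuous.ext_on (dense_compl_singleton (0 : ℂ)) ?_ ?_ ?_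
      · exact (continuous_det_pencilMatrix Γ.standardCoupling k).comp
          (continuous_id.prodMk continuous_const)
      · refine Continuous.mul (continuous_finsetProd _ fun p _ => ?_) continuous_const
        split_ifs <;> fun_prop
      · intro t ht
        have h2 := hQ t⁻¹
        rw [hc, Polynomial.eval_C] at h2
        beta_reduce
        rw [pencilMatrix_eq _ _ ht, Matrix.det_mul, Matrix.det_diagonal, h2]
    have h3 := congrFun h1 0
    rw [Finset.prod_eq_zero (Finset.mem_univ (k, 0)) (by simp), zero_mul] at h3
    exact det_pencilMatrix_zero_one hodd k h3
  · obtain ⟨y, hy⟩ := IsAlgClosed.exists_root Q hdeg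
    rw [Polynomial.IsRoot, hQ] at hy
    refine ⟨y, ?_, hy⟩
    rintro rfl
    exact h0 hy

/-- For small `ε` there is a zero of bounded size and bounded away from `0`. -/
theorem exists_eventually_det_scaledMatrix_eq_zero (hodd : ∀ v, Odd (Γ.degree v)) (k : Fin N) :
    ∃ L : ℝ, ∀ᶠ ε in 𝓝 (0 : ℂ), ∃ y, y ≠ 0 ∧ |Real.log ‖y‖| ≤ L ∧
      (scaledMatrix Γ.standardCoupling k ε y).det = 0 := by
  obtain ⟨y₀, hy₀, hdet⟩ := exists_det_pencilMatrix_eq_zero hodd k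
  have h0 : (scaledMatrix Γ.standardCoupling k 0 y₀).det = 0 := by
    rw [scaledMatrix_zero, Matrix.det_mul, hdet, mul_zero]
  -- A small nonzero y serves: the pencil is invertible near y = 0, and the diagonal factor is
  -- invertible for y ≠ 0. So the determinant at ε = 0 is not identically zero and its root
  -- persists.
  obtain ⟨y₁, hy₁⟩ : ∃ y₁, (scaledMatrix Γ.standardCoupling k 0 y₁).det ≠ 0 := by
    have hc : Continuous fun y => (pencilMatrix Γ.standardCoupling k 1 y).det :=
      (continuous_det_pencilMatrix Γ.standardCoupling k).comp
          (continuous_const.prodMk continuous_id)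
    have h1 : ∀ᶠ y in 𝓝[≠] (0 : ℂ), (pencilMatrix Γ.standardCoupling k 1 y).det ≠ 0 :=
      ((hc.tendsto 0).eventually (isOpen_ne.mem_nhds
        (det_pencilMatrix_one_zero hodd k))).filter_mono nhdsWithin_le_nhds
    obtain ⟨y, hy, hy0⟩ := (h1.and self_mem_nhdsWithin).exists
    refine ⟨y, ?_⟩
    rw [scaledMatrix_zero, Matrix.det_mul, Matrix.det_diagonal]
    refine mul_ne_zero (Finset.prod_ne_zero_iff.2 fun p _ => ?_) hy
    split_ifs
    exacts [hy0, one_ne_zero]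
  have hn : 0 < ‖y₀‖ := norm_pos_iff.2 hy₀
  refine ⟨max |Real.log (‖y₀‖ / 2)| |Real.log (2 * ‖y₀‖)|, ?_⟩
  filter_upwards [eventually_exists_zero (continuous_det_scaledMatrix Γ.standardCoupling k)
    (differentiable_det_scaledMatrix Γ.standardCoupling k) h0 hy₁ (half_pos hn)]
  rintro ε ⟨y, hy, hz⟩
  rw [mem_closedBall_iff_norm] at hy
  have h1 : ‖y₀‖ / 2 ≤ ‖y‖ := by
    have := norm_sub_norm_le y₀ y
    rw [norm_sub_rev] at this
    linarith
  have h2 : ‖y‖ ≤ 2 * ‖y₀‖ := by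
    have := norm_sub_norm_le y y₀
    linarith
  have h3 : 0 < ‖y‖ := (half_pos hn).trans_le h1
  exact ⟨y, norm_pos_iff.1 h3, abs_le_max_abs_abs (Real.log_le_log (half_pos hn) h1)
    (Real.log_le_log h3 h2), hz⟩

/-- A zero of the scaled determinant gives an eigenvalue of the limit matrix. -/
theorem mem_roots_of_det_scaledMatrix {U : Matrix (Fin N × Fin 2) (Fin N × Fin 2) ℂ}
    (hU : U * U = 1) {k : Fin N} {ε y : ℂ} (hε : ε ≠ 0) (hy : y ≠ 0)
    (h : (scaledMatrix U k ε y).det = 0) :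
    (y * ε ^ (k : ℕ))⁻¹ ∈ (U * edgeSwap fun e : Fin N => (ε ^ (e : ℕ))⁻¹).charpoly.roots := by
  set w := y * ε ^ (k : ℕ) with hw
  have hw0 : w ≠ 0 := mul_ne_zero hy (pow_ne_zero _ hε)
  set T := U * edgeSwap fun e : Fin N => (ε ^ (e : ℕ))⁻¹ with hT
  have h1 : scaledMatrix U k ε y = Matrix.diagonal (fun p => ε ^ ((p.1 : ℕ) - k)) *
      (U - w • edgeSwap fun e : Fin N => (ε ^ (e : ℕ))⁻¹) := by
    ext p q
    rw [Matrix.diagonal_mul, scaledMatrix, Matrix.sub_apply, Matrix.smul_apply, mul_sub, smul_eq_mul]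
    congr 1
    unfold edgeSwap
    split_ifs
    · have h2 : ε ^ ((k : ℕ) - p.1) * ε ^ (p.1 : ℕ) = ε ^ ((p.1 : ℕ) - k) * ε ^ (k : ℕ) := by
        rw [← pow_add, ← pow_add]
        congr 1
        omega
      have h3 : ε ^ (p.1 : ℕ) ≠ 0 := pow_ne_zero _ hε
      field_simp
      rw [hw]
      linear_combination y * h2
    · simp
  have h2 : U - w • edgeSwap (fun e : Fin N => (ε ^ (e : ℕ))⁻¹)
      = w • (U * (Matrix.scalar _ w⁻¹ - T)) := by
    rw [mul_sub, hT, ← mul_assoc, hU, one_mul, smul_sub, Matrix.scalar_apply,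
      ← Matrix.smul_one_eq_diagonal, mul_smul_comm, mul_one, smul_smul, mul_inv_cancel₀ hw0,
      one_smul]
  have h3 : U.det ≠ 0 := by
    intro h4
    have := congrArg Matrix.det hU
    rw [Matrix.det_mul, h4, zero_mul, Matrix.det_one] at this
    exact zero_ne_one this
  rw [Polynomial.mem_roots T.charpoly_monic.ne_zero, Polynomial.IsRoot, Matrix.eval_charpoly]
  rw [h1, h2, Matrix.det_mul, Matrix.det_smul, Matrix.det_mul, Matrix.det_diagonal] at h
  have h4 : ∏ p : Fin N × Fin 2, ε ^ ((p.1 : ℕ) - k) ≠ 0 :=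
    Finset.prod_ne_zero_iff.2 fun p _ => pow_ne_zero _ hε
  exact (mul_eq_zero.1 ((mul_eq_zero.1 ((mul_eq_zero.1 h).resolve_left h4)).resolve_left
    (pow_ne_zero _ hw0))).resolve_left h3

theorem edgeMean_const {α : EdgeC} {c : ℝ} (h : ∀ x ∈ Set.Icc (0 : ℝ) 1, edgeExt α x = (c : ℂ)) :
    edgeMean α = c := by
  have h1 : edgeMean α = ∫ t in (0 : ℝ)..1, edgeExt α t := rfl
  rw [h1, intervalIntegral.integral_congr (g := fun _ => (c : ℂ))]
  · simp
  · intro x hx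
    rw [Set.uIcc_of_le zero_le_one] at hx
    exact h x hx

/-- For a suitable constant damping on the edges, the eigenvalues of the limit matrix have at least
as many different absolute values as there are edges. -/
theorem exists_damping_card_abscissas (hodd : ∀ v, Odd (Γ.degree v)) :
    ∃ a : Fin N → ℝ, ∀ (P G : Matrix (Fin N × Fin 2) (Fin N × Fin 2) ℂ)
      (α : Fin N → EdgeC), IsCouplingPair Γ.standardCoupling P G →
      (∀ e, ∀ x ∈ Set.Icc (0 : ℝ) 1, edgeExt (α e) x = (a e : ℂ)) →
      N ≤ (HasBoxCounts.abscissas (limitMatrix P α).charpoly.roots).card := by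
  choose L hL using fun k : Fin N => exists_eventually_det_scaledMatrix_eq_zero hodd k
  obtain ⟨M, hM⟩ : ∃ M, ∀ k, L k ≤ M :=
    ⟨∑ k, |L k|, fun k => (le_abs_self _).trans
      (Finset.single_le_sum (f := fun k => |L k|) (fun _ _ => abs_nonneg _) (Finset.mem_univ k))⟩
  have h1 : ∀ᶠ ε : ℝ in 𝓝[>] 0, ∀ k, ∃ y : ℂ, y ≠ 0 ∧ |Real.log ‖y‖| ≤ L k ∧
      (scaledMatrix Γ.standardCoupling k ε y).det = 0 := by
    refine eventually_all.2 fun k => ?_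
    have h2 : Tendsto (fun ε : ℝ => (ε : ℂ)) (𝓝[>] 0) (𝓝 0) :=
      (Complex.continuous_ofReal.tendsto' 0 0 Complex.ofReal_zero).mono_left nhdsWithin_le_nhds
    exact h2.eventually (hL k)
  -- The roots y fluctuate on the logarithmic scale by at most M to either side, so a spacing |log
  -- ε| > 2M keeps the resulting abscissas apart.
  have h2 : ∀ᶠ ε : ℝ in 𝓝[>] 0, Real.log ε < -(2 * M) :=
    Real.tendsto_log_nhdsGT_zero.eventually (eventually_lt_atBot _)
  obtain ⟨ε, ⟨hε1, hε2⟩, hε⟩ := ((h1.and h2).and self_mem_nhdsWithin).exists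
  replace hε : 0 < ε := hε
  choose y hy0 hyL hydet using hε1
  -- This damping produces the edge weight exp(∫a) = ε^(−e).
  refine ⟨fun e => -(e : ℕ) * Real.log ε, fun P G α h hα => ?_⟩
  have hlim : limitMatrix P α
      = Γ.standardCoupling * edgeSwap fun e : Fin N => ((ε : ℂ) ^ (e : ℕ))⁻¹ := by
    rw [limitMatrix, h.reflection_eq_of_sq_eq_one (standardCoupling_mul_self Γ)]
    congr 2
    funext e
    rw [edgeMean_const (hα e), ← Complex.ofReal_exp]
    beta_reduce
    rw [neg_mul, Real.exp_neg, Real.exp_nat_mul,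
      Real.exp_log hε]
    push_cast
    rfl
  have hεc : (ε : ℂ) ≠ 0 := Complex.ofReal_ne_zero.2 hε.ne'
  -- The matrix eigenvalue found at scale k is 1/(y ε^k), and minus the logarithm of its modulus is
  -- this number.
  set f : Fin N → ℝ := fun k => Real.log ‖y k‖ + (k : ℕ) * Real.log ε with hf
  have hmem : ∀ k, f k ∈ HasBoxCounts.abscissas (limitMatrix P α).charpoly.roots := by
    intro k
    rw [HasBoxCounts.mem_abscissas, hlim]
    refine ⟨_, mem_roots_of_det_scaledMatrix (standardCoupling_mul_self Γ) hεc (hy0 k) (hydet k), ?_⟩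
    rw [rootAbscissa, norm_inv, Real.log_inv, neg_neg, norm_mul, norm_pow, Complex.norm_real,
      Real.norm_of_nonneg hε.le, Real.log_mul (norm_ne_zero_iff.2 (hy0 k))
      (pow_ne_zero _ hε.ne'), Real.log_pow]
  have hlt : ∀ k k' : Fin N, k < k' → f k' < f k := by
    intro k k' hk
    have h3 := abs_le.1 ((hyL k).trans (hM k))
    have h4 := abs_le.1 ((hyL k').trans (hM k'))
    have h5 : ((k : ℕ) : ℝ) + 1 ≤ (k' : ℕ) := by exact_mod_cast hk
    have h6 : 0 ≤ M := (abs_nonneg _).trans ((hyL k).trans (hM k))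
    have h7 : (k' : ℕ) * Real.log ε ≤ (((k : ℕ) : ℝ) + 1) * Real.log ε :=
      mul_le_mul_of_nonpos_right h5 (by linarith)
    simp only [hf]
    linarith
  have hinj : Function.Injective f := StrictAnti.injective fun k k' hk => hlt k k' hk
  calc N = (Finset.univ.image f).card := by
        rw [Finset.card_image_of_injective _ hinj, Finset.card_univ, Fintype.card_fin]
    _ ≤ _ := Finset.card_le_card fun c hc => by
        obtain ⟨k, -, rfl⟩ := Finset.mem_image.1 hc
        exact hmem k

end Standard

end DampedGraph

end

/-! ### Assembly of the four assertions from the box counts. -/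

theorem mainTheorem1 {V : Type*} (N : ℕ) (hN : 0 < N) (Γ : DampedGraph.EdgeGraph V N) :
    -- general coupling, damping and potential
    (∀ U : Matrix (Fin N × Fin 2) (Fin N × Fin 2) ℂ,
      U ∈ Matrix.unitaryGroup (Fin N × Fin 2) ℂ → Γ.IsLocal U →
      ∀ a b : Fin N → ℝ → ℝ,
      (∀ j, ContDiffOn ℝ 2 (a j) (Set.Icc 0 1)) → (∀ j, ContinuousOn (b j) (Set.Icc 0 1)) →
      -- the eigenvalue counts are finite
      ((∀ R : ℝ, {z : ℂ | DampedGraph.IsEigenvalue (DampedGraph.waveOp U a b) z ∧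
          |z.im| < R}.Finite) ∧
        ∀ z : ℂ, FiniteDimensional ℂ (DampedGraph.rootSpace (DampedGraph.waveOp U a b) z)) ∧
      -- (i)
      (∀ I : Set ℝ, IsOpen I → I.OrdConnected →
        (∀ c ∈ frontier I, ¬ DampedGraph.IsHighFreqAbscissa (DampedGraph.waveOp U a b) c) →
        ∃ m : ℕ, DampedGraph.MuEq (DampedGraph.waveOp U a b) I ((m : ℝ) / (2 * N))) ∧
      -- (ii) and (iii)
      (∃ (S : Finset ℝ) (m : ℝ → ℕ),
        (∀ c, c ∈ S ↔ DampedGraph.IsHighFreqAbscissa (DampedGraph.waveOp U a b) c) ∧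
        S.card ≤ 2 * N ∧
        (∀ c ∈ S, 0 < m c ∧ ∀ ε : ℝ, 0 < ε → (∀ c' ∈ S, c' ≠ c → ε < |c' - c|) →
          DampedGraph.MuEq (DampedGraph.waveOp U a b) (Set.Ioo (c - ε) (c + ε))
            ((m c : ℝ) / (2 * N))) ∧
        ∑ c ∈ S, m c = 2 * N ∧
        (∀ c, c ∉ S → ∃ ε₀ > 0, ∀ ε : ℝ, 0 < ε → ε < ε₀ →
          DampedGraph.MuEq (DampedGraph.waveOp U a b) (Set.Ioo (c - ε) (c + ε)) 0) ∧
        (Γ.IsBipartite → ∀ c ∈ S, Even (m c)))) ∧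
    -- (iv)
    (Γ.IsTree → (∀ v : V, Odd (Γ.degree v)) →
      ∃ a : Fin N → ℝ → ℝ, (∀ j, ContDiffOn ℝ 2 (a j) (Set.Icc 0 1)) ∧
        ∀ b : Fin N → ℝ → ℝ, (∀ j, ContinuousOn (b j) (Set.Icc 0 1)) →
          (N : ℕ∞) ≤ {c : ℝ |
            DampedGraph.IsHighFreqAbscissa (DampedGraph.waveOp Γ.standardCoupling a b) c ∧
            ∃ m : ℕ, 0 < m ∧ ∃ ε₀ > 0, ∀ ε : ℝ, 0 < ε → ε < ε₀ →
              DampedGraph.MuEq (DampedGraph.waveOp Γ.standardCoupling a b)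
                (Set.Ioo (c - ε) (c + ε)) ((m : ℝ) / (2 * N))}.encard) := by
  have hcard : ∀ T : Matrix (Fin N × Fin 2) (Fin N × Fin 2) ℂ,
      Multiset.card T.charpoly.roots = 2 * N := fun T => by
    rw [DampedGraph.card_roots_charpoly, Fintype.card_prod, Fintype.card_fin, Fintype.card_fin,
      mul_comm]
  have hcardR : ∀ T : Matrix (Fin N × Fin 2) (Fin N × Fin 2) ℂ,
      (Multiset.card T.charpoly.roots : ℝ) = 2 * N := fun T => by
    rw [hcard]
    push_cast
    rfl
  have hpos : ∀ T : Matrix (Fin N × Fin 2) (Fin N × Fin 2) ℂ,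
      0 < Multiset.card T.charpoly.roots := fun T => by
    rw [hcard]
    omega
  refine ⟨fun U hU hloc a b ha hb => ?_, fun _ hodd => ?_⟩
  · obtain ⟨α, hα⟩ := DampedGraph.exists_edgeC fun e => (ha e).continuousOn
    obtain ⟨β, hβ⟩ := DampedGraph.exists_edgeC hb
    obtain ⟨P, G, hPG⟩ := DampedGraph.exists_isCouplingPair hU
    obtain ⟨HB, hfin⟩ := DampedGraph.hasBoxCounts hU hPG ha hα hβ
    set T := DampedGraph.limitMatrix P α with hT
    -- Stated for arbitrary `c`, this serves both the abscissas, where the count at `c` is positive,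
    -- and all other points, where it is zero.
    have hmu : ∀ c ε : ℝ, 0 < ε →
        (∀ c' ∈ DampedGraph.HasBoxCounts.abscissas T.charpoly.roots, c' ≠ c → ε < |c' - c|) →
        DampedGraph.MuEq (DampedGraph.waveOp U a b) (Set.Ioo (c - ε) (c + ε))
          ((DampedGraph.abscissaCount T.charpoly.roots {c} : ℝ) / (2 * N)) := by
      intro c ε hε hc
      have := HB.muEq (hpos T) (DampedGraph.HasBoxCounts.notMem_frontier_Ioo hε hc)
      rwa [DampedGraph.HasBoxCounts.abscissaCount_Ioo hε hc, hcardR] at this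
    refine ⟨⟨HB.finite, hfin⟩, fun I _ _ hI => ?_,
      DampedGraph.HasBoxCounts.abscissas T.charpoly.roots,
      fun c => DampedGraph.abscissaCount T.charpoly.roots {c},
      fun c => (HB.isHighFreqAbscissa_iff c).symm, ?_, fun c hc => ⟨?_, hmu c⟩, ?_,
      fun c hc => ?_, fun hΓ c _ => ?_⟩
    · refine ⟨DampedGraph.abscissaCount T.charpoly.roots I, ?_⟩
      have := HB.muEq (hpos T) (I := I) fun τ hτ hτI => hI _ hτI
        ((HB.isHighFreqAbscissa_iff _).2 (DampedGraph.HasBoxCounts.mem_abscissas.2 ⟨τ, hτ, rfl⟩))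
      rwa [hcardR] at this
    · rw [← hcard T]
      exact Finset.card_image_le.trans (Multiset.toFinset_card_le _)
    · obtain ⟨τ, hτ, hτc⟩ := DampedGraph.HasBoxCounts.mem_abscissas.1 hc
      exact DampedGraph.HasBoxCounts.abscissaCount_pos hτ hτc
    · rw [DampedGraph.HasBoxCounts.sum_abscissaCount, hcard]
    · obtain ⟨ε₀, hε₀, hiso⟩ := DampedGraph.HasBoxCounts.exists_isolating T.charpoly.roots c
      refine ⟨ε₀, hε₀, fun ε hε hεε => ?_⟩
      have := hmu c ε hε fun c' hc' hne => hεε.trans_le (hiso c' hc' hne)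
      rwa [DampedGraph.HasBoxCounts.abscissaCount_eq_zero, Nat.cast_zero, zero_div] at this
      intro τ hτ hτc
      exact hc (DampedGraph.HasBoxCounts.mem_abscissas.2 ⟨τ, hτ, hτc⟩)
    · exact DampedGraph.even_abscissaCount
        (DampedGraph.zero_notMem_roots_charpoly (DampedGraph.det_limitMatrix_ne_zero hPG α))
        (DampedGraph.roots_limitMatrix_symm hΓ hloc hPG α) _
  · obtain ⟨a, ha⟩ := DampedGraph.exists_damping_card_abscissas hodd
    have hcd : ∀ j, ContDiffOn ℝ 2 ((fun j _ => a j : Fin N → ℝ → ℝ) j) (Set.Icc 0 1) :=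
      fun j => contDiffOn_const
    refine ⟨fun j _ => a j, hcd, fun b hb => ?_⟩
    have hU := DampedGraph.standardCoupling_mem_unitaryGroup Γ
    obtain ⟨α, hα⟩ := DampedGraph.exists_edgeC fun e => (hcd e).continuousOn
    obtain ⟨β, hβ⟩ := DampedGraph.exists_edgeC hb
    obtain ⟨P, G, hPG⟩ := DampedGraph.exists_isCouplingPair hU
    obtain ⟨HB, -⟩ := DampedGraph.hasBoxCounts hU hPG hcd hα hβ
    set T := DampedGraph.limitMatrix P α with hT
    have hN' : (N : ℕ∞)
        ≤ (DampedGraph.HasBoxCounts.abscissas T.charpoly.roots : Set ℝ).encard := by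
      rw [Set.encard_coe_eq_coe_finsetCard]
      exact_mod_cast ha P G α hPG hα
    refine hN'.trans (Set.encard_le_encard fun c hc => ?_)
    obtain ⟨τ, hτ, hτc⟩ := DampedGraph.HasBoxCounts.mem_abscissas.1 hc
    obtain ⟨ε₀, hε₀, hiso⟩ := DampedGraph.HasBoxCounts.exists_isolating T.charpoly.roots c
    refine ⟨(HB.isHighFreqAbscissa_iff c).2 hc, DampedGraph.abscissaCount T.charpoly.roots {c},
      DampedGraph.HasBoxCounts.abscissaCount_pos hτ hτc, ε₀, hε₀, fun ε hε hεε => ?_⟩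
    have hc' : ∀ c' ∈ DampedGraph.HasBoxCounts.abscissas T.charpoly.roots, c' ≠ c → ε < |c' - c| :=
      fun c' hc' hne => hεε.trans_le (hiso c' hc' hne)
    have := HB.muEq (hpos T) (DampedGraph.HasBoxCounts.notMem_frontier_Ioo hε hc')
    rwa [DampedGraph.HasBoxCounts.abscissaCount_Ioo hε hc', hcardR] at this
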